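/- Let $(C,o)$ be a reduced complex analytic curve germ with $r\ge 1$ irreducible components, with local algebra $\mathcal O$, normalization $\overline{\mathcal O}=\prod_{i=1}^r\mathbb C\{t_i\}\supset\mathcal O$, delta invariant $\delta(C,o)=\dim_{\mathbb C}\overline{\mathcal O}/\mathcal O$, and conductor $c\in\mathbb Z_{\ge0}^r$, i.e. $(\mathcal O:\overline{\mathcal O})=(t_1^{c_1},\dots,t_r^{c_r})\overline{\mathcal O}$. For $l\in\mathbb Z_{\geq 0}^r$ let $\mathfrak h(l)=\dim_{\mathbb C}\mathcal O/\{f\in\mathcal O:\operatorname{ord}_{t_i}f\ge l_i\ \forall i\}$, $|l|=\sum_i l_i$ and $w(l)=2\mathfrak h(l)-|l|$; let $m_w=\min_l w(l)$. For $I\subset\{1,\dots,r\}$ the cube $(l,I)$ of dimension $|I|$ has the vertices $l+\sum_{i\in I'}E_i$, $I'\subset I$; its weight $w((l,I))$ is the maximum of $w$ over its vertices. $S_n$ is the union of all cubes of $(\mathbb R_{\ge0})^r$ of weight at most $n$, and $\mathfrak X_{-d}$ is the union of all cubes $(l,I)$ with $|l|\ge d$. Homology of cubical complexes is cubical homology with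 integer coefficients, and $\chi_{top}$ is the alternating sum of its ranks. The lattice homology $\mathbb H_*(C,o)$ is the homology of the complex of free $\mathbb Z[U]$-modules on the cubes with the differential $\partial_w\square=\sum_k\varepsilon_kU^{w(\square)-w(\square_k)}\square_k$ (where $\partial\square=\sum_k\varepsilon_k\square_k$ is the cubical boundary), graded by $\deg(U^m\square)=-2m-2w(\square)$. $\mathbb H_{*,red}$ is the homology of the same complex augmented by $U^ml\mapsto U^{m+w(l)}$ on lattice points $l$, and $eu(\mathbb H_*)=-m_w+\sum_b(-1)^b\operatorname{rank}_{\mathbb Z}\mathbb H_{b,red}$. For every $n$ let $(E^k_{-d,q})_n$, $1\le k\le\infty$, be the spectral sequence of the filtration $\{S_n\cap\mathfrak X_{-d}\}_{d\ge0}$ of $S_n$ (defined by the filtered cubical chain complex, with $(E^\infty_{-d,q})_n$ the quotient of the image of $H_{-d+q}(S_n\cap\mathfrak X_{-d})$ in $H_{-d+q}(S_n)$ by the image of $H_{-d+q}(S_n\cap\mathfrak X_{-d-1})$), and let $$PE_\infty(T,Q,h)=\sum_{d,q,n}\operatorname{rank}(E^\infty_{-d,q})_n\,T^dQ^nh^{-d+q}.$$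 Then all these objects are well defined: $\overline{\mathcal O}/\mathcal O$, all $\mathcal O/\{f\in\mathcal O:\operatorname{ord}_{t_i}f\ge l_i\ \forall i\}$ have finite dimension, $c$ and $m_w$ exist, each $S_n$ has finitely many cubes, for each $n$ the pages stabilize to $E^\infty$ after finitely many steps, all homogeneous parts of $\mathbb H_b$ and all $\mathbb H_{b,red}$ are finitely generated over $\mathbb Z$, the powers of $Q$ in $PE_\infty$ are bounded below, and the coefficient of each $Q^n$ is a polynomial in $T,h$. Moreover: (a) $PE_\infty(1,Q,h)=\sum_{n\ge m_w}\big(\sum_b\operatorname{rank}H_b(S_n,\mathbb Z)\,h^b\big)Q^n=\sum_{n,b}\operatorname{rank}\,(\mathbb H_b(C,o))_{-2n}\,Q^nh^b$, the Poincaré series of $\mathbb H_*(C,o)$. (b) $PE_\infty(1,Q,-1)=\sum_{n\ge m_w}\chi_{top}(S_n)\,Q^n$. (c) For every lattice point $c'\ge c$, with $R(0,c')=\{x:0\le x\le c'\}$, $$PE_\infty(1,Q,-1)=\frac1{1-Q}\sum_{\square_q\subset R(0,c')}(-1)^qQ^{w(\square_q)},$$ where the sum is over all cubes in $R(0,c')$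 and $q=\dim\square_q$. (d) The series $PE_\infty(1,Q,-1)$ converges for complex $Q$ with $0<|Q|<1$, and $$\lim_{Q\to1}\Big(PE_\infty(1,Q,-1)-\frac1{1-Q}\Big)=eu(\mathbb H_*(C,o))=\delta(C,o),$$ where the limit is taken in the disc $|Q|<1$, and also, for the rational function of (c), in $\mathbb C\setminus\{1\}$. (e) Write $P\ge P'$ if all coefficients of $P-P'$ are nonnegative. Then $PE_\infty(1,Q,h)\ge PE_\infty(1,Q,0)\ge\frac1{1-Q}=\sum_{n\ge0}Q^n$, and $PE_\infty(1,Q,0)-\frac1{1-Q}$ has only finitely many nonzero coefficients. -/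

import Mathlib

noncomputable section

namespace LatticeHomology

open Filter Topology

section Subquot

variable {R M : Type*} [CommRing R] [AddCommGroup M] [Module R M]

/-- The subquotient `Z / (Z ∩ B)` of a module. -/
def Subquot (Z B : Submodule R M) : Type _ := ↥Z ⧸ B.submoduleOf Z

instance (Z B : Submodule R M) : AddCommGroup (Subquot Z B) :=
  inferInstanceAs (AddCommGroup (↥Z ⧸ B.submoduleOf Z))

instance (Z B : Submodule R M) : Module R (Subquot Z B) :=
  inferInstanceAs (Module R (↥Z ⧸ B.submoduleOf Z))

/-- The class of an element of `Z` in `Z / (Z ∩ B)`. -/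
def Subquot.mk (Z B : Submodule R M) : ↥Z →ₗ[R] Subquot Z B := (B.submoduleOf Z).mkQ

end Subquot

/-! ### Germs of holomorphic functions and curve germs -/

instance germAlgebra {α : Type*} (l : Filter α) : Algebra ℂ (Germ l ℂ) :=
  Algebra.ofModule
    (fun r x y => by
      induction x using Germ.inductionOn
      induction y using Germ.inductionOn
      rename_i f g
      exact congrArg (fun u : α → ℂ => (u : Germ l ℂ)) (smul_mul_assoc r f g))
    (fun r x y => by
      induction x using Germ.inductionOn
      induction y using Germ.inductionOn
      rename_i f g
      exact congrArg (fun u : α → ℂ => (u : Germ l ℂ)) (mul_smul_comm r f g))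

/-- The local ring `𝒪_{E,0}` of germs at the origin of holomorphic functions on the complex
normed space `E`: for `E = ℂ^N` it is the ring of convergent power series `ℂ{x₁, …, x_N}`,
and for `E = ℂ` it is `ℂ{t}`. -/
def holoGerm (E : Type*) [NormedAddCommGroup E] [NormedSpace ℂ E] :
    Subalgebra ℂ (Germ (𝓝 (0 : E)) ℂ) where
  carrier := {g | ∃ f : E → ℂ, AnalyticAt ℂ f 0 ∧ (f : Germ (𝓝 (0 : E)) ℂ) = g}
  mul_mem' := by
    rintro _ _ ⟨f, hf, rfl⟩ ⟨g, hg, rfl⟩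
    exact ⟨f * g, hf.mul hg, rfl⟩
  add_mem' := by
    rintro _ _ ⟨f, hf, rfl⟩ ⟨g, hg, rfl⟩
    exact ⟨f + g, hf.add hg, rfl⟩
  algebraMap_mem' := by
    intro c
    refine ⟨c • (1 : E → ℂ), (analyticAt_const (v := c • (1 : ℂ))), ?_⟩
    rw [Algebra.algebraMap_eq_smul_one]
    rfl

/-- The `t`-adic order of a germ in one variable (`⊤` for the zero germ). -/
def ord (g : Germ (𝓝 (0 : ℂ)) ℂ) : ℕ∞ :=
  Germ.liftOn g (fun f => analyticOrderAt f 0) (fun _ _ h => analyticOrderAt_congr h)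

/-- The ring `∏ᵢ ℂ{tᵢ}` with `r` factors. -/
abbrev Branches (r : ℕ) : Type := Fin r → holoGerm ℂ

/-- A germ `(C, o)` of a reduced complex analytic curve with `r` irreducible components,
together with its normalization. The germ is embedded in `(ℂ^N, 0)` by the ideal `I`, so that its
local algebra is `𝒪 = ℂ{x₁, …, x_N} / I`; the map `ν : 𝒪 → ∏ᵢ ℂ{tᵢ}` exhibits `∏ᵢ ℂ{tᵢ}` as the
integral closure of `𝒪` in its total ring of fractions: it is injective, the target is integral
over the image, and each element of the target is a fraction of elements of the image. -/
structure CurveGerm (r : ℕ) where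
  /-- embedding dimension of the chosen embedding -/
  N : ℕ
  /-- the ideal of the germ -/
  I : Ideal (holoGerm (Fin N → ℂ))
  /-- the point `o` lies on `C` -/
  I_ne_top : I ≠ ⊤
  /-- pull-back of functions under the normalization map -/
  ν : (holoGerm (Fin N → ℂ) ⧸ I) →ₐ[ℂ] Branches r
  ν_injective : Function.Injective ν
  ν_integral : ∀ y : Branches r, ∃ p : Polynomial (holoGerm (Fin N → ℂ) ⧸ I),
    p.Monic ∧ p.eval₂ ν.toRingHom y = 0
  ν_birational : ∀ y : Branches r, ∃ a b : holoGerm (Fin N → ℂ) ⧸ I,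
    ν b ∈ nonZeroDivisors (Branches r) ∧ ν b * y = ν a

theorem ord_smul (c : ℂ) (g : holoGerm ℂ) : ord g ≤ ord (c • g : holoGerm ℂ) := by
  obtain ⟨_, f, hf, rfl⟩ := g
  change analyticOrderAt f 0 ≤ analyticOrderAt (fun z => c * f z) 0
  have := analyticOrderAt_mul (f := fun _ : ℂ => c) (g := f) (z₀ := 0) analyticAt_const hf
  change analyticOrderAt (fun z => c * f z) 0 = _ at this
  rw [this]
  exact le_add_self

theorem ord_add (g g' : holoGerm ℂ) : min (ord g) (ord g') ≤ ord (g + g' : holoGerm ℂ) := by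
  obtain ⟨_, f, hf, rfl⟩ := g
  obtain ⟨_, f', hf', rfl⟩ := g'
  exact le_analyticOrderAt_add

/-- `{g : 𝔳ᵢ(g) ≥ lᵢ for all i}`, the valuative filtration of `∏ᵢ ℂ{tᵢ}`. -/
def barF {r : ℕ} (l : Fin r → ℕ) : Submodule ℂ (Branches r) where
  carrier := {g | ∀ i, (l i : ℕ∞) ≤ ord (g i)}
  zero_mem' := fun i => by
    have : ord ((0 : Branches r) i) = ⊤ := by
      change analyticOrderAt (0 : ℂ → ℂ) 0 = ⊤
      simp [analyticOrderAt_eq_top]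
    rw [this]
    exact le_top
  add_mem' := fun ha hb i => (le_min (ha i) (hb i)).trans (ord_add _ _)
  smul_mem' := fun c _ ha i => (ha i).trans (ord_smul c _)

namespace CurveGerm

variable {r : ℕ} (C : CurveGerm r)

/-- The local algebra `𝒪`, as a subalgebra of its normalization `∏ᵢ ℂ{tᵢ}`. -/
def O : Subalgebra ℂ (Branches r) := C.ν.range

/-- The delta invariant `δ(C, o) = dim_ℂ (∏ᵢ ℂ{tᵢ} / 𝒪)`. -/
def delta : ℕ := Module.finrank ℂ (Branches r ⧸ C.O.toSubmodule)

/-- The ideal filtration `ℱ(l) = {f ∈ 𝒪 : 𝔳ᵢ(f) ≥ lᵢ for all i}` of `𝒪`. -/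
def F (l : Fin r → ℕ) : Submodule ℂ (Branches r) := barF l ⊓ C.O.toSubmodule

/-- The Hilbert function `𝔥(l) = dim_ℂ 𝒪 / ℱ(l)`. -/
def hilb (l : Fin r → ℕ) : ℕ := Module.finrank ℂ (Subquot C.O.toSubmodule (C.F l))

/-- The weight `w₀(l) = 2 𝔥(l) - |l|` of a lattice point. -/
def w₀ (l : Fin r → ℕ) : ℤ := 2 * (C.hilb l : ℤ) - ∑ i, (l i : ℤ)

/-- The conductor ideal `(𝒪 : ∏ᵢ ℂ{tᵢ})`. -/
def conductorIdeal : Set (Branches r) := {g | ∀ y : Branches r, g * y ∈ C.O}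

/-- The conductor `c = (c₁, …, c_r)`, the exponent vector of the conductor ideal. -/
def conductor (i : Fin r) : ℕ := sInf {k : ℕ | ∃ g ∈ C.conductorIdeal, ord (g i) = k}

end CurveGerm

/-! ### Cubes, weights and lattice homology -/

/-- The cube `(l, I)` of `(ℝ_{≥ 0})^r`: its vertices are `l + ∑_{i ∈ I'} Eᵢ` for `I' ⊆ I`. -/
abbrev Cube (r : ℕ) : Type := (Fin r → ℕ) × Finset (Fin r)

variable {r : ℕ}

/-- `|l| = ∑ lᵢ` for the left-lower vertex `l` of a cube. -/
def level (c : Cube r) : ℕ := ∑ i, c.1 i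

/-- The lattice point `l + ∑_{i ∈ J} Eᵢ`. -/
def shift (l : Fin r → ℕ) (J : Finset (Fin r)) : Fin r → ℕ := fun i => l i + if i ∈ J then 1 else 0

/-- The weight of a cube: the maximum of the weights of its vertices. -/
def weight (w₀ : (Fin r → ℕ) → ℤ) (c : Cube r) : ℤ :=
  c.2.powerset.sup' ⟨∅, Finset.empty_mem_powerset _⟩ (fun J => w₀ (shift c.1 J))

/-- The face of a cube `(l, I)` on the side `xᵢ = lᵢ` (for `i ∈ I`). -/
def lowerFace (c : Cube r) (i : Fin r) : Cube r := (c.1, c.2.erase i)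

/-- The face of a cube `(l, I)` on the side `xᵢ = lᵢ + 1` (for `i ∈ I`). -/
def upperFace (c : Cube r) (i : Fin r) : Cube r := (shift c.1 {i}, c.2.erase i)

/-- The sign `(-1)^{#{j ∈ I : j < i}}`. -/
def sgn (c : Cube r) (i : Fin r) : ℤ := (-1) ^ (c.2.filter (· < i)).card

/-- Integral cubical chains of `(ℝ_{≥ 0})^r`, in all dimensions together. -/
abbrev Chains (r : ℕ) : Type := Cube r →₀ ℤ

/-- The boundary operator of cubical homology. -/
def bdry : Chains r →ₗ[ℤ] Chains r :=
  Finsupp.linearCombination ℤ fun c : Cube r => ∑ i ∈ c.2,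
    sgn c i • (Finsupp.single (upperFace c i) (1 : ℤ) - Finsupp.single (lowerFace c i) 1)

/-- The cubical complex `S_n`, given by its set of cubes: all cubes of weight at most `n`. -/
def S (w₀ : (Fin r → ℕ) → ℤ) (n : ℤ) : Set (Cube r) := {c | weight w₀ c ≤ n}

/-- The `b`-dimensional chains supported on a set of cubes. -/
def chainsOn (A : Set (Cube r)) (b : ℕ) : Submodule ℤ (Chains r) :=
  Finsupp.supported ℤ ℤ {c | c ∈ A ∧ c.2.card = b}

/-- The homology `H_b(A, ℤ)` of a cubical complex `A` (cycles modulo boundaries). -/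
abbrev H (A : Set (Cube r)) (b : ℕ) : Type :=
  Subquot (chainsOn A b ⊓ LinearMap.ker bdry) ((chainsOn A (b + 1)).map bdry)

/-- The topological Euler characteristic of a (finite) cubical complex: the alternating sum of its
Betti numbers. There are no cubes of dimension bigger than `r`. -/
def chiTop (A : Set (Cube r)) : ℤ :=
  ∑ b ∈ Finset.range (r + 1), (-1) ^ b * (Module.finrank ℤ (H A b) : ℤ)

/-- The minimum `m_w` of the weights. -/
def minW (w₀ : (Fin r → ℕ) → ℤ) : ℤ := sInf (Set.range w₀)

/-- The module `ℒ = 𝒞 ⊗ ℤ[U]`, in all dimensions together. -/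
abbrev L (r : ℕ) : Type := Cube r →₀ Polynomial ℤ

/-- `ℒ_b`, spanned over `ℤ[U]` by the `b`-dimensional cubes. -/
def Lb (r b : ℕ) : Submodule (Polynomial ℤ) (L r) :=
  Finsupp.supported (Polynomial ℤ) (Polynomial ℤ) {c | c.2.card = b}

/-- The `ℤ[U]`-linear operator
`∂_w □ = ∑_k ε_k U^{w(□) - w(□_k)} □_k`, the sum being over the faces of `□`. -/
def bdryW (w₀ : (Fin r → ℕ) → ℤ) : L r →ₗ[Polynomial ℤ] L r :=
  Finsupp.linearCombination (Polynomial ℤ) fun c : Cube r => ∑ i ∈ c.2,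
    sgn c i •
      (Finsupp.single (upperFace c i)
          ((Polynomial.X : Polynomial ℤ) ^ (weight w₀ c - weight w₀ (upperFace c i)).toNat) -
        Finsupp.single (lowerFace c i)
          ((Polynomial.X : Polynomial ℤ) ^ (weight w₀ c - weight w₀ (lowerFace c i)).toNat))

/-- The cycles of `(ℒ, ∂_w)` of dimension `b`. -/
def cyclesW (w₀ : (Fin r → ℕ) → ℤ) (b : ℕ) : Submodule (Polynomial ℤ) (L r) :=
  Lb r b ⊓ LinearMap.ker (bdryW w₀)

/-- The boundaries of `(ℒ, ∂_w)` of dimension `b`. -/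
def boundariesW (w₀ : (Fin r → ℕ) → ℤ) (b : ℕ) : Submodule (Polynomial ℤ) (L r) :=
  (Lb r (b + 1)).map (bdryW w₀)

/-- The lattice homology `ℍ_b`, a `ℤ[U]`-module. -/
abbrev HH (w₀ : (Fin r → ℕ) → ℤ) (b : ℕ) : Type :=
  Subquot (cyclesW w₀ b) (boundariesW w₀ b)

/-- The homogeneous elements of `ℒ` of degree `D`, where `deg (U^m □) = -2m - 2w(□)`. -/
def LDeg (w₀ : (Fin r → ℕ) → ℤ) (D : ℤ) : AddSubgroup (L r) where
  carrier := {x | ∀ (c : Cube r) (m : ℕ), -2 * (m : ℤ) - 2 * weight w₀ c ≠ D → (x c).coeff m = 0}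
  zero_mem' := by intro c m _; simp
  add_mem' := by
    intro x y hx hy c m h
    simp [hx c m h, hy c m h]
  neg_mem' := by
    intro x hx c m h
    simp [hx c m h]

/-- The homogeneous part `(ℍ_b)_D`: the classes of the homogeneous cycles of degree `D`. -/
def HHDeg (w₀ : (Fin r → ℕ) → ℤ) (b : ℕ) (D : ℤ) : AddSubgroup (HH w₀ b) where
  carrier := {ξ | ∃ z : cyclesW w₀ b, (z : L r) ∈ LDeg w₀ D ∧ Subquot.mk _ _ z = ξ}
  zero_mem' := ⟨0, (LDeg w₀ D).zero_mem, map_zero _⟩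
  add_mem' := by
    rintro _ _ ⟨x, hx, rfl⟩ ⟨y, hy, rfl⟩
    exact ⟨x + y, (LDeg w₀ D).add_mem hx hy, map_add _ _ _⟩
  neg_mem' := by
    rintro _ ⟨x, hx, rfl⟩
    exact ⟨-x, (LDeg w₀ D).neg_mem hx, (Subquot.mk _ _).map_neg x⟩

/-- The augmentation `ε_w (U^m l) = U^{m + w₀(l)}` (extended by zero to cubes of positive
dimension), with values in `ℤ[U, U⁻¹]`. -/
def augW (w₀ : (Fin r → ℕ) → ℤ) : L r →ₗ[Polynomial ℤ] LaurentPolynomial ℤ :=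
  Finsupp.linearCombination (Polynomial ℤ) fun c : Cube r =>
    if c.2 = ∅ then LaurentPolynomial.T (w₀ c.1) else 0

/-- The cycles of dimension `b` of the augmented complex `⋯ → ℒ₁ → ℒ₀ → ℤ[U, U⁻¹]`. -/
def redCyclesW (w₀ : (Fin r → ℕ) → ℤ) (b : ℕ) : Submodule (Polynomial ℤ) (L r) :=
  if b = 0 then Lb r 0 ⊓ LinearMap.ker (augW w₀) else cyclesW w₀ b

/-- The reduced lattice homology `ℍ_{b,red}`. -/
abbrev HHred (w₀ : (Fin r → ℕ) → ℤ) (b : ℕ) : Type :=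
  Subquot (redCyclesW w₀ b) (boundariesW w₀ b)

/-- The Euler characteristic `eu(ℍ_*) = -min w₀ + ∑_b (-1)^b rank_ℤ ℍ_{b,red}`. -/
def eu (w₀ : (Fin r → ℕ) → ℤ) : ℤ :=
  -minW w₀ + ∑ b ∈ Finset.range (r + 1), (-1) ^ b * (Module.finrank ℤ (HHred w₀ b) : ℤ)

/-! ### The level filtration and its spectral sequence -/

/-- `S_n ∩ 𝔛_{-d}`: the cubes `(l, I)` of `S_n` with `|l| ≥ d`. For `d = ⊤` it is empty. -/
def SX (w₀ : (Fin r → ℕ) → ℤ) (n : ℤ) (d : ℕ∞) : Set (Cube r) :=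
  {c | c ∈ S w₀ n ∧ d ≤ (level c : ℕ∞)}

/-- `Z^k_{-d}` in dimension `b`: the chains of `S_n ∩ 𝔛_{-d}` whose boundary lies
in `S_n ∩ 𝔛_{-d-k}`. For `k = ⊤` these are the cycles of `S_n ∩ 𝔛_{-d}`. -/
def pageZ (w₀ : (Fin r → ℕ) → ℤ) (n : ℤ) (k d : ℕ∞) (b : ℕ) : Submodule ℤ (Chains r) :=
  chainsOn (SX w₀ n d) b ⊓ (Finsupp.supported ℤ ℤ (SX w₀ n (d + k))).comap bdry

/-- `B^k_{-d}` in dimension `b`: the chains of `S_n ∩ 𝔛_{-d}` that are boundaries of chains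
of `S_n ∩ 𝔛_{-d+k-1}` (where `𝔛_e = 𝔛` for `e ≥ 0`). For `k = ⊤` these are all the chains of
`S_n ∩ 𝔛_{-d}` that are boundaries in `S_n`. -/
def pageB (w₀ : (Fin r → ℕ) → ℤ) (n : ℤ) (k d : ℕ∞) (b : ℕ) : Submodule ℤ (Chains r) :=
  chainsOn (SX w₀ n d) b ⊓ (chainsOn (SX w₀ n (d - (k - 1))) (b + 1)).map bdry

/-- The term `(E^k_{-d,q})_n`, `b = -d + q`, of the `k`-th page (`1 ≤ k ≤ ∞`) of the spectral
sequence of the filtration `{S_n ∩ 𝔛_{-d}}_d` of `S_n`, that is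
`Z^k_{-d} / (Z^{k-1}_{-d-1} + B^k_{-d})`, where `Z^{k-1}_{-d-1}` consists of the elements of
`Z^k_{-d}` that are chains of `S_n ∩ 𝔛_{-d-1}`. For `k = ⊤` this is the quotient of the image of
`H_b(S_n ∩ 𝔛_{-d})` in `H_b(S_n)` by the image of `H_b(S_n ∩ 𝔛_{-d-1})`. -/
abbrev Page (w₀ : (Fin r → ℕ) → ℤ) (n : ℤ) (k : ℕ∞) (d b : ℕ) : Type :=
  Subquot (pageZ w₀ n k d b)
    ((pageZ w₀ n k d b ⊓ chainsOn (SX w₀ n ((d : ℕ∞) + 1)) b) ⊔ pageB w₀ n k d b)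

/-! ### Series -/

/-- The formal Laurent series `∑_n a_n Q^n`; the coefficients `a_n` have to vanish
for `n` small enough. -/
def laurent {R : Type*} [Zero R] (a : ℤ → R) : LaurentSeries R :=
  open Classical in
  if h : BddBelow (Function.support a) then HahnSeries.ofSuppBddBelow a h else 0

/-- `1 / (1 - Q) = ∑_{n ≥ 0} Q^n`. -/
def geom : LaurentSeries ℤ := HahnSeries.ofPowerSeries ℤ ℤ (PowerSeries.mk 1)

theorem one_sub_mul_geom : (1 - HahnSeries.single 1 1) * geom = 1 := by
  have h : (1 - HahnSeries.single 1 1 : LaurentSeries ℤ) =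
      HahnSeries.ofPowerSeries ℤ ℤ (1 - PowerSeries.X) := by
    rw [(HahnSeries.ofPowerSeries ℤ ℤ).map_sub, (HahnSeries.ofPowerSeries ℤ ℤ).map_one,
      HahnSeries.ofPowerSeries_X]
  rw [h, geom, ← map_mul, mul_comm, PowerSeries.mk_one_mul_one_sub_eq_one,
    (HahnSeries.ofPowerSeries ℤ ℤ).map_one]

/-- The coefficient `∑_{d,b} rank (E^k_{-d,b+d})_n T^d h^b` of `Q^n` in `PE_k(T, Q, h)`. -/
def PEcoeff (w₀ : (Fin r → ℕ) → ℤ) (k : ℕ∞) (n : ℤ) : PowerSeries (Polynomial ℤ) :=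
  PowerSeries.mk fun d => ∑ b ∈ Finset.range (r + 1),
    Polynomial.monomial b (Module.finrank ℤ (Page w₀ n k d b) : ℤ)

/-- The Poincaré series `PE_k(T, Q, h)` of the `k`-th page, as a Laurent series in `Q` whose
coefficients are power series in `T` over `ℤ[h]`. -/
def PE (w₀ : (Fin r → ℕ) → ℤ) (k : ℕ∞) : LaurentSeries (PowerSeries (Polynomial ℤ)) :=
  laurent (PEcoeff w₀ k)

/-- Substitution of `T = 1` in a Laurent series in `Q` whose coefficients are
polynomials in `T` (presented as power series). -/
def atTOne {R : Type*} [Semiring R] (P : LaurentSeries (PowerSeries R)) : LaurentSeries R :=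
  laurent fun n => ∑ᶠ d : ℕ, PowerSeries.coeff d (P.coeff n)

/-- Substitution of `h = a`. -/
def atH (a : ℤ) (P : LaurentSeries (Polynomial ℤ)) : LaurentSeries ℤ :=
  HahnSeries.map P (Polynomial.evalRingHom a)

/-- A series in `Q` considered as a series in `Q` and `h`. -/
def constH (P : LaurentSeries ℤ) : LaurentSeries (Polynomial ℤ) :=
  HahnSeries.map P (Polynomial.C : ℤ →+* Polynomial ℤ)

/-- `P ≥ P'`: all coefficients of `P - P'` are nonnegative. -/
def SeriesGE (P P' : LaurentSeries (Polynomial ℤ)) : Prop :=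
  ∀ (n : ℤ) (b : ℕ), 0 ≤ ((P - P').coeff n).coeff b

/-- The cubes contained in the rectangle `R(0, c')`. -/
def rectCubes (c' : Fin r → ℕ) : Finset (Cube r) :=
  open Classical in
  (Finset.Iic c' ×ˢ Finset.univ).filter fun c => shift c.1 c.2 ≤ c'

/-- The Laurent polynomial `∑_{□ ⊂ R(0, c')} (-1)^{dim □} Q^{w(□)}`. -/
def rectEuler (w₀ : (Fin r → ℕ) → ℤ) (c' : Fin r → ℕ) : LaurentSeries ℤ :=
  ∑ c ∈ rectCubes c', HahnSeries.single (weight w₀ c) ((-1) ^ c.2.card)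

/-- The sum at the complex number `Q` of a Laurent series with integral coefficients. -/
def evalAt (P : LaurentSeries ℤ) (Q : ℂ) : ℂ := ∑' n : ℤ, (P.coeff n : ℂ) * Q ^ n

end LatticeHomology

end

open LatticeHomology Filter Topology

/-! The curve enters only through its Hilbert function 𝔥. Weierstrass division shows that the
normalization is a finite 𝒪-module, and a common denominator of its generators gives a conductor
that is nonzero on every branch (`exists_barF_le`). This yields the axioms of `IsHilbertFunction`:
unit steps raise 𝔥 by 0 or 1, a jump at m in direction i persists at smaller l with the same i-th
coordinate, every step beyond the conductor exponent is a jump, and |l| - 𝔥(l) = δ for l ≥ c.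

The jump axiom makes 𝔥 behave like a matroid rank on each cube, whence w((l,I)) = 𝔥(l) + 𝔥(l+E_I) -
|l| (`weight_eq`). So for l_i ≥ c_i and i ∉ I the cubes (l, I ∪ {i}) and (l+E_i, I) have the same
weight. As a cancellation, this pairing removes all cubes outside R(0,c'), c' ≥ c, from the Euler
characteristic of S_n, which gives (c). As a collapse, it pushes cycles of S_n into R(0,c), and from
there to the origin once S_n contains all of R(0,c); thus S_n is acyclic for large n (`acyclic`).

The page E^∞ is the graded module of a filtration of H_b(S_n), so its ranks telescope to Betti
numbers. The exponents of U in ∂_w make the degree -2n part of ℒ a copy of the chains of S_n.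
Together these give (a) and (b), and reduced lattice homology becomes a finite sum of reduced
homologies of the S_n.

For (d), the weight is a function of the lower vertex plus a function of the upper vertex.
Alternating sums of such functions over R(0,c') collapse to their values at c' and at 0, so the sum
of (-1)^q w(□) is 𝔥(c') - |c'| + 𝔥(0) = -δ. Summing χ(S_n) - 1 over n then gives eu = δ, and the
limit is minus the derivative at Q = 1 of the Laurent polynomial of (c), whose value there is 1. For
(e), S_n is nonempty for n ≥ 0 because w(0) = 0, and it is acyclic for large n. -/

noncomputable section

open LatticeHomology Filter Topology

namespace LatticeHomology

/-! ### Germs of holomorphic functions and substitution into convergent series. -/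

section GermRing

variable {E : Type*} [NormedAddCommGroup E] [NormedSpace ℂ E]

/-- The germ at the origin of a function analytic there. -/
def germOf (f : E → ℂ) (hf : AnalyticAt ℂ f 0) : holoGerm E := ⟨(f : Germ (𝓝 (0 : E)) ℂ), f, hf, rfl⟩

theorem exists_germOf (g : holoGerm E) : ∃ f hf, g = germOf f hf := by
  obtain ⟨_, f, hf, rfl⟩ := g
  exact ⟨f, hf, rfl⟩

theorem germOf_eq_iff {f g : E → ℂ} {hf : AnalyticAt ℂ f 0} {hg : AnalyticAt ℂ g 0} :
    germOf f hf = germOf g hg ↔ f =ᶠ[𝓝 0] g :=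
  Subtype.ext_iff.trans Germ.coe_eq

theorem germOf_mul {f g : E → ℂ} (hf : AnalyticAt ℂ f 0) (hg : AnalyticAt ℂ g 0) :
    germOf f hf * germOf g hg = germOf (fun z => f z * g z) (hf.mul hg) := rfl

theorem germOf_add {f g : E → ℂ} (hf : AnalyticAt ℂ f 0) (hg : AnalyticAt ℂ g 0) :
    germOf f hf + germOf g hg = germOf (fun z => f z + g z) (hf.add hg) := rfl

theorem germOf_sub {f g : E → ℂ} (hf : AnalyticAt ℂ f 0) (hg : AnalyticAt ℂ g 0) :
    germOf f hf - germOf g hg = germOf (fun z => f z - g z) (hf.sub hg) := rfl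

theorem smul_germOf {f : E → ℂ} (c : ℂ) (hf : AnalyticAt ℂ f 0) :
    c • germOf f hf = germOf (fun z => c * f z) (analyticAt_const.mul hf) := rfl

theorem germOf_zero : (0 : holoGerm E) = germOf (fun _ => 0) analyticAt_const := rfl

theorem germOf_one : (1 : holoGerm E) = germOf (fun _ => 1) analyticAt_const := rfl

theorem germOf_pow {f : E → ℂ} (hf : AnalyticAt ℂ f 0) (n : ℕ) :
    germOf f hf ^ n = germOf (fun z => f z ^ n) (hf.pow n) := by
  induction n with
  | zero => simp only [pow_zero]; rfl
  | succ n ih => simp only [pow_succ, ih]; rfl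

theorem sum_germOf {ι : Type*} (s : Finset ι) {f : ι → E → ℂ} (hf : ∀ i, AnalyticAt ℂ (f i) 0) :
    ∑ i ∈ s, germOf (f i) (hf i) =
      germOf (fun z => ∑ i ∈ s, f i z) (Finset.analyticAt_fun_sum s fun i _ => hf i) := by
  classical
  induction s using Finset.induction_on with
  | empty => simp only [Finset.sum_empty]; rfl
  | insert a s ha ih =>
    rw [Finset.sum_insert ha, ih, germOf_add, germOf_eq_iff]
    exact Eventually.of_forall fun z => by simp [Finset.sum_insert ha]

/-- The value of a germ at the origin. -/
def valueHom : holoGerm E →+* ℂ :=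
  (Germ.valueRingHom (x := (0 : E)) (E := ℂ)).comp (holoGerm E).val.toRingHom

theorem valueHom_germOf {f : E → ℂ} (hf : AnalyticAt ℂ f 0) : valueHom (germOf f hf) = f 0 := rfl

theorem valueHom_smul (c : ℂ) (g : holoGerm E) : valueHom (c • g) = c * valueHom g := by
  obtain ⟨f, hf, rfl⟩ := exists_germOf g
  rfl

theorem isUnit_of_valueHom_ne_zero {g : holoGerm E} (h : valueHom g ≠ 0) : IsUnit g := by
  obtain ⟨f, hf, rfl⟩ := exists_germOf g
  rw [valueHom_germOf] at h
  refine IsUnit.of_mul_eq_one (germOf (fun z => (f z)⁻¹) (hf.fun_inv h)) ?_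
  rw [germOf_mul, germOf_one, germOf_eq_iff]
  filter_upwards [hf.continuousAt.eventually_ne h] with z hz
  exact mul_inv_cancel₀ hz

/-- Substitution of a germ in a convergent power series, characterised by congruences. -/
theorem exists_subst (a : holoGerm E) (ha : valueHom a = 0) (c : ℕ → ℂ) (A K : ℝ)
    (hc : ∀ q, ‖c q‖ ≤ A * K ^ q) :
    ∃ φ : holoGerm E, ∀ Q, a ^ Q ∣ φ - ∑ q ∈ Finset.range Q, c q • a ^ q := by
  obtain ⟨f, hf, rfl⟩ := exists_germOf a
  rw [valueHom_germOf] at ha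
  -- `K` may be nonpositive; `K'` is a positive replacement whose inverse serves as a radius.
  set K' : ℝ := |K| + 1
  have hK' : 0 < K' := by positivity
  have hA : 0 ≤ A := by
    have := (norm_nonneg _).trans (hc 0)
    simpa using this
  have hc' : ∀ q, ‖c q‖ ≤ A * K' ^ q := fun q => (hc q).trans <| by
    refine mul_le_mul_of_nonneg_left ?_ hA
    calc K ^ q ≤ |K ^ q| := le_abs_self _
      _ = |K| ^ q := abs_pow _ _
      _ ≤ K' ^ q := pow_le_pow_left₀ (abs_nonneg _) (by simp [K']) _
  have hsum : ∀ (Q : ℕ) (z : ℂ), ‖z‖ < K'⁻¹ → Summable fun q => c (q + Q) * z ^ q := by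
    intro Q z hz
    have hlt : K' * ‖z‖ < 1 := by
      calc K' * ‖z‖ < K' * K'⁻¹ := by gcongr
        _ = 1 := mul_inv_cancel₀ hK'.ne'
    refine Summable.of_norm_bounded (g := fun q => A * K' ^ Q * (K' * ‖z‖) ^ q)
      ((summable_geometric_of_lt_one (by positivity) hlt).mul_left _) fun q => ?_
    rw [norm_mul, norm_pow, mul_pow]
    calc ‖c (q + Q)‖ * ‖z‖ ^ q ≤ A * K' ^ (q + Q) * ‖z‖ ^ q := by gcongr; exact hc' _
      _ = _ := by ring
  have han : ∀ Q : ℕ, AnalyticAt ℂ (fun z => ∑' q, c (q + Q) * z ^ q) 0 := by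
    intro Q
    set p : FormalMultilinearSeries ℂ ℂ ℂ := .ofScalars ℂ fun q => c (q + Q)
    have hr : 0 < p.radius := by
      have : ((K'.toNNReal⁻¹ : NNReal) : ENNReal) ≤ p.radius := by
        refine p.le_radius_of_bound (A * K' ^ Q) fun q => ?_
        rw [FormalMultilinearSeries.ofScalars_norm]
        rw [NNReal.coe_inv, Real.coe_toNNReal _ hK'.le, inv_pow, ← div_eq_mul_inv,
          div_le_iff₀ (by positivity)]
        exact (hc' _).trans (le_of_eq (by ring))
      refine lt_of_lt_of_le ?_ this
      simp [hK']
    have := (p.hasFPowerSeriesOnBall hr).analyticAt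
    refine this.congr (Eventually.of_forall fun z => ?_)
    simp only [FormalMultilinearSeries.sum, p, FormalMultilinearSeries.ofScalars_apply_eq]
    refine tsum_congr fun q => ?_
    simp
  have hcomp : ∀ Q : ℕ, AnalyticAt ℂ (fun x => ∑' q, c (q + Q) * f x ^ q) 0 := fun Q =>
    AnalyticAt.fun_comp (g := fun z => ∑' q, c (q + Q) * z ^ q) (by rw [ha]; exact han Q) hf
  -- The quotient by `a ^ Q` is the series with coefficients shifted by `Q`, which converges on the
  -- same disc.
  refine ⟨germOf _ (hcomp 0), fun Q => ⟨germOf _ (hcomp Q), ?_⟩⟩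
  simp only [germOf_pow, smul_germOf]
  rw [sum_germOf, germOf_sub, germOf_mul, germOf_eq_iff]
  have hev : ∀ᶠ x in 𝓝 (0 : E), ‖f x‖ < K'⁻¹ := by
    have : ContinuousAt (fun x => ‖f x‖) 0 := hf.continuousAt.norm
    exact this.eventually_lt continuousAt_const (by simp [ha, hK'])
  filter_upwards [hev] with x hx
  have h0 := hsum 0 (f x) hx
  rw [sub_eq_iff_eq_add, ← tsum_mul_left]
  simp only [add_zero] at h0 ⊢
  rw [← h0.sum_add_tsum_nat_add Q, add_comm]
  congr 1
  refine tsum_congr fun q => ?_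
  ring

end GermRing

/-! ### Orders and divisibility in ℂ{t}. -/

section OneVariable

theorem ord_germOf {f : ℂ → ℂ} (hf : AnalyticAt ℂ f 0) :
    ord (germOf f hf) = analyticOrderAt f 0 := rfl

theorem ord_mul (g g' : holoGerm ℂ) : ord (g * g' : holoGerm ℂ) = ord g + ord g' := by
  obtain ⟨f, hf, rfl⟩ := exists_germOf g
  obtain ⟨f', hf', rfl⟩ := exists_germOf g'
  exact analyticOrderAt_mul hf hf'

theorem ord_eq_top {g : holoGerm ℂ} : ord g = ⊤ ↔ g = 0 := by
  obtain ⟨f, hf, rfl⟩ := exists_germOf g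
  rw [ord_germOf, analyticOrderAt_eq_top, germOf_zero, germOf_eq_iff]
  rfl

theorem ord_zero : ord (0 : holoGerm ℂ) = ⊤ := ord_eq_top.2 rfl

theorem ord_one : ord (1 : holoGerm ℂ) = 0 := by
  rw [germOf_one, ord_germOf, analyticAt_const.analyticOrderAt_eq_zero]
  exact one_ne_zero

theorem ord_pow (g : holoGerm ℂ) (n : ℕ) : ord (g ^ n : holoGerm ℂ) = n * ord g := by
  induction n with
  | zero => simp only [pow_zero, ord_one, Nat.cast_zero, zero_mul]
  | succ n ih => rw [pow_succ, ord_mul, ih, Nat.cast_succ, add_mul, one_mul]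

/-- The coordinate `t`. -/
def tt : holoGerm ℂ := germOf (fun z => z) analyticAt_id

theorem ord_tt : ord tt = 1 := analyticOrderAt_id

theorem ord_tt_pow (n : ℕ) : ord (tt ^ n : holoGerm ℂ) = n := by rw [ord_pow, ord_tt, mul_one]

theorem natCast_le_ord {g : holoGerm ℂ} {n : ℕ} : (n : ℕ∞) ≤ ord g ↔ tt ^ n ∣ g := by
  constructor
  · obtain ⟨f, hf, rfl⟩ := exists_germOf g
    intro h
    rw [ord_germOf, natCast_le_analyticOrderAt hf] at h
    obtain ⟨u, hu, h⟩ := h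
    refine ⟨germOf u hu, ?_⟩
    rw [tt, germOf_pow, germOf_mul, germOf_eq_iff]
    simpa [EventuallyEq] using h
  · rintro ⟨u, rfl⟩
    rw [ord_mul, ord_tt_pow]
    exact le_self_add

theorem ord_eq_zero {g : holoGerm ℂ} : ord g = 0 ↔ valueHom g ≠ 0 := by
  obtain ⟨f, hf, rfl⟩ := exists_germOf g
  exact hf.analyticOrderAt_eq_zero

theorem one_le_ord {g : holoGerm ℂ} : 1 ≤ ord g ↔ valueHom g = 0 := by
  rw [Order.one_le_iff_ne_zero, Ne, ord_eq_zero, not_not]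

theorem exists_unit_of_ord_eq {g : holoGerm ℂ} {n : ℕ} (h : ord g = n) :
    ∃ u : holoGerm ℂ, valueHom u ≠ 0 ∧ g = tt ^ n * u := by
  obtain ⟨u, rfl⟩ := natCast_le_ord.1 h.ge
  refine ⟨u, ?_, rfl⟩
  rw [ord_mul, ord_tt_pow] at h
  rw [← ord_eq_zero]
  rcases eq_or_ne (ord u) ⊤ with h' | h'
  · simp [h'] at h
  · lift ord u to ℕ using h' with k
    norm_cast at h ⊢
    omega

/-- A germ of finite order n is t ^ n times a unit, so the order alone decides divisibility. -/
theorem dvd_of_ord_le {f g : holoGerm ℂ} (h : ord f ≤ ord g) : f ∣ g := by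
  rcases eq_or_ne (ord f) ⊤ with hf | hf
  · rw [hf, top_le_iff, ord_eq_top] at h
    rw [h]
    exact dvd_zero _
  · obtain ⟨n, hn⟩ := ENat.ne_top_iff_exists.1 hf
    obtain ⟨u, hu, rfl⟩ := exists_unit_of_ord_eq hn.symm
    rw [← hn, natCast_le_ord] at h
    exact (isUnit_of_valueHom_ne_zero hu).mul_right_dvd.2 h

theorem ord_le_of_dvd {f g : holoGerm ℂ} (h : f ∣ g) : ord f ≤ ord g := by
  obtain ⟨u, rfl⟩ := h
  rw [ord_mul]
  exact le_self_add

/-- Cancellation of leading terms. -/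
theorem exists_succ_le_ord_sub {f g : holoGerm ℂ} {n : ℕ} (hf : ord f = n) (hg : n ≤ ord g) :
    ∃ a : ℂ, ((n + 1 : ℕ) : ℕ∞) ≤ ord (g - a • f : holoGerm ℂ) := by
  obtain ⟨u, rfl⟩ := dvd_of_ord_le (hf.le.trans hg)
  -- The quotient `u` of `g` by `f`, minus its value at 0, vanishes at 0; this raises the order by
  -- one.
  refine ⟨valueHom u, ?_⟩
  have : f * u - valueHom u • f = f * (u - valueHom u • 1) := by
    rw [mul_sub, mul_smul_comm, mul_one]
  rw [this, ord_mul, hf, Nat.cast_succ]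
  gcongr
  rw [one_le_ord, map_sub, valueHom_smul, map_one, mul_one, sub_self]

/-- The orders of multiples of `f ^ n` tend to infinity. This lets identities with convergent series
be tested by congruences modulo powers. -/
theorem eq_zero_of_forall_pow_dvd {f g : holoGerm ℂ} (hf : 1 ≤ ord f) (h : ∀ n : ℕ, f ^ n ∣ g) :
    g = 0 := by
  rw [← ord_eq_top, ENat.eq_top_iff_forall_ge]
  intro n
  refine le_trans ?_ (ord_le_of_dvd (h n))
  rw [ord_pow]
  exact le_mul_of_one_le_right zero_le hf

end OneVariable

/-! ### Weierstrass division with geometric bounds. -/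

section Division

/-- Iterates `g z = g 0 + z * dslope g 0 z`; the values of the iterates at 0 are the Taylor
coefficients. -/
theorem eq_sum_add_pow_mul_dslope_iterate (g : ℂ → ℂ) (n : ℕ) (z : ℂ) :
    g z = ∑ j ∈ Finset.range n, ((fun g => dslope g 0)^[j] g) 0 * z ^ j +
      z ^ n * ((fun g => dslope g 0)^[n] g) z := by
  induction n with
  | zero => simp
  | succ n ih =>
    have h := sub_smul_dslope ((fun g : ℂ → ℂ => dslope g 0)^[n] g) 0 z
    rw [Finset.sum_range_succ, Function.iterate_succ_apply']
    rw [sub_zero, smul_eq_mul] at h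
    rw [pow_succ, mul_assoc, h]
    linear_combination ih

/-- By the Schwarz lemma each division by z costs a factor `2 / ρ`, since a function differs from
its value at 0 by at most twice its bound. The ball does not shrink, so the step can be repeated
indefinitely. -/
theorem norm_dslope_iterate_le {ρ M : ℝ} (hρ : 0 < ρ) {g : ℂ → ℂ}
    (hg : DifferentiableOn ℂ g (Metric.ball 0 ρ)) (hb : ∀ z ∈ Metric.ball 0 ρ, ‖g z‖ ≤ M) (j : ℕ) :
    DifferentiableOn ℂ ((fun g : ℂ → ℂ => dslope g 0)^[j] g) (Metric.ball 0 ρ) ∧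
      ∀ z ∈ Metric.ball (0 : ℂ) ρ, ‖((fun g : ℂ → ℂ => dslope g 0)^[j] g) z‖ ≤ M * (2 / ρ) ^ j := by
  induction j with
  | zero => simpa using ⟨hg, fun z hz => hb z (by simpa using hz)⟩
  | succ j ih =>
    simp only [Function.iterate_succ_apply']
    refine ⟨(Complex.differentiableOn_dslope (Metric.ball_mem_nhds 0 hρ)).2 ih.1, fun z hz => ?_⟩
    refine (Complex.norm_dslope_le_div_of_mapsTo_ball (R₂ := 2 * (M * (2 / ρ) ^ j)) ih.1
      (fun w hw => ?_) hz).trans (le_of_eq (by ring))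
    rw [mem_closedBall_iff_norm, two_mul]
    exact (norm_sub_le _ _).trans (add_le_add (ih.2 w hw) (ih.2 0 (Metric.mem_ball_self hρ)))

/-- The bound is fixed before the radius and all small radii work, so one radius can serve several
germs. -/
theorem exists_ball_bound {f : ℂ → ℂ} (hf : AnalyticAt ℂ f 0) :
    ∃ M : ℝ, 0 ≤ M ∧ ∀ᶠ ρ in 𝓝[>] (0 : ℝ), DifferentiableOn ℂ f (Metric.ball 0 ρ) ∧
      ∀ z ∈ Metric.ball 0 ρ, ‖f z‖ ≤ M := by
  refine ⟨‖f 0‖ + 1, by positivity, ?_⟩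
  have h1 : ∀ᶠ z in 𝓝 (0 : ℂ), AnalyticAt ℂ f z ∧ ‖f z‖ < ‖f 0‖ + 1 :=
    hf.eventually_analyticAt.and
      (hf.continuousAt.norm.eventually_lt continuousAt_const (by simp))
  obtain ⟨ε, hε, h⟩ := Metric.eventually_nhds_iff_ball.1 h1
  filter_upwards [Ioo_mem_nhdsGT hε] with ρ hρ
  have hsub := Metric.ball_subset_ball (x := (0 : ℂ)) hρ.2.le
  exact ⟨fun z hz => (h z (hsub hz)).1.differentiableAt.differentiableWithinAt,
    fun z hz => (h z (hsub hz)).2.le⟩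

/-- Repeated division with remainder by a germ of order `n`: the coefficients of the remainders
grow at most geometrically. -/
theorem exists_division_sequence {f : holoGerm ℂ} {n : ℕ} (hf : ord f = n) (h : holoGerm ℂ) :
    ∃ (G : ℕ → holoGerm ℂ) (c : ℕ → ℕ → ℂ) (A : ℕ → ℝ) (K : ℝ), G 0 = h ∧
      (∀ j q, ‖c j q‖ ≤ A j * K ^ q) ∧
      ∀ q, G q = ∑ j ∈ Finset.range n, c j q • tt ^ j + f * G (q + 1) := by
  obtain ⟨u, hu, rfl⟩ := exists_unit_of_ord_eq hf
  obtain ⟨u, hua, rfl⟩ := exists_germOf u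
  obtain ⟨h, hha, rfl⟩ := exists_germOf h
  rw [valueHom_germOf] at hu
  set v : ℂ → ℂ := fun z => (u z)⁻¹
  have hva : AnalyticAt ℂ v 0 := hua.fun_inv hu
  obtain ⟨V, hV, hV'⟩ := exists_ball_bound hva
  obtain ⟨M, hM, hM'⟩ := exists_ball_bound hha
  obtain ⟨ρ, ⟨⟨hvd, hvb⟩, hhd, hhb⟩, hρ⟩ := ((hV'.and hM').and self_mem_nhdsWithin).exists
  have hρ : 0 < ρ := hρ
  set D : (ℂ → ℂ) → ℂ → ℂ := fun g => dslope g 0 with hD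
  -- Division by t ^ n * u drops the first n Taylor coefficients and multiplies by 1 / u; the
  -- dropped coefficients are the remainders.
  let F : ℕ → ℂ → ℂ := fun q => Nat.rec h (fun _ g z => v z * (D^[n] g) z) q
  have hF : ∀ q, DifferentiableOn ℂ (F q) (Metric.ball 0 ρ) ∧
      ∀ z ∈ Metric.ball (0 : ℂ) ρ, ‖F q z‖ ≤ M * (V * (2 / ρ) ^ n) ^ q := by
    intro q
    induction q with
    | zero => simpa [F] using ⟨hhd, fun z hz => hhb z (by simpa using hz)⟩
    | succ q ih =>
      obtain ⟨h1, h2⟩ := norm_dslope_iterate_le hρ ih.1 ih.2 n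
      refine ⟨hvd.mul h1, fun z hz => ?_⟩
      calc ‖v z * (D^[n] (F q)) z‖ = ‖v z‖ * ‖(D^[n] (F q)) z‖ := norm_mul _ _
        _ ≤ V * (M * (V * (2 / ρ) ^ n) ^ q * (2 / ρ) ^ n) :=
          mul_le_mul (hvb z hz) (h2 z hz) (norm_nonneg _) hV
        _ = _ := by ring
  have hFa : ∀ q, AnalyticAt ℂ (F q) 0 := fun q =>
    (hF q).1.analyticAt (Metric.ball_mem_nhds 0 hρ)
  refine ⟨fun q => germOf (F q) (hFa q), fun j q => (D^[j] (F q)) 0, fun j => M * (2 / ρ) ^ j,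
    V * (2 / ρ) ^ n, rfl, fun j q => ?_, fun q => ?_⟩
  · refine ((norm_dslope_iterate_le hρ (hF q).1 (hF q).2 j).2 0
      (Metric.mem_ball_self hρ)).trans (le_of_eq (by ring))
  · rw [tt]
    simp only [germOf_pow, smul_germOf]
    rw [sum_germOf, germOf_mul, germOf_mul, germOf_add, germOf_eq_iff]
    filter_upwards [hua.continuousAt.eventually_ne hu] with z hz
    have h1 := eq_sum_add_pow_mul_dslope_iterate (F q) n z
    have h2 : F (q + 1) z = v z * (D^[n] (F q)) z := rfl
    rw [h2]
    have h3 : z ^ n * u z * (v z * (D^[n] (F q)) z) = z ^ n * (D^[n] (F q)) z := by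
      simp only [v]
      field_simp
    rw [h3]
    exact h1

/-- Unrolling the recursion `Q` times leaves the error term `f ^ Q * G Q`. -/
theorem pow_dvd_sub_of_division_sequence {f : holoGerm ℂ} {n : ℕ} {G : ℕ → holoGerm ℂ}
    {c : ℕ → ℕ → ℂ}
    (hG : ∀ q, G q = ∑ j ∈ Finset.range n, c j q • tt ^ j + f * G (q + 1)) (Q : ℕ) :
    f ^ Q ∣ G 0 - ∑ j ∈ Finset.range n, tt ^ j * ∑ q ∈ Finset.range Q, c j q • f ^ q := by
  refine ⟨G Q, ?_⟩
  induction Q with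
  | zero => simp
  | succ Q ih =>
    have h : ∑ j ∈ Finset.range n, tt ^ j * ∑ q ∈ Finset.range (Q + 1), c j q • f ^ q =
        ∑ j ∈ Finset.range n, tt ^ j * ∑ q ∈ Finset.range Q, c j q • f ^ q +
          f ^ Q * ∑ j ∈ Finset.range n, c j Q • tt ^ j := by
      rw [Finset.mul_sum, ← Finset.sum_add_distrib]
      refine Finset.sum_congr rfl fun j _ => ?_
      rw [Finset.sum_range_succ, mul_add, mul_smul_comm, mul_smul_comm, mul_comm (tt ^ j) (f ^ Q)]
    rw [h, ← sub_sub, ih, hG Q]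
    ring

end Division

/-! ### Finiteness of the normalization and existence of the conductor. -/

section Conductor

variable {r : ℕ}

/-- A zero component would be annihilated by the idempotent of that branch. -/
theorem ord_ne_top_of_mem_nonZeroDivisors {y : Branches r} (hy : y ∈ nonZeroDivisors (Branches r))
    (i : Fin r) : ord (y i) ≠ ⊤ := by
  classical
  rw [Ne, ord_eq_top]
  intro h
  have h1 : (Pi.single i 1 : Branches r) * y = 0 := by
    ext1 k
    rcases eq_or_ne k i with rfl | hk
    · simp [h]
    · simp [Pi.single_eq_of_ne hk]
  have h2 := mul_right_mem_nonZeroDivisors_eq_zero_iff hy |>.1 h1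
  have h3 := congrFun h2 i
  rw [Pi.single_eq_same] at h3
  have h4 := ord_one
  rw [h3, Pi.zero_apply, ord_zero] at h4
  exact ENat.top_ne_zero h4

namespace CurveGerm

variable (C : CurveGerm r)

/-- Without branches the normalization is the zero ring, and injectivity of `ν` would force `I = ⊤`.
-/
theorem pos (C : CurveGerm r) : 0 < r := by
  rcases Nat.eq_zero_or_pos r with rfl | h
  · exfalso
    have : Subsingleton (holoGerm (Fin C.N → ℂ) ⧸ C.I) :=
      ⟨fun a b => C.ν_injective (Subsingleton.elim _ _)⟩
    exact C.I_ne_top (Ideal.Quotient.subsingleton_iff.1 this)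
  · exact h

/-- A germ on the ambient space, vanishing at the origin, whose pull-back to each branch has positive
finite order. -/
theorem exists_parameter : ∃ a : holoGerm (Fin C.N → ℂ), valueHom a = 0 ∧
    ∀ i, ∃ n : ℕ, 1 ≤ n ∧ ord (C.ν (Ideal.Quotient.mk C.I a) i) = n := by
  -- Write (t, …, t) as a fraction a / b: on every branch the order of a is that of b plus one,
  -- hence positive and finite.
  obtain ⟨a, b, hb, hab⟩ := C.ν_birational fun _ => tt
  obtain ⟨a, rfl⟩ := Ideal.Quotient.mk_surjective a
  have key : ∀ i, ∃ n : ℕ, 1 ≤ n ∧ ord (C.ν (Ideal.Quotient.mk C.I a) i) = n := by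
    intro i
    obtain ⟨m, hm⟩ := ENat.ne_top_iff_exists.1 (ord_ne_top_of_mem_nonZeroDivisors hb i)
    refine ⟨m + 1, by omega, ?_⟩
    rw [← hab, Pi.mul_apply, ord_mul, ← hm, ord_tt]
    rfl
  refine ⟨a, ?_, key⟩
  -- A germ with nonzero value is a unit, and so would be its pull-back, which has positive order.
  by_contra h
  have hu := (((isUnit_of_valueHom_ne_zero h).map (Ideal.Quotient.mk C.I)).map C.ν).map
    (Pi.evalRingHom _ (⟨0, C.pos⟩ : Fin r))
  obtain ⟨n, hn, hn'⟩ := key ⟨0, C.pos⟩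
  have h1 := hu.map valueHom
  have h2 : valueHom (C.ν (Ideal.Quotient.mk C.I a) ⟨0, C.pos⟩) = 0 := by
    rw [← one_le_ord, hn']
    exact_mod_cast hn
  exact h1.ne_zero h2

theorem ν_mem (x : holoGerm (Fin C.N → ℂ) ⧸ C.I) : C.ν x ∈ C.O := ⟨x, rfl⟩

/-- Finiteness of the normalization. -/
theorem exists_eq_sum_single_mul {a : holoGerm (Fin C.N → ℂ)} (ha : valueHom a = 0) {i : Fin r}
    {n : ℕ} (hn : 1 ≤ n) (ha' : ord (C.ν (Ideal.Quotient.mk C.I a) i) = n) (h : holoGerm ℂ) :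
    ∃ x : ℕ → Branches r, (∀ j, x j ∈ C.O) ∧
      (Pi.single i h : Branches r) = ∑ j ∈ Finset.range n, Pi.single i (tt ^ j) * x j := by
  classical
  -- Divide repeatedly by the pull-back of `a`: the coefficients at t ^ j form convergent series in
  -- `a`, which exist as ambient germs `φ j`.
  obtain ⟨G, c, A, K, rfl, hc, hG⟩ := exists_division_sequence ha' h
  choose φ hφ using fun j => exists_subst a ha (c j) (A j) K (hc j)
  refine ⟨fun j => C.ν (Ideal.Quotient.mk C.I (φ j)), fun j => C.ν_mem _, ?_⟩
  ext1 k
  rw [Finset.sum_apply]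
  rcases eq_or_ne k i with rfl | hk
  · simp only [Pi.mul_apply, Pi.single_eq_same]
    -- The two sides agree modulo every power of the pull-back of `a`.
    rw [← sub_eq_zero]
    refine eq_zero_of_forall_pow_dvd (f := C.ν (Ideal.Quotient.mk C.I a) k)
      (by rw [ha']; exact_mod_cast hn) fun Q => ?_
    have h1 := pow_dvd_sub_of_division_sequence hG Q
    have h2 : ∀ j, (C.ν (Ideal.Quotient.mk C.I a) k) ^ Q ∣ C.ν (Ideal.Quotient.mk C.I (φ j)) k -
        ∑ q ∈ Finset.range Q, c j q • (C.ν (Ideal.Quotient.mk C.I a) k) ^ q := by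
      intro j
      have := map_dvd (((Pi.evalAlgHom ℂ (fun _ : Fin r => holoGerm ℂ) k).comp C.ν).comp
        (Ideal.Quotient.mkₐ ℂ C.I)) (hφ j Q)
      simp only [map_sub, map_sum, map_smul, map_pow] at this
      exact this
    have h3 : (C.ν (Ideal.Quotient.mk C.I a) k) ^ Q ∣ ∑ j ∈ Finset.range n, tt ^ j *
        (C.ν (Ideal.Quotient.mk C.I (φ j)) k -
          ∑ q ∈ Finset.range Q, c j q • (C.ν (Ideal.Quotient.mk C.I a) k) ^ q) :=
      Finset.dvd_sum fun j _ => (h2 j).mul_left _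
    have h4 := dvd_sub h1 h3
    convert h4 using 1
    simp only [mul_sub, Finset.sum_sub_distrib]
    ring
  · simp [Pi.single_eq_of_ne hk]

/-- The conductor is not zero on any branch. -/
theorem exists_barF_le : ∃ m : Fin r → ℕ, barF m ≤ C.O.toSubmodule := by
  classical
  obtain ⟨a, ha, hn⟩ := C.exists_parameter
  choose n hn ha' using hn
  choose p q hq hpq using C.ν_birational
  set y : Fin r → ℕ → Branches r := fun i j => Pi.single i (tt ^ j)
  -- The elements `y i j` with j < n i generate the normalization over 𝒪; `b` is the product of
  -- their denominators.
  set b : Branches r := ∏ i, ∏ j ∈ Finset.range (n i), C.ν (q (y i j)) with hb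
  have hbd : b ∈ nonZeroDivisors (Branches r) :=
    prod_mem fun i _ => prod_mem fun j _ => hq _
  have hby : ∀ i, ∀ j ∈ Finset.range (n i), b * y i j ∈ C.O := by
    intro i j hj
    rw [hb, ← Finset.mul_prod_erase _ _ (Finset.mem_univ i),
      ← Finset.mul_prod_erase _ _ hj, mul_right_comm, mul_right_comm (C.ν _), hpq]
    exact mul_mem (mul_mem (C.ν_mem _) (prod_mem fun _ _ => C.ν_mem _))
      (prod_mem fun _ _ => prod_mem fun _ _ => C.ν_mem _)
  have hB : ∀ z : Branches r, b * z ∈ C.O := by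
    intro z
    rw [← Finset.univ_sum_single z, Finset.mul_sum]
    refine sum_mem fun i _ => ?_
    obtain ⟨x, hx, h⟩ := C.exists_eq_sum_single_mul ha (hn i) (ha' i) (z i)
    rw [h, Finset.mul_sum]
    refine sum_mem fun j hj => ?_
    rw [← mul_assoc]
    exact mul_mem (hby i j hj) (hx j)
  choose m hm using fun i => ENat.ne_top_iff_exists.1 (ord_ne_top_of_mem_nonZeroDivisors hbd i)
  refine ⟨m, fun g hg => ?_⟩
  have : ∀ i, b i ∣ g i := fun i => dvd_of_ord_le ((hm i).symm.le.trans (hg i))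
  choose z hz using this
  have : g = b * z := funext hz
  rw [this]
  exact hB z

end CurveGerm

end Conductor

/-! ### Dimensions of quotients along chains of subspaces. -/

section Codimension

variable {K V : Type*} [Field K] [AddCommGroup V] [Module K V]

/-- The kernel of V / P' → V / P is the line spanned by the class of `f`. This is used at each unit
step of the valuative filtration. -/
theorem finrank_quotient_succ {P P' : Submodule K V} (hle : P' ≤ P) [FiniteDimensional K (V ⧸ P)]
    {f : V} (hf : f ∈ P) (hf' : f ∉ P') (h : ∀ g ∈ P, ∃ a : K, g - a • f ∈ P') :
    FiniteDimensional K (V ⧸ P') ∧ Module.finrank K (V ⧸ P') = Module.finrank K (V ⧸ P) + 1 := by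
  set π : V ⧸ P' →ₗ[K] V ⧸ P := Submodule.factor hle
  have hker : LinearMap.ker π = K ∙ P'.mkQ f := by
    ext x
    obtain ⟨g, rfl⟩ := P'.mkQ_surjective x
    rw [LinearMap.mem_ker, Submodule.mem_span_singleton]
    have h1 : π (P'.mkQ g) = P.mkQ g := rfl
    rw [h1, Submodule.mkQ_apply, Submodule.Quotient.mk_eq_zero]
    constructor
    · intro hg
      obtain ⟨a, ha⟩ := h g hg
      refine ⟨a, ?_⟩
      rw [← map_smul, eq_comm, ← sub_eq_zero, ← map_sub]
      exact (Submodule.Quotient.mk_eq_zero _).2 ha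
    · rintro ⟨a, ha⟩
      rw [← map_smul, eq_comm, ← sub_eq_zero, ← map_sub] at ha
      have := hle ((Submodule.Quotient.mk_eq_zero _).1 ha)
      simpa using add_mem this (P.smul_mem a hf)
  have hne : P'.mkQ f ≠ 0 := fun h0 => hf' ((Submodule.Quotient.mk_eq_zero _).1 h0)
  have hsurj : LinearMap.range π = ⊤ := LinearMap.range_eq_top.2 (Submodule.factor_surjective hle)
  have hk1 : Module.finrank K (LinearMap.ker π) = 1 := by
    rw [hker]
    exact finrank_span_singleton hne
  have : Module.Finite K (LinearMap.ker π) := Module.finite_of_finrank_pos (by omega)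
  have : Module.Finite K ((V ⧸ P') ⧸ LinearMap.ker π) :=
    Module.Finite.equiv (π.quotKerEquivOfSurjective (LinearMap.range_eq_top.1 hsurj)).symm
  have hfin : FiniteDimensional K (V ⧸ P') := Module.Finite.of_submodule_quotient (LinearMap.ker π)
  refine ⟨hfin, ?_⟩
  have := LinearMap.finrank_range_add_finrank_ker π
  rw [hsurj, finrank_top, hk1] at this
  exact this.symm

theorem finrank_subquot_succ {Z P P' : Submodule K V} (hle : P' ≤ P)
    [hfin : FiniteDimensional K (Subquot Z P)] {f : V} (hZ : f ∈ Z) (hf : f ∈ P) (hf' : f ∉ P')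
    (h : ∀ g ∈ P, ∃ a : K, g - a • f ∈ P') : FiniteDimensional K (Subquot Z P') ∧
      Module.finrank K (Subquot Z P') = Module.finrank K (Subquot Z P) + 1 := by
  have : FiniteDimensional K (↥Z ⧸ P.submoduleOf Z) := hfin
  exact finrank_quotient_succ (P := P.submoduleOf Z) (P' := P'.submoduleOf Z)
    (fun x hx => hle hx) (f := ⟨f, hZ⟩) hf hf' fun g hg => h g hg

theorem subsingleton_subquot {Z P : Submodule K V} (h : Z ≤ P) : Subsingleton (Subquot Z P) :=
  Submodule.Quotient.subsingleton_iff.2 (Submodule.submoduleOf_eq_top.2 h)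

/-- Dimension count in 0 → Q / P → V / P → V / Q → 0. -/
theorem finrank_quotient_add_finrank_subquot {P Q : Submodule K V} (hle : P ≤ Q)
    [FiniteDimensional K (V ⧸ P)] :
    Module.finrank K (V ⧸ P) =
      Module.finrank K (Subquot Q P) + Module.finrank K (V ⧸ Q) := by
  set π : V ⧸ P →ₗ[K] V ⧸ Q := Submodule.factor hle
  have hsurj : LinearMap.range π = ⊤ := LinearMap.range_eq_top.2 (Submodule.factor_surjective hle)
  set ι : ↥Q →ₗ[K] V ⧸ P := P.mkQ.comp Q.subtype
  have hι : LinearMap.ker ι = P.submoduleOf Q := by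
    ext x
    exact Submodule.Quotient.mk_eq_zero _
  have hr : LinearMap.ker π = LinearMap.range ι := by
    ext x
    obtain ⟨g, rfl⟩ := P.mkQ_surjective x
    constructor
    · intro h
      exact ⟨⟨g, (Submodule.Quotient.mk_eq_zero _).1 h⟩, rfl⟩
    · rintro ⟨y, hy⟩
      rw [← hy]
      exact (Submodule.Quotient.mk_eq_zero _).2 y.2
  have h1 := LinearMap.finrank_range_add_finrank_ker π
  rw [hsurj, finrank_top, hr, ← LinearEquiv.finrank_eq ι.quotKerEquivRange,
    LinearEquiv.finrank_eq (Submodule.quotEquivOfEq _ _ hι)] at h1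
  rw [← h1, add_comm]
  rfl

end Codimension

/-! ### The Hilbert function of a curve germ. -/

section Lattice

variable {r : ℕ}

theorem shift_empty (l : Fin r → ℕ) : shift l ∅ = l := by
  ext i
  simp [shift]

theorem sum_shift (l : Fin r → ℕ) (J : Finset (Fin r)) : ∑ i, shift l J i = ∑ i, l i + J.card := by
  simp [shift, Finset.sum_add_distrib]

theorem le_shift (l : Fin r → ℕ) (J : Finset (Fin r)) : l ≤ shift l J := fun _ => Nat.le_add_right _ _

theorem shift_insert {l : Fin r → ℕ} {J : Finset (Fin r)} {i : Fin r} (h : i ∉ J) :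
    shift l (insert i J) = shift (shift l J) {i} := by
  ext k
  rcases eq_or_ne k i with rfl | hk
  · simp [shift, h]
  · simp [shift, hk]

theorem exists_eq_shift_of_pos {l : Fin r → ℕ} {i : Fin r} (h : 0 < l i) :
    ∃ l', l = shift l' {i} ∧ l' ≤ l := by
  refine ⟨fun k => l k - if k ∈ ({i} : Finset (Fin r)) then 1 else 0, ?_, fun k => Nat.sub_le _ _⟩
  ext k
  rcases eq_or_ne k i with rfl | hk
  · simp only [shift, Finset.mem_singleton, if_true]
    omega
  · simp [shift, hk]

theorem lattice_induction {p : (Fin r → ℕ) → Prop} (h0 : p 0)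
    (hs : ∀ l i, p l → p (shift l {i})) (l : Fin r → ℕ) : p l := by
  obtain ⟨n, hn⟩ : ∃ n, ∑ i, l i = n := ⟨_, rfl⟩
  induction n generalizing l with
  | zero =>
    have : l = 0 := by
      ext i
      simpa using (Finset.sum_eq_zero_iff.1 hn) i (Finset.mem_univ i)
    rwa [this]
  | succ n ih =>
    obtain ⟨i, hi⟩ : ∃ i, 0 < l i := by
      by_contra! h
      have : ∑ i, l i = 0 := Finset.sum_eq_zero fun i _ => Nat.le_zero.1 (h i)
      omega
    obtain ⟨l', rfl, -⟩ := exists_eq_shift_of_pos hi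
    rw [sum_shift, Finset.card_singleton] at hn
    exact hs l' i (ih l' (by omega))

/-- The properties of the Hilbert function of a curve germ that determine the lattice homology
up to Euler characteristic. -/
structure IsHilbertFunction (h : (Fin r → ℕ) → ℕ) (δ : ℕ) (c : Fin r → ℕ) : Prop where
  zero : h 0 = 0
  le_shift_single : ∀ l i, h l ≤ h (shift l {i})
  shift_single_le : ∀ l i, h (shift l {i}) ≤ h l + 1
  jump : ∀ {l m : Fin r → ℕ} {i : Fin r}, l ≤ m → l i = m i → h m < h (shift m {i}) →
    h l < h (shift l {i})
  shift_single_of_le : ∀ {l : Fin r → ℕ} {i : Fin r}, c i ≤ l i → h (shift l {i}) = h l + 1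
  sum_eq : ∀ {l : Fin r → ℕ}, c ≤ l → ∑ i, l i = h l + δ

theorem barF_shift_le (l : Fin r → ℕ) (J : Finset (Fin r)) : barF (shift l J) ≤ barF l :=
  fun _ hg i => le_trans (by exact_mod_cast le_shift l J i) (hg i)

theorem barF_zero : barF (0 : Fin r → ℕ) = ⊤ := by
  ext g
  simp only [Submodule.mem_top, iff_true]
  exact fun i => by simp

theorem mem_barF_shift_single {l : Fin r → ℕ} {i : Fin r} {g : Branches r} (hg : g ∈ barF l) :
    g ∈ barF (shift l {i}) ↔ ((l i + 1 : ℕ) : ℕ∞) ≤ ord (g i) := by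
  constructor
  · intro h
    have := h i
    simpa [shift] using this
  · intro h k
    rcases eq_or_ne k i with rfl | hk
    · simpa [shift] using h
    · simpa [shift, hk] using hg k

theorem ord_eq_of_notMem {l : Fin r → ℕ} {i : Fin r} {g : Branches r} (hg : g ∈ barF l)
    (hg' : g ∉ barF (shift l {i})) : ord (g i) = l i := by
  rw [mem_barF_shift_single hg, not_le] at hg'
  refine le_antisymm ?_ (hg i)
  rw [Nat.cast_succ] at hg'
  exact Order.le_of_lt_add_one hg'

theorem exists_sub_smul_mem_barF {l : Fin r → ℕ} {i : Fin r} {f g : Branches r} (hf : f ∈ barF l)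
    (hf' : f ∉ barF (shift l {i})) (hg : g ∈ barF l) : ∃ a : ℂ, g - a • f ∈ barF (shift l {i}) := by
  obtain ⟨a, ha⟩ := exists_succ_le_ord_sub (ord_eq_of_notMem hf hf') (hg i)
  exact ⟨a, (mem_barF_shift_single (sub_mem hg (Submodule.smul_mem _ a hf))).2 ha⟩

theorem single_tt_pow_mem_barF {l : Fin r → ℕ} {i : Fin r} {n : ℕ} (h : l i ≤ n) :
    (Pi.single i (tt ^ n) : Branches r) ∈ barF l := by
  intro k
  rcases eq_or_ne k i with rfl | hk
  · rw [Pi.single_eq_same, ord_tt_pow]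
    exact_mod_cast h
  · rw [Pi.single_eq_of_ne hk, ord_zero]
    exact le_top

theorem single_tt_pow_notMem_barF {l : Fin r → ℕ} {i : Fin r} :
    (Pi.single i (tt ^ l i) : Branches r) ∉ barF (shift l {i}) := by
  rw [mem_barF_shift_single (single_tt_pow_mem_barF le_rfl), Pi.single_eq_same, ord_tt_pow, not_le]
  exact_mod_cast Nat.lt_succ_self _

/-- Each unit step in direction i adds one dimension, spanned by t ^ l i on branch i. -/
theorem finrank_quotient_barF (l : Fin r → ℕ) : FiniteDimensional ℂ (Branches r ⧸ barF l) ∧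
    Module.finrank ℂ (Branches r ⧸ barF l) = ∑ i, l i := by
  induction l using lattice_induction with
  | h0 =>
    rw [barF_zero]
    have : Subsingleton (Branches r ⧸ (⊤ : Submodule ℂ (Branches r))) :=
      Submodule.Quotient.subsingleton_iff.2 rfl
    exact ⟨inferInstance, by simp only [Module.finrank_zero_of_subsingleton, Pi.zero_apply, Finset.sum_const_zero]⟩
  | hs l i ih =>
    have := ih.1
    have h := finrank_quotient_succ (barF_shift_le l {i}) (single_tt_pow_mem_barF (i := i) le_rfl)
      single_tt_pow_notMem_barF fun g hg =>
        exists_sub_smul_mem_barF (single_tt_pow_mem_barF le_rfl) single_tt_pow_notMem_barF hg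
    exact ⟨h.1, by rw [h.2, ih.2, sum_shift, Finset.card_singleton]⟩

namespace CurveGerm

variable (C : CurveGerm r)

theorem F_shift_le (l : Fin r → ℕ) (J : Finset (Fin r)) : C.F (shift l J) ≤ C.F l :=
  inf_le_inf_right _ (barF_shift_le l J)

theorem hilb_succ {l : Fin r → ℕ} {i : Fin r}
    [FiniteDimensional ℂ (Subquot C.O.toSubmodule (C.F l))] {f : Branches r}
    (hf : f ∈ C.F l) (hf' : f ∉ C.F (shift l {i})) :
    FiniteDimensional ℂ (Subquot C.O.toSubmodule (C.F (shift l {i}))) ∧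
      C.hilb (shift l {i}) = C.hilb l + 1 := by
  refine finrank_subquot_succ (C.F_shift_le l _) hf.2 hf hf' fun g hg => ?_
  obtain ⟨a, ha⟩ := exists_sub_smul_mem_barF hf.1 (fun h => hf' ⟨h, hf.2⟩) hg.1
  exact ⟨a, ha, sub_mem hg.2 (Submodule.smul_mem _ a hf.2)⟩

theorem F_eq_or_exists (l : Fin r → ℕ) (i : Fin r) :
    C.F (shift l {i}) = C.F l ∨ ∃ f ∈ C.F l, f ∉ C.F (shift l {i}) := by
  by_cases h : C.F l ≤ C.F (shift l {i})
  · exact .inl (le_antisymm (C.F_shift_le l _) h)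
  · exact .inr (Set.not_subset.1 h)

theorem hilb_zero_and_finite : C.hilb 0 = 0 ∧
    FiniteDimensional ℂ (Subquot C.O.toSubmodule (C.F 0)) := by
  have : Subsingleton (Subquot C.O.toSubmodule (C.F 0)) :=
    subsingleton_subquot (by rw [F, barF_zero, top_inf_eq])
  exact ⟨Module.finrank_zero_of_subsingleton, inferInstance⟩

theorem finite_quotient_F (l : Fin r → ℕ) :
    FiniteDimensional ℂ (Subquot C.O.toSubmodule (C.F l)) := by
  induction l using lattice_induction with
  | h0 => exact C.hilb_zero_and_finite.2
  | hs l i ih =>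
    rcases C.F_eq_or_exists l i with h | ⟨f, hf, hf'⟩
    · rwa [h]
    · exact (C.hilb_succ hf hf').1

theorem hilb_shift_single_eq_or (l : Fin r → ℕ) (i : Fin r) :
    C.hilb (shift l {i}) = C.hilb l ∨ C.hilb (shift l {i}) = C.hilb l + 1 := by
  have := C.finite_quotient_F l
  rcases C.F_eq_or_exists l i with h | ⟨f, hf, hf'⟩
  · left; rw [hilb, h, hilb]
  · right; exact (C.hilb_succ hf hf').2

/-- A witness f for a jump at m serves equally at every l ≤ m with the same i-th coordinate; the
axiom `jump` follows from this. -/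
theorem hilb_lt_iff (l : Fin r → ℕ) (i : Fin r) : C.hilb l < C.hilb (shift l {i}) ↔
    ∃ f ∈ C.O, f ∈ barF l ∧ ord (f i) = l i := by
  have := C.finite_quotient_F l
  constructor
  · intro h
    rcases C.F_eq_or_exists l i with h' | ⟨f, hf, hf'⟩
    · rw [hilb, hilb, h'] at h
      exact absurd h (lt_irrefl _)
    · exact ⟨f, hf.2, hf.1, ord_eq_of_notMem hf.1 fun h => hf' ⟨h, hf.2⟩⟩
  · rintro ⟨f, hf, hf', h⟩
    rw [(C.hilb_succ (l := l) (i := i) (f := f) ⟨hf', hf⟩ fun h' => ?_).2]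
    · exact Nat.lt_succ_self _
    · have := (mem_barF_shift_single hf').1 h'.1
      rw [h] at this
      exact absurd (Nat.cast_le.1 this) (by omega)

theorem conductor_spec (i : Fin r) : ∃ g ∈ C.conductorIdeal, ord (g i) = C.conductor i := by
  obtain ⟨m, hm⟩ := C.exists_barF_le
  have hg : (fun k => tt ^ m k : Branches r) ∈ C.conductorIdeal := by
    intro y
    refine hm fun k => ?_
    rw [Pi.mul_apply, ord_mul, ord_tt_pow]
    exact le_self_add
  have hne : {k : ℕ | ∃ g ∈ C.conductorIdeal, ord (g i) = k}.Nonempty :=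
    ⟨m i, _, hg, ord_tt_pow _⟩
  exact Nat.sInf_mem hne

/-- The conductor is an ideal of the whole product ring, hence a product of ideals of the factors:
take a conductor element of minimal order on branch i, cut it to that branch and multiply it up to
`g i`; then sum over i. -/
theorem conductorIdeal_eq : C.conductorIdeal = {g | ∀ i, (C.conductor i : ℕ∞) ≤ ord (g i)} := by
  ext g
  constructor
  · intro hg i
    rcases eq_or_ne (ord (g i)) ⊤ with h | h
    · rw [h]
      exact le_top
    · obtain ⟨k, hk⟩ := ENat.ne_top_iff_exists.1 h
      rw [← hk]
      have : C.conductor i ≤ k := Nat.sInf_le ⟨g, hg, hk.symm⟩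
      exact_mod_cast this
  · intro hg y
    choose b hb hb' using C.conductor_spec
    have : ∀ i, b i i ∣ g i := fun i => dvd_of_ord_le ((hb' i).le.trans (hg i))
    choose u hu using this
    have hg' : g = ∑ i, b i * Pi.single i (u i) := by
      rw [← Finset.univ_sum_single g]
      refine Finset.sum_congr rfl fun i _ => ?_
      rw [hu]
      ext1 k
      rcases eq_or_ne k i with rfl | hk
      · simp
      · simp [Pi.single_eq_of_ne hk]
    rw [hg', Finset.sum_mul]
    refine sum_mem fun i _ => ?_
    rw [mul_assoc]
    exact hb i _

theorem barF_le_of_conductor_le {l : Fin r → ℕ} (hl : C.conductor ≤ l) :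
    barF l ≤ C.O.toSubmodule := by
  intro g hg
  have : g ∈ C.conductorIdeal := by
    rw [conductorIdeal_eq]
    exact fun i => le_trans (by exact_mod_cast hl i) (hg i)
  have h1 := this 1
  rwa [mul_one] at h1

theorem finite_quotient_O : FiniteDimensional ℂ (Branches r ⧸ C.O.toSubmodule) := by
  have := (finrank_quotient_barF C.conductor).1
  exact Module.Finite.of_surjective (Submodule.factor (C.barF_le_of_conductor_le le_rfl))
    (Submodule.factor_surjective _)

theorem isHilbertFunction : IsHilbertFunction C.hilb C.delta C.conductor where
  zero := C.hilb_zero_and_finite.1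
  le_shift_single l i := by
    rcases C.hilb_shift_single_eq_or l i with h | h <;> omega
  shift_single_le l i := by
    rcases C.hilb_shift_single_eq_or l i with h | h <;> omega
  jump {l m i} hlm hi h := by
    rw [hilb_lt_iff] at h ⊢
    obtain ⟨f, hf, hf', h⟩ := h
    exact ⟨f, hf, fun k => le_trans (by exact_mod_cast hlm k) (hf' k), by rw [h, hi]⟩
  -- Only the i-th coordinate matters: t ^ l i on branch i vanishes on the other branches, so it
  -- lies in 𝒪.
  shift_single_of_le {l i} h := by
    have : C.hilb l < C.hilb (shift l {i}) := by
      rw [hilb_lt_iff]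
      refine ⟨Pi.single i (tt ^ l i), C.barF_le_of_conductor_le le_rfl (single_tt_pow_mem_barF h),
        single_tt_pow_mem_barF le_rfl, ?_⟩
      rw [Pi.single_eq_same, ord_tt_pow]
    rcases C.hilb_shift_single_eq_or l i with h | h <;> omega
  -- Here |l| is the codimension of `barF l` in the normalization. Beyond the conductor `barF l`
  -- lies in 𝒪 and equals `C.F l`, so the count passes through 𝒪.
  sum_eq {l} hl := by
    have := (finrank_quotient_barF l).1
    have hle := C.barF_le_of_conductor_le hl
    have h := finrank_quotient_add_finrank_subquot hle
    rw [(finrank_quotient_barF l).2] at h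
    have hF : C.F l = barF l := inf_eq_left.2 hle
    rw [h, hilb, hF, delta]

end CurveGerm

end Lattice

variable {r : ℕ}

/-! ### Vertices and weights of cubes. -/

section Shift

theorem shift_shift_comm (l : Fin r → ℕ) (I J : Finset (Fin r)) :
    shift (shift l I) J = shift (shift l J) I := by
  ext k
  simp only [shift]
  omega

theorem shift_mono_right (l : Fin r → ℕ) {I J : Finset (Fin r)} (h : I ⊆ J) :
    shift l I ≤ shift l J := by
  intro i
  by_cases hi : i ∈ I
  · simp [shift, hi, h hi]
  · simp [shift, hi]

theorem shift_apply_of_notMem {l : Fin r → ℕ} {J : Finset (Fin r)} {i : Fin r} (h : i ∉ J) :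
    shift l J i = l i := by simp [shift, h]

theorem shift_apply_of_mem {l : Fin r → ℕ} {J : Finset (Fin r)} {i : Fin r} (h : i ∈ J) :
    shift l J i = l i + 1 := by simp [shift, h]

theorem add_shift (l k : Fin r → ℕ) (J : Finset (Fin r)) : l + shift k J = shift (l + k) J := by
  ext i
  simp [shift, add_assoc]

/-- The upper right vertex of a cube. -/
def top (c : Cube r) : Fin r → ℕ := shift c.1 c.2

theorem top_upperFace {c : Cube r} {i : Fin r} (hi : i ∈ c.2) : top (upperFace c i) = top c := by
  rw [top, upperFace, top, shift_shift_comm, ← shift_insert (Finset.notMem_erase i c.2),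
    Finset.insert_erase hi]

theorem top_lowerFace_le (c : Cube r) (i : Fin r) : top (lowerFace c i) ≤ top c :=
  shift_mono_right _ (Finset.erase_subset _ _)

end Shift

section Weight

variable (w : (Fin r → ℕ) → ℤ)

theorem weight_le_iff {c : Cube r} {n : ℤ} :
    weight w c ≤ n ↔ ∀ J ⊆ c.2, w (shift c.1 J) ≤ n := by
  refine (Finset.sup'_le_iff _ _).trans ?_
  simp only [Finset.mem_powerset]

theorem le_weight (K : Cube r) : w K.1 ≤ weight w K := by
  have := (weight_le_iff w).1 (le_refl (weight w K)) ∅ (by simp)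
  rwa [shift_empty] at this

theorem weight_vertex (l : Fin r → ℕ) : weight w (l, ∅) = w l := by
  simp [weight, shift_empty]

theorem weight_upperFace_le {c : Cube r} {i : Fin r} (hi : i ∈ c.2) :
    weight w (upperFace c i) ≤ weight w c := by
  rw [weight_le_iff]
  intro J hJ
  have hiJ : i ∉ J := fun h => Finset.notMem_erase i c.2 (hJ h)
  rw [upperFace, shift_shift_comm, ← shift_insert hiJ]
  exact (weight_le_iff w).1 le_rfl _
    (Finset.insert_subset hi (hJ.trans (Finset.erase_subset _ _)))

theorem weight_lowerFace_le (c : Cube r) (i : Fin r) : weight w (lowerFace c i) ≤ weight w c := by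
  rw [weight_le_iff]
  intro J hJ
  exact (weight_le_iff w).1 le_rfl _ (hJ.trans (Finset.erase_subset _ _))

end Weight

/-! ### The weight of a cube in terms of the Hilbert function. -/

section HilbertFunction

/-- The weight function attached to a Hilbert function. -/
def hilbWeight (h : (Fin r → ℕ) → ℕ) (l : Fin r → ℕ) : ℤ := 2 * (h l : ℤ) - ∑ i, (l i : ℤ)

namespace IsHilbertFunction

variable {h : (Fin r → ℕ) → ℕ} {δ : ℕ} {c : Fin r → ℕ} (hh : IsHilbertFunction h δ c)
include hh

theorem le_add (l k : Fin r → ℕ) : h l ≤ h (l + k) ∧ h (l + k) ≤ h l + ∑ i, k i := by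
  induction k using lattice_induction with
  | h0 => simp
  | hs k i ih =>
    rw [add_shift, sum_shift, Finset.card_singleton]
    have h1 := hh.le_shift_single (l + k) i
    have h2 := hh.shift_single_le (l + k) i
    omega

theorem mono {l m : Fin r → ℕ} (hlm : l ≤ m) : h l ≤ h m := by
  have := (hh.le_add l (m - l)).1
  rwa [add_tsub_cancel_of_le hlm] at this

/-- Since unit steps raise h by at most one, |l| - h(l) does not decrease on the way to `l ⊔ c`,
where it equals δ. -/
theorem sum_le (l : Fin r → ℕ) : ∑ i, l i ≤ h l + δ := by
  have h1 := hh.le_add l (l ⊔ c - l)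
  rw [add_tsub_cancel_of_le le_sup_left] at h1
  have h2 := hh.sum_eq (l := l ⊔ c) le_sup_right
  have h3 : ∑ i, (l ⊔ c) i = ∑ i, l i + ∑ i, (l ⊔ c - l) i := by
    rw [← Finset.sum_add_distrib]
    refine Finset.sum_congr rfl fun i _ => ?_
    rw [← Pi.add_apply, add_tsub_cancel_of_le le_sup_left]
  omega

theorem shift_le (l : Fin r → ℕ) (J : Finset (Fin r)) : h (shift l J) ≤ h l + J.card := by
  have h1 := (hh.le_add l (shift 0 J)).2
  rwa [add_shift, add_zero, sum_shift, Pi.zero_def, Finset.sum_const_zero, zero_add] at h1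

/-- As for a matroid rank: add directions one by one and keep those that raise h. By `jump`, a
direction that raises h above l + E_I also raises it above l + E_J for J ⊆ I, so every kept
direction counts. -/
theorem exists_basis (l : Fin r → ℕ) (I : Finset (Fin r)) :
    ∃ J ⊆ I, h (shift l J) = h l + J.card ∧ h (shift l J) = h (shift l I) := by
  classical
  induction I using Finset.induction_on with
  | empty => exact ⟨∅, subset_rfl, by simp [shift_empty]⟩
  | insert i I hi ih =>
    obtain ⟨J, hJ, h1, h2⟩ := ih
    have hiJ : i ∉ J := fun h => hi (hJ h)
    rw [shift_insert hi]
    rcases (hh.le_shift_single (shift l I) i).eq_or_lt with h3 | h3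
    · exact ⟨J, hJ.trans (Finset.subset_insert _ _), h1, by rw [h2, h3]⟩
    · refine ⟨insert i J, Finset.insert_subset_insert _ hJ, ?_⟩
      have h4 := hh.jump (shift_mono_right l hJ)
        (by rw [shift_apply_of_notMem hiJ, shift_apply_of_notMem hi]) h3
      have h5 := hh.shift_single_le (shift l J) i
      have h6 := hh.shift_single_le (shift l I) i
      rw [shift_insert hiJ, Finset.card_insert_of_notMem hiJ]
      omega

/-- At a vertex l + E_J the value of h is at most h(l) + |J| and at most its value at the upper
vertex; adding these bounds gives ≤. A set J from `exists_basis` attains both. -/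
theorem weight_eq (K : Cube r) :
    weight (hilbWeight h) K = h K.1 + h (top K) - ∑ i, (K.1 i : ℤ) := by
  apply le_antisymm
  · rw [weight_le_iff]
    intro J hJ
    have h1 := hh.shift_le K.1 J
    have h2 : h (shift K.1 J) ≤ h (top K) := hh.mono (shift_mono_right _ hJ)
    have h3 := sum_shift K.1 J
    simp only [hilbWeight]
    rw [← Nat.cast_sum, ← Nat.cast_sum]
    omega
  · obtain ⟨J, hJ, h1, h2⟩ := hh.exists_basis K.1 K.2
    have h0 := (weight_le_iff (hilbWeight h)).1 (le_refl (weight (hilbWeight h) K)) J hJ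
    have h3 := sum_shift K.1 J
    simp only [hilbWeight] at h0
    rw [← Nat.cast_sum] at h0
    rw [← Nat.cast_sum, top]
    omega

/-- The two cubes share the upper vertex, and past the conductor both h and |·| of the lower vertex
grow by one. This pairing drives both the rectangle formula and the acyclicity. -/
theorem weight_shift {l : Fin r → ℕ} {I : Finset (Fin r)} {i : Fin r} (hi : i ∉ I)
    (hc : c i ≤ l i) :
    weight (hilbWeight h) (shift l {i}, I) = weight (hilbWeight h) (l, insert i I) := by
  have h1 := hh.shift_single_of_le hc
  have h2 := sum_shift l {i}
  rw [hh.weight_eq, hh.weight_eq]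
  simp only [top]
  rw [shift_insert hi, shift_shift_comm, h1, ← Nat.cast_sum, ← Nat.cast_sum, h2,
    Finset.card_singleton]
  push_cast
  ring

theorem neg_delta_le (l : Fin r → ℕ) : -(δ : ℤ) ≤ hilbWeight h l := by
  have := hh.sum_le l
  rw [hilbWeight, ← Nat.cast_sum]
  omega

/-- By `sum_le`, w(l) ≥ |l| - 2δ. -/
theorem level_le {n : ℤ} {K : Cube r} (hK : K ∈ S (hilbWeight h) n) :
    level K ≤ (n + 2 * δ).toNat := by
  have h0 := (le_weight _ K).trans hK
  have := hh.sum_le K.1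
  rw [hilbWeight, ← Nat.cast_sum] at h0
  rw [level]
  omega

theorem S_finite (n : ℤ) : (S (hilbWeight h) n).Finite := by
  classical
  refine (((Finset.Iic fun _ : Fin r => (n + 2 * δ).toNat) ×ˢ
    (Finset.univ : Finset (Finset (Fin r)))).finite_toSet).subset fun K hK => ?_
  simp only [Finset.coe_product, Set.mem_prod, Finset.coe_Iic, Set.mem_Iic, Finset.coe_univ,
    Set.mem_univ, and_true]
  intro i
  refine le_trans ?_ (hh.level_le hK)
  exact Finset.single_le_sum (f := K.1) (fun _ _ => Nat.zero_le _) (Finset.mem_univ i)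

theorem isLeast_minW : IsLeast (Set.range (hilbWeight h)) (minW (hilbWeight h)) := by
  have hb : BddBelow (Set.range (hilbWeight h)) :=
    ⟨-(δ : ℤ), by rintro _ ⟨l, rfl⟩; exact hh.neg_delta_le l⟩
  exact ⟨Int.csInf_mem ⟨_, 0, rfl⟩ hb, fun x hx => csInf_le hb hx⟩

theorem hilbWeight_zero : hilbWeight h 0 = 0 := by simp [hilbWeight, hh.zero]

theorem minW_le_zero : minW (hilbWeight h) ≤ 0 :=
  hh.isLeast_minW.2 ⟨0, hh.hilbWeight_zero⟩

theorem S_eq_empty {n : ℤ} (hn : n < minW (hilbWeight h)) : S (hilbWeight h) n = ∅ := by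
  ext K
  simp only [S, Set.mem_ofPred_eq, Set.mem_empty_iff_false, iff_false, not_le]
  exact hn.trans_le ((hh.isLeast_minW.2 ⟨K.1, rfl⟩).trans (le_weight _ K))

theorem exists_vertex_mem {n : ℤ} (hn : minW (hilbWeight h) ≤ n) :
    ∃ l, ((l, ∅) : Cube r) ∈ S (hilbWeight h) n := by
  obtain ⟨l, hl⟩ := hh.isLeast_minW.1
  exact ⟨l, by rw [S, Set.mem_ofPred_eq, weight_vertex, hl]; exact hn⟩

end IsHilbertFunction

end HilbertFunction

/-! ### Alternating sums over rectangles and over S_n. -/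

section EulerSums

theorem mem_rectCubes {c' : Fin r → ℕ} {K : Cube r} : K ∈ rectCubes c' ↔ top K ≤ c' := by
  classical
  simp only [rectCubes, Finset.mem_filter, Finset.mem_product, Finset.mem_Iic, Finset.mem_univ,
    and_true]
  exact ⟨fun h => h.2, fun h => ⟨(le_shift _ _).trans h, h⟩⟩

/-- Group the cubes by lower vertex l: the admissible I are the subsets of the directions with l i <
c' i, and their signs cancel unless there is no such direction, that is, l = c'. -/
theorem sum_rectCubes_lower (c' : Fin r → ℕ) (φ : (Fin r → ℕ) → ℤ) :
    ∑ K ∈ rectCubes c', (-1) ^ K.2.card * φ K.1 = φ c' := by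
  classical
  have h1 : ∀ l ∈ Finset.Iic c', ∑ I ∈ (Finset.univ : Finset (Finset (Fin r))),
      (if shift l I ≤ c' then (-1) ^ I.card * φ l else 0) = if l = c' then φ c' else 0 := by
    intro l hl
    rw [Finset.mem_Iic] at hl
    have h2 : Finset.univ.filter (fun I => shift l I ≤ c') =
        (Finset.univ.filter fun i => l i < c' i).powerset := by
      ext I
      simp only [Finset.mem_filter, Finset.mem_univ, true_and, Finset.mem_powerset]
      constructor
      · intro h i hi
        have := h i
        rw [shift_apply_of_mem hi] at this
        simpa using this
      · intro h i
        by_cases hi : i ∈ I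
        · rw [shift_apply_of_mem hi]
          simpa using h hi
        · rw [shift_apply_of_notMem hi]
          exact hl i
    rw [← Finset.sum_filter, h2, ← Finset.sum_mul, Finset.sum_powerset_neg_one_pow_card, ite_mul,
      one_mul, zero_mul]
    have h3 : (Finset.univ.filter fun i => l i < c' i) = ∅ ↔ l = c' := by
      rw [Finset.filter_eq_empty_iff]
      constructor
      · intro h
        exact le_antisymm hl fun i => not_lt.1 (h (Finset.mem_univ i))
      · rintro rfl i _
        exact lt_irrefl _
    by_cases h4 : l = c'
    · rw [if_pos (h3.2 h4), if_pos h4, h4]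
    · rw [if_neg (fun h => h4 (h3.1 h)), if_neg h4]
  have h5 : rectCubes c' = (Finset.Iic c' ×ˢ Finset.univ).filter fun K => shift K.1 K.2 ≤ c' := by
    ext K
    rw [mem_rectCubes]
    simp only [Finset.mem_filter, Finset.mem_product, Finset.mem_Iic, Finset.mem_univ, and_true]
    exact ⟨fun h => ⟨(le_shift _ _).trans h, h⟩, fun h => h.2⟩
  rw [h5, Finset.sum_filter, Finset.sum_product, Finset.sum_congr rfl h1]
  simp

/-- The reflection l ↦ c' - l exchanges lower and upper vertices. -/
theorem sum_rectCubes_upper (c' : Fin r → ℕ) (ψ : (Fin r → ℕ) → ℤ) :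
    ∑ K ∈ rectCubes c', (-1) ^ K.2.card * ψ (top K) = ψ 0 := by
  have h := sum_rectCubes_lower c' fun l => ψ (c' - l)
  rw [tsub_self] at h
  rw [← h]
  have key : ∀ K ∈ rectCubes c', c' - (c' - top K) = top K ∧
      top (c' - top K, K.2) = c' - K.1 := by
    intro K hK
    rw [mem_rectCubes] at hK
    refine ⟨tsub_tsub_cancel_of_le hK, ?_⟩
    ext i
    have := hK i
    simp only [top, shift, Pi.sub_apply] at this ⊢
    split_ifs at this ⊢ <;> omega
  refine Finset.sum_nbij' (fun K => (c' - top K, K.2)) (fun K => (c' - top K, K.2)) ?_ ?_ ?_ ?_ ?_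
  · intro K hK
    rw [mem_rectCubes, (key K hK).2]
    exact tsub_le_self
  · intro K hK
    rw [mem_rectCubes, (key K hK).2]
    exact tsub_le_self
  · intro K hK
    ext1
    · rw [(key K hK).2]
      exact tsub_tsub_cancel_of_le ((le_shift _ _).trans (mem_rectCubes.1 hK))
    · rfl
  · intro K hK
    ext1
    · rw [(key K hK).2]
      exact tsub_tsub_cancel_of_le ((le_shift _ _).trans (mem_rectCubes.1 hK))
    · rfl
  · intro K hK
    rw [(key K hK).1]

theorem sum_rectCubes_one (c' : Fin r → ℕ) : ∑ K ∈ rectCubes c', (-1 : ℤ) ^ K.2.card = 1 := by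
  simpa using sum_rectCubes_lower c' fun _ => 1

variable {h : (Fin r → ℕ) → ℕ} {δ : ℕ} {c : Fin r → ℕ}

/-- By `weight_eq` the weight is a function of the lower vertex plus one of the upper vertex; the
two sums leave h(c') - |c'| = -δ and h(0) = 0. -/
theorem IsHilbertFunction.sum_rectCubes_weight (hh : IsHilbertFunction h δ c) {c' : Fin r → ℕ}
    (hc : c ≤ c') :
    ∑ K ∈ rectCubes c', (-1) ^ K.2.card * weight (hilbWeight h) K = -(δ : ℤ) := by
  have h1 := sum_rectCubes_lower c' fun l => (h l : ℤ) - ∑ i, (l i : ℤ)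
  have h2 := sum_rectCubes_upper c' fun l => (h l : ℤ)
  rw [hh.zero, Nat.cast_zero] at h2
  have h3 := hh.sum_eq hc
  have h4 : ∑ K ∈ rectCubes c', (-1) ^ K.2.card * weight (hilbWeight h) K =
      ∑ K ∈ rectCubes c', (-1) ^ K.2.card * ((h K.1 : ℤ) - ∑ i, (K.1 i : ℤ)) +
      ∑ K ∈ rectCubes c', (-1) ^ K.2.card * (h (top K) : ℤ) := by
    rw [← Finset.sum_add_distrib]
    refine Finset.sum_congr rfl fun K _ => ?_
    rw [hh.weight_eq]
    ring
  rw [h4, h1, h2, ← Nat.cast_sum, h3]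
  push_cast
  ring

/-- The cube on the other side of the edge direction `i`, with the same upper right vertex. -/
def flip (i : Fin r) (K : Cube r) : Cube r :=
  if i ∈ K.2 then (shift K.1 {i}, K.2.erase i)
  else (fun k => K.1 k - if k ∈ ({i} : Finset (Fin r)) then 1 else 0, insert i K.2)

theorem flip_of_mem {i : Fin r} {K : Cube r} (h : i ∈ K.2) : flip i K = upperFace K i := if_pos h

theorem flip_insert {l : Fin r → ℕ} {I : Finset (Fin r)} {i : Fin r} (h : i ∉ I) :
    flip i (l, insert i I) = (shift l {i}, I) := by
  rw [flip, if_pos (Finset.mem_insert_self i I)]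
  simp [Finset.erase_insert h]

theorem flip_shift {l : Fin r → ℕ} {I : Finset (Fin r)} {i : Fin r} (h : i ∉ I) :
    flip i (shift l {i}, I) = (l, insert i I) := by
  rw [flip, if_neg h]
  ext1
  · ext k
    simp only [shift]
    omega
  · rfl

/-- Case distinction for the cubes not in the half space `xᵢ ≤ m`. -/
theorem exists_of_lt_top {K : Cube r} {i : Fin r} {m : ℕ} (h : m < top K i) :
    ∃ l I, i ∉ I ∧ m ≤ l i ∧ (K = (l, insert i I) ∨ K = (shift l {i}, I)) := by
  by_cases hi : i ∈ K.2
  · refine ⟨K.1, K.2.erase i, Finset.notMem_erase _ _, ?_, .inl ?_⟩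
    · rw [top, shift_apply_of_mem hi] at h
      omega
    · rw [Finset.insert_erase hi]
  · rw [top, shift_apply_of_notMem hi] at h
    obtain ⟨l, hl, -⟩ := exists_eq_shift_of_pos (Nat.zero_lt_of_lt h)
    refine ⟨l, K.2, hi, ?_, .inr ?_⟩
    · rw [hl, shift_apply_of_mem (Finset.mem_singleton_self i)] at h
      omega
    · rw [← hl]

theorem top_insert_eq {l : Fin r → ℕ} {I : Finset (Fin r)} {i : Fin r} (h : i ∉ I) :
    top (l, insert i I) = top (shift l {i}, I) := by
  simp only [top]
  rw [shift_insert h, shift_shift_comm]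

/-- The Euler characteristic of `S_n` is already that of its part in a rectangle `R(0, c')`. -/
theorem IsHilbertFunction.sum_S_eq (hh : IsHilbertFunction h δ c) {c' : Fin r → ℕ}
    (hc : c ≤ c') (n : ℤ) :
    ∑ K ∈ (hh.S_finite n).toFinset, (-1 : ℤ) ^ K.2.card =
      ∑ K ∈ rectCubes c', if weight (hilbWeight h) K ≤ n then (-1 : ℤ) ^ K.2.card else 0 := by
  classical
  rw [← Finset.sum_filter]
  have hsub : (rectCubes c').filter (fun K => weight (hilbWeight h) K ≤ n) =
      (hh.S_finite n).toFinset.filter fun K => top K ≤ c' := by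
    ext K
    simp only [Finset.mem_filter, mem_rectCubes, Set.Finite.mem_toFinset, S, Set.mem_ofPred_eq]
    exact and_comm
  rw [hsub, ← Finset.sum_filter_add_sum_filter_not (hh.S_finite n).toFinset fun K => top K ≤ c']
  rw [add_eq_left]
  have hT : ∀ K : Cube r, ¬ top K ≤ c' → (Finset.univ.filter fun i => c' i < top K i).Nonempty := by
    intro K hK
    rw [Pi.le_def] at hK
    push Not at hK
    obtain ⟨i, hi⟩ := hK
    exact ⟨i, by simpa using hi⟩
  -- The least direction in which the cube leaves the rectangle. It depends only on the upper
  -- vertex, which `flip` preserves, so flipping in this direction is an involution; it keeps the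
  -- weight and reverses the sign.
  let dir : Cube r → Option (Fin r) := fun K =>
    if hK : (Finset.univ.filter fun i => c' i < top K i).Nonempty then
      some ((Finset.univ.filter fun i => c' i < top K i).min' hK) else none
  have hdir : ∀ K : Cube r, ¬ top K ≤ c' → ∃ i, dir K = some i ∧ c' i < top K i := by
    intro K hK
    refine ⟨_, dif_pos (hT K hK), ?_⟩
    simpa using Finset.min'_mem _ (hT K hK)
  have hdirtop : ∀ K K', top K = top K' → dir K = dir K' := by
    intro K K' h
    simp only [dir, h]
  refine Finset.sum_involution (fun K _ => (dir K).elim K fun i => flip i K) ?_ ?_ ?_ ?_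
  all_goals
    intro K hK
    simp only [Finset.mem_filter, Set.Finite.mem_toFinset, S, Set.mem_ofPred_eq] at hK ⊢
    obtain ⟨i, hi, hi'⟩ := hdir K hK.2
    obtain ⟨l, I, hiI, hl, rfl | rfl⟩ := exists_of_lt_top hi'
  · simp only [hi, Option.elim, flip_insert hiI, Finset.card_insert_of_notMem hiI]
    ring
  · simp only [hi, Option.elim, flip_shift hiI, Finset.card_insert_of_notMem hiI]
    ring
  · intro _ h
    simp only [hi, Option.elim, flip_insert hiI] at h
    exact hiI (by rw [(Prod.mk.inj h).2]; exact Finset.mem_insert_self _ _)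
  · intro _ h
    simp only [hi, Option.elim, flip_shift hiI] at h
    exact hiI (by rw [← (Prod.mk.inj h).2]; exact Finset.mem_insert_self _ _)
  · simp only [hi, Option.elim, flip_insert hiI]
    rw [hh.weight_shift hiI ((hc i).trans hl), ← top_insert_eq hiI]
    exact hK
  · simp only [hi, Option.elim, flip_shift hiI]
    rw [← hh.weight_shift hiI ((hc i).trans hl), top_insert_eq hiI]
    exact hK
  · simp only [hi, Option.elim, flip_insert hiI]
    rw [hdirtop _ _ (top_insert_eq hiI).symm, hi]
    exact flip_shift hiI
  · simp only [hi, Option.elim, flip_shift hiI]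
    rw [hdirtop _ _ (top_insert_eq hiI), hi]
    exact flip_insert hiI

end EulerSums

/-! ### The cubical chain complex. -/

section Boundary

theorem bdry_single (K : Cube r) (a : ℤ) : bdry (Finsupp.single K a) = a • ∑ i ∈ K.2,
    sgn K i • (Finsupp.single (upperFace K i) (1 : ℤ) - Finsupp.single (lowerFace K i) 1) := by
  rw [bdry, Finsupp.linearCombination_single]

/-- The sum over the ordered pairs of distinct elements of an antisymmetric function vanishes. -/
theorem sum_sum_erase_eq_zero {M ι : Type*} [DecidableEq ι] [AddCommGroup M]
    [IsAddTorsionFree M] (s : Finset ι) (f : ι → ι → M)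
    (hf : ∀ i ∈ s, ∀ j ∈ s, i ≠ j → f i j = -f j i) : ∑ i ∈ s, ∑ j ∈ s.erase i, f i j = 0 := by
  have h1 : ∑ i ∈ s, ∑ j ∈ s.erase i, f i j = ∑ j ∈ s, ∑ i ∈ s.erase j, f i j := by
    refine Finset.sum_comm' fun i j => ?_
    simp only [Finset.mem_erase]
    tauto
  have h2 : ∑ i ∈ s, ∑ j ∈ s.erase i, f i j = -∑ i ∈ s, ∑ j ∈ s.erase i, f i j := by
    conv_lhs => rw [h1]
    rw [← Finset.sum_neg_distrib]
    refine Finset.sum_congr rfl fun j hj => ?_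
    rw [← Finset.sum_neg_distrib]
    refine Finset.sum_congr rfl fun i hi => ?_
    exact hf i (Finset.mem_of_mem_erase hi) j hj (Finset.ne_of_mem_erase hi)
  exact self_eq_neg.1 h2

theorem upperFace_snd (K : Cube r) (i : Fin r) : (upperFace K i).2 = K.2.erase i := rfl

theorem lowerFace_snd (K : Cube r) (i : Fin r) : (lowerFace K i).2 = K.2.erase i := rfl

theorem sgn_congr {K K' : Cube r} (h : K.2 = K'.2) (i : Fin r) : sgn K i = sgn K' i := by
  rw [sgn, sgn, h]

theorem sgn_ne_zero (K : Cube r) (i : Fin r) : sgn K i ≠ 0 := pow_ne_zero _ (by norm_num)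

theorem sgn_mul_self (K : Cube r) (i : Fin r) : sgn K i * sgn K i = 1 := by
  rw [sgn, ← mul_pow]
  norm_num

theorem sgn_lowerFace_of_lt {K : Cube r} {i j : Fin r} (hij : i < j) (hi : i ∈ K.2) :
    sgn (lowerFace K i) j = -sgn K j := by
  rw [sgn, sgn, lowerFace, Finset.filter_erase,
    ← Finset.card_erase_add_one (Finset.mem_filter.2 ⟨hi, hij⟩), pow_succ]
  ring

theorem sgn_lowerFace_of_gt {K : Cube r} {i j : Fin r} (hij : j < i) :
    sgn (lowerFace K i) j = sgn K j := by
  rw [sgn, sgn, lowerFace, Finset.filter_erase, Finset.erase_eq_of_notMem]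
  simp [hij.le]

/-- Deleting the smaller of two directions changes the sign of the larger one, but not conversely;
this makes ∂∂ vanish. -/
theorem sgn_mul_sgn_lowerFace {K : Cube r} {i j : Fin r} (hi : i ∈ K.2) (hj : j ∈ K.2)
    (hij : i ≠ j) : sgn K i * sgn (lowerFace K i) j = -(sgn K j * sgn (lowerFace K j) i) := by
  rcases lt_or_gt_of_ne hij with h | h
  · rw [sgn_lowerFace_of_lt h hi, sgn_lowerFace_of_gt h]
    ring
  · rw [sgn_lowerFace_of_lt h hj, sgn_lowerFace_of_gt h]
    ring

theorem bdry_bdry (z : Chains r) : bdry (bdry z) = 0 := by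
  classical
  induction z using Finsupp.induction_linear with
  | zero => simp
  | add x y hx hy => rw [map_add, map_add, hx, hy, add_zero]
  | single K a =>
    rw [bdry_single, map_smul, map_sum]
    have h : ∀ i ∈ K.2, bdry (sgn K i • (Finsupp.single (upperFace K i) (1 : ℤ) -
        Finsupp.single (lowerFace K i) 1)) =
        ∑ j ∈ K.2.erase i, (sgn K i * sgn (lowerFace K i) j) •
          ((Finsupp.single (upperFace (upperFace K i) j) (1 : ℤ) -
            Finsupp.single (lowerFace (upperFace K i) j) 1) -
          (Finsupp.single (upperFace (lowerFace K i) j) (1 : ℤ) -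
            Finsupp.single (lowerFace (lowerFace K i) j) 1)) := by
      intro i hi
      rw [map_smul, map_sub, bdry_single, bdry_single, one_smul, one_smul, upperFace_snd,
        lowerFace_snd, ← Finset.sum_sub_distrib, Finset.smul_sum]
      refine Finset.sum_congr rfl fun j _ => ?_
      rw [sgn_congr (K := upperFace K i) (K' := lowerFace K i) rfl, ← smul_sub, smul_smul]
    rw [Finset.sum_congr rfl h, sum_sum_erase_eq_zero, smul_zero]
    intro i hi j hj hij
    rw [sgn_mul_sgn_lowerFace hi hj hij, neg_smul]
    congr 2
    have h1 : upperFace (upperFace K i) j = upperFace (upperFace K j) i := by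
      simp only [upperFace]
      rw [shift_shift_comm, Finset.erase_right_comm]
    have h2 : lowerFace (upperFace K i) j = upperFace (lowerFace K j) i := by
      simp only [upperFace, lowerFace]
      rw [Finset.erase_right_comm]
    have h3 : upperFace (lowerFace K i) j = lowerFace (upperFace K j) i := by
      simp only [upperFace, lowerFace]
      rw [Finset.erase_right_comm]
    have h4 : lowerFace (lowerFace K i) j = lowerFace (lowerFace K j) i := by
      simp only [lowerFace]
      rw [Finset.erase_right_comm]
    rw [h1, h2, h3, h4]
    abel

/-- A set of cubes is a cubical complex. -/
def IsComplex (A : Set (Cube r)) : Prop :=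
  ∀ K ∈ A, ∀ i ∈ K.2, upperFace K i ∈ A ∧ lowerFace K i ∈ A

theorem bdry_mem {A A' : Set (Cube r)} {b : ℕ}
    (hA : ∀ K ∈ A, ∀ i ∈ K.2, upperFace K i ∈ A' ∧ lowerFace K i ∈ A') {z : Chains r}
    (hz : z ∈ chainsOn A (b + 1)) : bdry z ∈ chainsOn A' b := by
  rw [← Finsupp.sum_single z, Finsupp.sum, map_sum]
  refine sum_mem fun K hK => ?_
  obtain ⟨hKA, hKb⟩ := hz hK
  rw [bdry_single]
  refine Submodule.smul_mem _ _ (sum_mem fun i hi => Submodule.smul_mem _ _ ?_)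
  have hcard : (K.2.erase i).card = b := by
    rw [Finset.card_erase_of_mem hi, hKb, Nat.add_sub_cancel]
  exact sub_mem (Finsupp.single_mem_supported ℤ _ ⟨(hA K hKA i hi).1, hcard⟩)
    (Finsupp.single_mem_supported ℤ _ ⟨(hA K hKA i hi).2, hcard⟩)

theorem bdry_eq_zero {A : Set (Cube r)} {z : Chains r} (hz : z ∈ chainsOn A 0) : bdry z = 0 := by
  rw [← Finsupp.sum_single z, Finsupp.sum, map_sum]
  refine Finset.sum_eq_zero fun K hK => ?_
  rw [bdry_single, Finset.card_eq_zero.1 (hz hK).2, Finset.sum_empty, smul_zero]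

/-- The augmentation of the cubical chain complex. -/
def aug : Chains r →ₗ[ℤ] ℤ :=
  Finsupp.linearCombination ℤ fun K : Cube r => if K.2 = ∅ then 1 else 0

theorem aug_single (K : Cube r) (a : ℤ) :
    aug (Finsupp.single K a) = a * if K.2 = ∅ then 1 else 0 := by
  rw [aug, Finsupp.linearCombination_single, smul_eq_mul]

theorem aug_bdry (z : Chains r) : aug (bdry z) = 0 := by
  induction z using Finsupp.induction_linear with
  | zero => simp
  | add x y hx hy => rw [map_add, map_add, hx, hy, add_zero]
  | single K a =>
    rw [bdry_single, map_smul, map_sum]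
    simp [aug_single, upperFace, lowerFace]

theorem aug_eq_zero {A : Set (Cube r)} {b : ℕ} (hb : b ≠ 0) {z : Chains r}
    (hz : z ∈ chainsOn A b) : aug z = 0 := by
  rw [← Finsupp.sum_single z, Finsupp.sum, map_sum]
  refine Finset.sum_eq_zero fun K hK => ?_
  rw [aug_single, if_neg, mul_zero]
  intro h
  rw [← (hz hK).2, h] at hb
  exact hb rfl

theorem isComplex_S (w : (Fin r → ℕ) → ℤ) (n : ℤ) : IsComplex (S w n) := fun K hK _ hi =>
  ⟨(weight_upperFace_le w hi).trans hK, (weight_lowerFace_le w K _).trans hK⟩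

theorem isComplex_top_le (T : Fin r → ℕ) : IsComplex {K | top K ≤ T} := fun K hK _ hi =>
  ⟨(top_upperFace hi).le.trans hK, (top_lowerFace_le K _).trans hK⟩

theorem IsComplex.inter {A B : Set (Cube r)} (hA : IsComplex A) (hB : IsComplex B) :
    IsComplex (A ∩ B) := fun K hK i hi =>
  ⟨⟨(hA K hK.1 i hi).1, (hB K hK.2 i hi).1⟩, ⟨(hA K hK.1 i hi).2, (hB K hK.2 i hi).2⟩⟩

theorem chainsOn_mono {A B : Set (Cube r)} (h : A ⊆ B) (b : ℕ) : chainsOn A b ≤ chainsOn B b :=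
  Finsupp.supported_mono fun _ hK => ⟨h hK.1, hK.2⟩

end Boundary

/-! ### Collapsing S_n for large n. -/

section Acyclic

theorem upperFace_injOn {K K' : Cube r} {i : Fin r} (hi : i ∈ K.2) (hi' : i ∈ K'.2)
    (h : upperFace K i = upperFace K' i) : K = K' := by
  rw [← flip_of_mem hi, ← flip_of_mem hi'] at h
  have h' : ∀ {K : Cube r}, i ∈ K.2 → flip i (flip i K) = K := by
    intro K hi
    obtain ⟨l, I⟩ := K
    rw [flip_of_mem hi, upperFace, flip_shift (Finset.notMem_erase _ _), Finset.insert_erase hi]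
  rw [← h' hi, h, h' hi']

/-- The coefficient of a boundary at the upper face of a cube, in a direction in which the chain
does not extend further. -/
theorem bdry_apply_upperFace {z : Chains r} {i : Fin r} {m : ℕ} (hz : ∀ K ∈ z.support,
      top K i ≤ m + 1) (hz' : ∀ K ∈ z.support, i ∉ K.2 → K.1 i ≠ m + 1)
    {l : Fin r → ℕ} {I : Finset (Fin r)} (hi : i ∉ I) (hl : l i = m) :
    bdry z (shift l {i}, I) = sgn (l, insert i I) i * z (l, insert i I) := by
  classical
  have hK0 : upperFace (l, insert i I) i = (shift l {i}, I) := by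
    rw [← flip_of_mem (Finset.mem_insert_self i I), flip_insert hi]
  have hterm : ∀ K ∈ z.support, bdry (Finsupp.single K (z K)) (shift l {i}, I) =
      if K = (l, insert i I) then sgn (l, insert i I) i * z (l, insert i I) else 0 := by
    intro K hK
    rw [bdry_single, Finsupp.smul_apply, Finsupp.finsetSum_apply]
    -- A lower face on the wall x_i = m + 1 would put `K.1` on it: then K would either extend past
    -- the wall or be one of the excluded cubes.
    have hlow : ∀ j ∈ K.2, lowerFace K j ≠ (shift l {i}, I) := by
      intro j hj h
      have h1 : K.1 = shift l {i} := congrArg Prod.fst h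
      have h2 : K.1 i = m + 1 := by
        rw [h1, shift_apply_of_mem (Finset.mem_singleton_self i), hl]
      by_cases hiK : i ∈ K.2
      · have := hz K hK
        rw [top, shift_apply_of_mem hiK] at this
        omega
      · exact hz' K hK hiK h2
    have hup : ∀ j ∈ K.2, upperFace K j = (shift l {i}, I) → K = (l, insert i I) ∧ j = i := by
      intro j hj h
      rcases eq_or_ne j i with rfl | hji
      · rw [← hK0] at h
        exact ⟨upperFace_injOn hj (Finset.mem_insert_self _ _) h, rfl⟩
      · exfalso
        have h1 : shift K.1 {j} = shift l {i} := congrArg Prod.fst h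
        have h2 : K.2.erase j = I := congrArg Prod.snd h
        have h3 := congrFun h1 i
        rw [shift_apply_of_mem (Finset.mem_singleton_self i),
          shift_apply_of_notMem (by simpa using hji.symm), hl] at h3
        refine hz' K hK (fun hiK => hi ?_) h3
        rw [← h2]
        exact Finset.mem_erase.2 ⟨hji.symm, hiK⟩
    by_cases hKK : K = (l, insert i I)
    · rw [if_pos hKK, hKK, Finset.sum_eq_single i]
      · rw [Finsupp.smul_apply, Finsupp.sub_apply, hK0, Finsupp.single_eq_same,
          Finsupp.single_eq_of_ne' (by rw [← hKK]; exact hlow i (by rw [hKK]; simp))]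
        simp [mul_comm]
      · intro j hj hji
        rw [Finsupp.smul_apply, Finsupp.sub_apply, Finsupp.single_eq_of_ne', Finsupp.single_eq_of_ne']
        · simp
        · rw [← hKK]; exact hlow j (by rw [hKK]; exact hj)
        · intro h
          rw [← hKK] at h
          exact hji (hup j (by rw [hKK]; exact hj) h).2
      · intro h
        exact absurd (Finset.mem_insert_self _ _) h
    · rw [if_neg hKK, Finset.sum_eq_zero, smul_zero]
      intro j hj
      rw [Finsupp.smul_apply, Finsupp.sub_apply, Finsupp.single_eq_of_ne' (hlow j hj),
        Finsupp.single_eq_of_ne' fun h => hKK (hup j hj h).1]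
      simp
  conv_lhs => rw [← Finsupp.sum_single z, Finsupp.sum, map_sum, Finsupp.finsetSum_apply]
  rw [Finset.sum_congr rfl hterm, Finset.sum_ite_eq']
  split_ifs with h
  · rfl
  · rw [Finsupp.notMem_support_iff.1 h, mul_zero]

/-- A cycle with `xᵢ ≤ m + 1` is homologous to one with `xᵢ ≤ m`, if the complex contains
all the cubes needed. -/
theorem exists_push {A : Set (Cube r)} (hA : IsComplex A) {T : Fin r → ℕ} {i : Fin r}
    (hflip : ∀ l I, i ∉ I → l i = T i → top (shift l {i}, I) ≤ shift T {i} →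
      (shift l {i}, I) ∈ A → (l, insert i I) ∈ A) {b : ℕ} {z : Chains r}
    (hz : z ∈ chainsOn (A ∩ {K | top K ≤ shift T {i}}) b) (hcyc : bdry z = 0) :
    ∃ y ∈ chainsOn A (b + 1), z - bdry y ∈ chainsOn (A ∩ {K | top K ≤ T}) b := by
  classical
  set B : Set (Cube r) := A ∩ {K | top K ≤ shift T {i}} with hB
  have hBc : IsComplex B := hA.inter (isComplex_top_le _)
  -- The cubes of `z` in the outer wall x_i = T i + 1. Each is the upper face of its flip, and the
  -- signs in `y` make ∂y reproduce exactly this part of `z`.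
  set P : Finset (Cube r) := z.support.filter fun K => i ∉ K.2 ∧ K.1 i = T i + 1 with hP
  set y : Chains r := ∑ K ∈ P, Finsupp.single (flip i K) (sgn K i * z K) with hy
  have hPB : ∀ K ∈ P, ∃ l I, i ∉ I ∧ l i = T i ∧ K = (shift l {i}, I) ∧ flip i K = (l, insert i I) ∧
      (l, insert i I) ∈ B ∧ (insert i I).card = b + 1 := by
    intro K hK
    rw [hP, Finset.mem_filter] at hK
    obtain ⟨hKz, hiK, hKi⟩ := hK
    obtain ⟨l, hl, -⟩ := exists_eq_shift_of_pos (l := K.1) (i := i) (by omega)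
    have hK' : K = (shift l {i}, K.2) := by rw [← hl]
    have hli : l i = T i := by
      rw [hl, shift_apply_of_mem (Finset.mem_singleton_self i)] at hKi
      omega
    obtain ⟨⟨hKA, hKT⟩, hKb⟩ := hz hKz
    refine ⟨l, K.2, hiK, hli, hK', ?_, ⟨?_, ?_⟩, ?_⟩
    · rw [hK']
      exact flip_shift hiK
    · exact hflip l K.2 hiK hli (by rw [← hl]; exact hKT) (by rw [← hl]; exact hKA)
    · rw [Set.mem_ofPred_eq, top_insert_eq hiK, ← hl]
      exact hKT
    · rw [Finset.card_insert_of_notMem hiK, hKb]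
  have hyB : y ∈ chainsOn B (b + 1) := by
    refine sum_mem fun K hK => ?_
    obtain ⟨l, I, -, -, -, h1, h2, h3⟩ := hPB K hK
    rw [h1]
    exact Finsupp.single_mem_supported ℤ _ ⟨h2, h3⟩
  set z' : Chains r := z - bdry y with hz'
  have hz'B : z' ∈ chainsOn B b := sub_mem hz (bdry_mem hBc hyB)
  have htop : ∀ {u : Chains r} {b : ℕ}, u ∈ chainsOn B b → ∀ K ∈ u.support, top K i ≤ T i + 1 := by
    intro u b hu K hK
    have := (hu hK).1.2 i
    rwa [shift_apply_of_mem (Finset.mem_singleton_self i)] at this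
  have hyi : ∀ K ∈ y.support, i ∈ K.2 := by
    intro K hK
    by_contra hi
    refine Finsupp.mem_support_iff.1 hK ?_
    rw [hy, Finsupp.finsetSum_apply]
    refine Finset.sum_eq_zero fun K' hK' => ?_
    obtain ⟨l, I, -, -, -, h1, -, -⟩ := hPB K' hK'
    rw [h1, Finsupp.single_eq_of_ne']
    rintro rfl
    exact hi (Finset.mem_insert_self _ _)
  have hyapp : ∀ l I, i ∉ I → l i = T i → y (l, insert i I) = sgn (l, insert i I) i *
      z (shift l {i}, I) := by
    intro l I hi hl
    have hsgn : sgn ((shift l {i}, I) : Cube r) i = sgn ((l, insert i I) : Cube r) i := by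
      rw [sgn, sgn]
      simp only
      rw [Finset.filter_insert, if_neg (lt_irrefl i)]
    rw [hy, Finsupp.finsetSum_apply, Finset.sum_eq_single (shift l {i}, I)]
    · rw [flip_shift hi, Finsupp.single_eq_same, hsgn]
    · intro K' hK' hne
      obtain ⟨l', I', hi', -, h0, h1, -, -⟩ := hPB K' hK'
      rw [h1, Finsupp.single_eq_of_ne']
      intro h
      apply hne
      rw [h0, ← flip_insert hi', h, flip_insert hi]
    · intro h
      rw [flip_shift hi, Finsupp.single_eq_same]
      by_cases h0 : z (shift l {i}, I) = 0
      · rw [h0, mul_zero]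
      · exact absurd (Finset.mem_filter.2 ⟨Finsupp.mem_support_iff.2 h0, hi,
          by rw [← hl]; exact shift_apply_of_mem (Finset.mem_singleton_self i)⟩) h
  have h1 : ∀ K ∈ z'.support, i ∉ K.2 → K.1 i ≠ T i + 1 := by
    intro K hK hi hKi
    refine Finsupp.mem_support_iff.1 hK ?_
    obtain ⟨l, hl, -⟩ := exists_eq_shift_of_pos (l := K.1) (i := i) (by omega)
    have hK' : K = (shift l {i}, K.2) := by rw [← hl]
    have hli : l i = T i := by
      rw [hl, shift_apply_of_mem (Finset.mem_singleton_self i)] at hKi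
      omega
    rw [hK', hz', Finsupp.sub_apply,
      bdry_apply_upperFace (htop hyB) (fun K hK h => absurd (hyi K hK) h) hi hli,
      hyapp l K.2 hi hli, ← mul_assoc, sgn_mul_self, one_mul, sub_self]
  have hcyc' : bdry z' = 0 := by rw [hz', map_sub, hcyc, bdry_bdry, sub_zero]
  refine ⟨y, chainsOn_mono Set.inter_subset_left _ hyB, fun K hK => ?_⟩
  have hKB := hz'B hK
  refine ⟨⟨hKB.1.1, fun k => show top K k ≤ T k from ?_⟩, hKB.2⟩
  have hk : top K k ≤ shift T {i} k := hKB.1.2 k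
  rcases eq_or_ne k i with rfl | hki
  · by_contra hlt
    replace hlt : T k < top K k := not_le.1 hlt
    rw [shift_apply_of_mem (Finset.mem_singleton_self k)] at hk
    -- A remaining cube that spans the last layer would be alone in contributing at its upper face,
    -- so the cycle `z'` has none.
    by_cases hkK : k ∈ K.2
    · have hK1 : K.1 k = T k := by
        rw [top, shift_apply_of_mem hkK] at hk hlt
        omega
      have h2 := bdry_apply_upperFace (htop hz'B) h1 (Finset.notMem_erase k K.2) hK1
      rw [hcyc', Finset.insert_erase hkK] at h2
      rcases mul_eq_zero.1 h2.symm with h3 | h3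
      · exact sgn_ne_zero _ _ h3
      · exact Finsupp.mem_support_iff.1 hK h3
    · refine h1 K hK hkK ?_
      rw [top, shift_apply_of_notMem hkK] at hk hlt
      omega
  · rwa [shift_apply_of_notMem (by simpa using hki)] at hk

variable {h : (Fin r → ℕ) → ℕ} {δ : ℕ} {c : Fin r → ℕ}

/-- The complexes `S_n` have trivial reduced homology for large `n`. -/
theorem IsHilbertFunction.acyclic (hh : IsHilbertFunction h δ c) {n : ℤ}
    (hn : ∀ K ∈ rectCubes c, weight (hilbWeight h) K ≤ n) {b : ℕ} {z : Chains r}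
    (hz : z ∈ chainsOn (S (hilbWeight h) n) b) (hcyc : bdry z = 0) (haug : aug z = 0) :
    ∃ y ∈ chainsOn (S (hilbWeight h) n) (b + 1), bdry y = z := by
  classical
  set A := S (hilbWeight h) n
  have hA : IsComplex A := isComplex_S _ _
  -- Induction on a rectangle [0, T] containing the cycle; `exists_push` removes one layer at a
  -- time.
  let p : (Fin r → ℕ) → Prop := fun T => ∀ z ∈ chainsOn (A ∩ {K | top K ≤ T}) b, bdry z = 0 →
    aug z = 0 → ∃ y ∈ chainsOn A (b + 1), bdry y = z
  have step : ∀ T i, (∀ l I, i ∉ I → l i = T i → top (shift l {i}, I) ≤ shift T {i} →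
      (shift l {i}, I) ∈ A → (l, insert i I) ∈ A) → p T → p (shift T {i}) := by
    intro T i hflip hT z hz hcyc haug
    obtain ⟨y, hy, hy'⟩ := exists_push hA hflip hz hcyc
    obtain ⟨x, hx, hx'⟩ := hT _ hy' (by rw [map_sub, hcyc, bdry_bdry, sub_zero])
      (by rw [map_sub, haug, aug_bdry, sub_zero])
    exact ⟨x + y, add_mem hx hy, by rw [map_add, hx', sub_add_cancel]⟩
  -- Only the origin is left, and the augmentation reads off its coefficient.
  have h0 : p 0 := by
    intro z hz _ haug
    have h1 : ∀ K ∈ z.support, K = (0, ∅) := by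
      intro K hK
      have h2 : top K ≤ 0 := (hz hK).1.2
      have h3 : K.1 = 0 := le_antisymm ((le_shift _ _).trans h2) (zero_le)
      refine Prod.ext h3 (Finset.eq_empty_of_forall_notMem fun i hi => ?_)
      have := h2 i
      rw [top, shift_apply_of_mem hi] at this
      exact absurd this (by simp)
    have h2 : z = Finsupp.single (0, ∅) (z (0, ∅)) := by
      ext K
      by_cases hK : K ∈ z.support
      · rw [h1 K hK, Finsupp.single_eq_same]
      · rw [Finsupp.notMem_support_iff.1 hK]
        by_cases hK' : (0, ∅) = K
        · rw [hK', Finsupp.single_eq_same]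
          exact (Finsupp.notMem_support_iff.1 hK).symm
        · rw [Finsupp.single_eq_of_ne' hK']
    rw [h2, aug_single, if_pos rfl, mul_one] at haug
    rw [haug, Finsupp.single_zero] at h2
    exact ⟨0, zero_mem _, by rw [h2, map_zero]⟩
  -- Up to `c` the cubes needed are present because all of R(0, c) has weight at most n.
  have h1 : ∀ T, T ≤ c → p T := by
    intro T
    induction T using lattice_induction with
    | h0 => exact fun _ => h0
    | hs T i ih =>
      intro hT
      refine step T i (fun l I hi _ htop _ => hn _ (mem_rectCubes.2 ?_))
        (ih ((le_shift _ _).trans hT))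
      rw [top_insert_eq hi]
      exact htop.trans hT
  -- Beyond `c` they are present because flipping preserves the weight.
  have h2 : ∀ k, p (c + k) := by
    intro k
    induction k using lattice_induction with
    | h0 => simpa using h1 c le_rfl
    | hs k i ih =>
      rw [add_shift]
      refine step _ i (fun l I hi hl _ hm => ?_) ih
      have hw := hh.weight_shift (l := l) hi (by rw [hl]; exact Nat.le_add_right _ _)
      exact hw.symm.le.trans hm
  -- The sum of all upper vertices is a crude bound for each of them.
  refine h2 (∑ K ∈ z.support, top K) z (fun K hK => ⟨⟨(hz hK).1, ?_⟩, (hz hK).2⟩) hcyc haug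
  refine le_trans (b := ∑ K ∈ z.support, top K) ?_ (le_add_of_nonneg_left zero_le)
  exact Finset.single_le_sum (f := top) (fun _ _ => zero_le) hK

end Acyclic

/-! ### Ranks of modules over a domain. -/

section DomainRank

open Module

variable {R M N : Type*} [CommRing R] [AddCommGroup M]
  [Module R M] [AddCommGroup N] [Module R N]

theorem finrank_range_add_finrank_ker_of_isDomain [IsDomain R] [Module.Finite R M] (f : M →ₗ[R] N) :
    finrank R (LinearMap.range f) + finrank R (LinearMap.ker f) = finrank R M := by
  rw [← f.quotKerEquivRange.finrank_eq]
  exact Submodule.finrank_quotient_add_finrank _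

theorem finite_of_le [IsNoetherianRing R] {P Q : Submodule R M} (h : P ≤ Q) [Module.Finite R Q] : Module.Finite R P :=
  Module.Finite.of_injective (Submodule.inclusion h) (Submodule.inclusion_injective h)

theorem finrank_subquot_add [IsDomain R] {Z B : Submodule R M} (h : B ≤ Z) [Module.Finite R Z] :
    finrank R (Subquot Z B) + finrank R B = finrank R Z := by
  rw [← (Submodule.submoduleOfEquivOfLe h).finrank_eq]
  exact Submodule.finrank_quotient_add_finrank _

theorem finite_subquot (Z B : Submodule R M) [Module.Finite R Z] : Module.Finite R (Subquot Z B) :=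
  inferInstanceAs (Module.Finite R (↥Z ⧸ B.submoduleOf Z))

theorem finrank_map_add [IsDomain R] (Z : Submodule R M) [Module.Finite R Z] (f : M →ₗ[R] N) :
    finrank R (Z.map f) + finrank R ↥(Z ⊓ LinearMap.ker f) = finrank R Z := by
  have h := finrank_range_add_finrank_ker_of_isDomain (f.domRestrict Z)
  rw [LinearMap.range_domRestrict] at h
  have h1 : LinearMap.ker (f.domRestrict Z) = (Z ⊓ LinearMap.ker f).submoduleOf Z := by
    ext x
    simp [Submodule.submoduleOf]
  rw [h1, (Submodule.submoduleOfEquivOfLe inf_le_left).finrank_eq] at h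
  exact h

theorem finrank_sup_add_finrank_inf_of_isDomain [IsDomain R] [IsNoetherianRing R] (P Q : Submodule R M) [Module.Finite R P]
    [Module.Finite R Q] :
    finrank R ↥(P ⊔ Q) + finrank R ↥(P ⊓ Q) = finrank R P + finrank R Q := by
  have : Module.Finite R ↥(P ⊔ Q) := Submodule.finite_sup P Q
  have : Module.Finite R ↥(P ⊓ Q) := finite_of_le (Q := P) inf_le_left
  have h := Submodule.rank_sup_add_rank_inf_eq P Q
  rw [← finrank_eq_rank, ← finrank_eq_rank, ← finrank_eq_rank, ← finrank_eq_rank] at h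
  exact_mod_cast h

/-- The modules may have torsion, so additivity comes from the exact sequence of the projection
rather than from bases. -/
theorem finrank_prod_of_isDomain [IsDomain R] [Module.Finite R M] [Module.Finite R N] :
    finrank R (M × N) = finrank R M + finrank R N := by
  have h := finrank_range_add_finrank_ker_of_isDomain (LinearMap.fst R M N)
  rw [LinearMap.range_eq_top.2 LinearMap.fst_surjective, finrank_top, LinearMap.ker_fst,
    LinearMap.finrank_range_of_inj LinearMap.inr_injective] at h
  exact h.symm

theorem finrank_pi_of_isDomain [IsDomain R] {ι : Type} [Fintype ι] (M : ι → Type) [∀ i, AddCommGroup (M i)]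
    [∀ i, Module R (M i)] [∀ i, Module.Finite R (M i)] :
    finrank R (∀ i, M i) = ∑ i, finrank R (M i) := by
  revert M
  refine Fintype.induction_empty_option (P := fun ι _ => ∀ (M : ι → Type)
    [∀ i, AddCommGroup (M i)] [∀ i, Module R (M i)] [∀ i, Module.Finite R (M i)],
    finrank R (∀ i, M i) = ∑ i, finrank R (M i)) ?_ ?_ ?_ ι
  · intro α β _ e ih M _ _ _
    let := Fintype.ofEquiv β e.symm
    rw [← (LinearEquiv.piCongrLeft R M e).finrank_eq, ih, ← e.sum_comp]
  · intro M _ _ _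
    rw [finrank_zero_of_subsingleton]
    simp
  · intro α _ ih M _ _ _
    rw [(LinearEquiv.piOptionEquivProd R).finrank_eq, finrank_prod_of_isDomain, ih,
      Fintype.sum_option]

end DomainRank

/-! ### Transport along additive isomorphisms. -/

section AddEquiv

open Module

variable {M N : Type*} [AddCommGroup M] [Module ℤ M] [AddCommGroup N] [Module ℤ N]

/-- `HHDeg` is only an additive subgroup of a ℤ[U]-module, so the comparisons of homology groups
below are additive isomorphisms. -/
theorem finrank_eq_of_addEquiv (e : M ≃+ N) : finrank ℤ M = finrank ℤ N :=
  (e.toLinearEquiv fun c x => by simpa using map_intCast_smul e ℤ ℤ c x).finrank_eq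

theorem finite_of_addEquiv (e : M ≃+ N) [Module.Finite ℤ M] : Module.Finite ℤ N :=
  Module.Finite.equiv (e.toLinearEquiv fun c x => by simpa using map_intCast_smul e ℤ ℤ c x)

/-- A description of a subquotient as an additive group. -/
theorem nonempty_subquot_addEquiv {R M N : Type*} [CommRing R] [AddCommGroup M] [Module R M]
    [AddCommGroup N] {Z B : Submodule R M} (ψ : ↥Z →+ N) (hs : Function.Surjective ψ)
    (hk : ∀ z, ψ z = 0 ↔ (z : M) ∈ B) : Nonempty (Subquot Z B ≃+ N) := by
  have h : (B.submoduleOf Z).toAddSubgroup = ψ.ker := by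
    ext z
    exact (hk z).symm
  exact ⟨(QuotientAddGroup.quotientAddEquivOfEq h).trans
    (QuotientAddGroup.quotientKerEquivOfSurjective ψ hs)⟩

end AddEquiv

/-! ### Betti numbers of finite cubical complexes. -/

section Cubical

open Module

variable {A : Set (Cube r)}

theorem finite_chainsOn (hA : A.Finite) (b : ℕ) : Module.Finite ℤ (chainsOn A b) := by
  have : Finite {c | c ∈ A ∧ c.2.card = b} := (hA.subset fun _ h => h.1).to_subtype
  exact Module.Finite.equiv (Finsupp.supportedEquivFinsupp _).symm

theorem finrank_chainsOn (hA : A.Finite) (b : ℕ) :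
    finrank ℤ (chainsOn A b) = (hA.toFinset.filter fun c => c.2.card = b).card := by
  have : Fintype {c | c ∈ A ∧ c.2.card = b} := (hA.subset fun _ h => h.1).fintype
  rw [chainsOn, (Finsupp.supportedEquivFinsupp _).finrank_eq, finrank_finsupp_self,
    ← Set.toFinset_card]
  congr 1
  ext c
  simp

theorem chainsOn_eq_bot {b : ℕ} (hb : r < b) : chainsOn A b = ⊥ := by
  have : {c : Cube r | c ∈ A ∧ c.2.card = b} = ∅ := by
    ext c
    simp only [Set.mem_ofPred_eq, Set.mem_empty_iff_false, iff_false, not_and]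
    intro _ h
    have := Finset.card_le_univ c.2
    rw [Fintype.card_fin] at this
    omega
  rw [chainsOn, this, Finsupp.supported_empty]

theorem chainsOn_empty (b : ℕ) : chainsOn (∅ : Set (Cube r)) b = ⊥ := by
  have : {c : Cube r | c ∈ (∅ : Set (Cube r)) ∧ c.2.card = b} = ∅ := by
    ext c
    simp
  rw [chainsOn, this, Finsupp.supported_empty]

theorem chainsOn_zero_inf_ker : chainsOn A 0 ⊓ LinearMap.ker bdry = chainsOn A 0 :=
  inf_eq_left.2 fun _ hz => bdry_eq_zero hz

theorem boundaries_le_cycles (hA : IsComplex A) (b : ℕ) :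
    (chainsOn A (b + 1)).map bdry ≤ chainsOn A b ⊓ LinearMap.ker bdry := by
  rintro _ ⟨y, hy, rfl⟩
  exact ⟨bdry_mem hA hy, bdry_bdry y⟩

theorem finrank_H (hA : IsComplex A) (hf : A.Finite) (b : ℕ) :
    (finrank ℤ (H A b) : ℤ) = finrank ℤ ↥(chainsOn A b ⊓ LinearMap.ker bdry) -
      finrank ℤ ((chainsOn A (b + 1)).map bdry) := by
  have := finite_chainsOn hf b
  have : Module.Finite ℤ ↥(chainsOn A b ⊓ LinearMap.ker bdry) :=
    finite_of_le (Q := chainsOn A b) inf_le_left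
  have h : finrank ℤ (H A b) + _ = _ := finrank_subquot_add (boundaries_le_cycles hA b)
  rw [← h]
  push_cast
  ring

theorem finite_H (hf : A.Finite) (b : ℕ) : Module.Finite ℤ (H A b) := by
  have := finite_chainsOn hf b
  have : Module.Finite ℤ ↥(chainsOn A b ⊓ LinearMap.ker bdry) :=
    finite_of_le (Q := chainsOn A b) inf_le_left
  exact finite_subquot _ _

/-- The Euler–Poincaré formula. -/
theorem chiTop_eq (hA : IsComplex A) (hf : A.Finite) :
    chiTop A = ∑ K ∈ hf.toFinset, (-1 : ℤ) ^ K.2.card := by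
  -- The sums truncated at m differ by the rank of the boundaries in dimension m, which is zero for
  -- m = r because there are no cubes of dimension r + 1.
  have key : ∀ m : ℕ, ∑ b ∈ Finset.range (m + 1), (-1 : ℤ) ^ b * (finrank ℤ (H A b) : ℤ) =
      ∑ b ∈ Finset.range (m + 1), (-1 : ℤ) ^ b * (finrank ℤ (chainsOn A b) : ℤ) -
        (-1) ^ m * (finrank ℤ ((chainsOn A (m + 1)).map bdry) : ℤ) := by
    intro m
    induction m with
    | zero =>
      rw [Finset.sum_range_one, Finset.sum_range_one, finrank_H hA hf, chainsOn_zero_inf_ker]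
      ring
    | succ m ih =>
      have := finite_chainsOn hf (m + 1)
      have h := finrank_map_add (chainsOn A (m + 1)) bdry
      rw [Finset.sum_range_succ, ih, Finset.sum_range_succ _ (m + 1), finrank_H hA hf, ← h]
      push_cast
      ring
  rw [chiTop, key, chainsOn_eq_bot (Nat.lt_succ_self r), Submodule.map_bot, finrank_bot]
  simp only [Nat.cast_zero, mul_zero, sub_zero, finrank_chainsOn hf]
  rw [← Finset.sum_fiberwise_of_maps_to (s := hf.toFinset) (t := Finset.range (r + 1))
    (g := fun K => K.2.card)]
  · refine Finset.sum_congr rfl fun b _ => ?_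
    rw [Finset.sum_congr rfl (g := fun _ => (-1 : ℤ) ^ b), Finset.sum_const, nsmul_eq_mul, mul_comm]
    intro K hK
    rw [(Finset.mem_filter.1 hK).2]
  · intro K _
    rw [Finset.mem_range, Nat.lt_succ_iff]
    simpa using Finset.card_le_univ K.2

/-- The cycles of the augmented cubical complex. -/
def redCycles (A : Set (Cube r)) (b : ℕ) : Submodule ℤ (Chains r) :=
  chainsOn A b ⊓ LinearMap.ker bdry ⊓ LinearMap.ker aug

/-- Reduced homology. -/
abbrev redH (A : Set (Cube r)) (b : ℕ) : Type :=
  Subquot (redCycles A b) ((chainsOn A (b + 1)).map bdry)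

theorem finite_redCycles (hf : A.Finite) (b : ℕ) : Module.Finite ℤ (redCycles A b) := by
  have := finite_chainsOn hf b
  exact finite_of_le (Q := chainsOn A b) (inf_le_left.trans inf_le_left)

/-- On 0-chains the augmentation is onto because A has a vertex; on chains of positive dimension it
is zero. -/
theorem finrank_redH (hA : IsComplex A) (hf : A.Finite) {l : Fin r → ℕ} (hl : (l, ∅) ∈ A) (b : ℕ) :
    (finrank ℤ (redH A b) : ℤ) = finrank ℤ (H A b) - if b = 0 then 1 else 0 := by
  have hle : (chainsOn A (b + 1)).map bdry ≤ redCycles A b := fun x hx =>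
    ⟨boundaries_le_cycles hA b hx, by obtain ⟨y, -, rfl⟩ := hx; exact aug_bdry y⟩
  have h1 := finite_redCycles hf b
  have h2 := finrank_subquot_add hle
  rw [finrank_H hA hf]
  have := finite_chainsOn hf b
  have : Module.Finite ℤ ↥(chainsOn A b ⊓ LinearMap.ker bdry) :=
    finite_of_le (Q := chainsOn A b) inf_le_left
  have h3 := finrank_map_add (chainsOn A b ⊓ LinearMap.ker bdry) aug
  have h4 : finrank ℤ ((chainsOn A b ⊓ LinearMap.ker bdry).map aug) = if b = 0 then 1 else 0 := by
    split_ifs with hb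
    · have : (chainsOn A b ⊓ LinearMap.ker bdry).map aug = ⊤ := by
        rw [eq_top_iff]
        intro a _
        refine ⟨Finsupp.single (l, ∅) a, ⟨Finsupp.single_mem_supported ℤ a ⟨hl, by simp [hb]⟩, ?_⟩, ?_⟩
        · exact LinearMap.mem_ker.2 (by rw [bdry_single]; simp)
        · rw [aug_single]
          simp
      rw [this, finrank_top, finrank_self]
    · have : (chainsOn A b ⊓ LinearMap.ker bdry).map aug = ⊥ := by
        rw [eq_bot_iff]
        rintro _ ⟨z, hz, rfl⟩
        exact aug_eq_zero hb hz.1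
      rw [this, finrank_bot]
  rw [h4] at h3
  change _ + finrank ℤ (redCycles A b) = _ at h3
  change finrank ℤ (redH A b) + _ = _ at h2
  split_ifs at h3 ⊢ <;> omega

theorem one_le_finrank_H_zero (hA : IsComplex A) (hf : A.Finite) {l : Fin r → ℕ}
    (hl : (l, ∅) ∈ A) : 1 ≤ finrank ℤ (H A 0) := by
  have := finrank_redH hA hf hl 0
  rw [if_pos rfl] at this
  omega

theorem finrank_H_zero_of_acyclic (hA : IsComplex A) (hf : A.Finite) {l : Fin r → ℕ}
    (hl : (l, ∅) ∈ A) (h : redCycles A 0 ≤ (chainsOn A 1).map bdry) : finrank ℤ (H A 0) = 1 := by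
  have h1 := finrank_redH hA hf hl 0
  have : Subsingleton (redH A 0) :=
    Submodule.Quotient.subsingleton_iff.2 (Submodule.submoduleOf_eq_top.2 h)
  rw [if_pos rfl, finrank_zero_of_subsingleton] at h1
  push_cast at h1
  omega

end Cubical

/-! ### The spectral sequence of the level filtration. -/

section Pages

open Module

variable (w : (Fin r → ℕ) → ℤ) (n : ℤ)

theorem SX_top : SX w n ⊤ = ∅ := by
  ext K
  simp only [SX, Set.mem_ofPred_eq, top_le_iff, ENat.natCast_ne_top, and_false,
    Set.mem_empty_iff_false]

theorem SX_zero : SX w n 0 = S w n := by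
  ext K
  simp [SX]

theorem SX_anti {d e : ℕ∞} (h : d ≤ e) : SX w n e ⊆ SX w n d := fun _ hK => ⟨hK.1, h.trans hK.2⟩

variable {w n}

theorem SX_eq_empty {D : ℕ} (hD : ∀ K ∈ S w n, level K ≤ D) {e : ℕ∞} (he : D < e) :
    SX w n e = ∅ := by
  ext K
  simp only [SX, Set.mem_ofPred_eq, Set.mem_empty_iff_false, iff_false, not_and, not_le]
  exact fun hK => lt_of_le_of_lt (by exact_mod_cast hD K hK) he

theorem pageZ_top (d : ℕ∞) (b : ℕ) :
    pageZ w n ⊤ d b = chainsOn (SX w n d) b ⊓ LinearMap.ker bdry := by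
  rw [pageZ, add_top, SX_top, Finsupp.supported_empty]
  rfl

theorem pageB_top (d : ℕ∞) (b : ℕ) :
    pageB w n ⊤ d b = chainsOn (SX w n d) b ⊓ (chainsOn (S w n) (b + 1)).map bdry := by
  -- Truncated subtraction yields level 0, so the chains to be bounded may range over all of S_n.
  have : d - (⊤ - 1) = 0 := by simp
  rw [pageB, this, SX_zero]

/-- Levels in S_n are at most D: a boundary pushed up by more than D levels is zero, and going down
D levels from any nonempty step reaches level 0. -/
theorem page_stabilizes {D : ℕ} (hD : ∀ K ∈ S w n, level K ≤ D) {k : ℕ} (hk : D + 1 ≤ k)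
    (d b : ℕ) : pageZ w n k d b = pageZ w n ⊤ d b ∧ pageB w n k d b = pageB w n ⊤ d b := by
  constructor
  · rw [pageZ, pageZ, add_top, SX_top, SX_eq_empty hD (e := (d : ℕ∞) + k)]
    exact_mod_cast (by omega : D < d + k)
  · rcases Nat.lt_or_ge D d with h | h
    · rw [pageB, pageB, SX_eq_empty hD (by exact_mod_cast h), chainsOn_empty, bot_inf_eq, bot_inf_eq]
    · have : (d : ℕ∞) - ((k : ℕ∞) - 1) = 0 := by
        rw [tsub_eq_zero_iff_le]
        have : ((d : ℕ) : ℕ∞) ≤ ((k - 1 : ℕ) : ℕ∞) := by exact_mod_cast (by omega : d ≤ k - 1)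
        simpa using this
      rw [pageB_top, pageB, this, SX_zero]

/-- The quotient of `pageZ` by `pageB` at level d is the image in H_b(S_n) of the homology of the
d-th step; E^∞ compares two consecutive images. This form of the rank telescopes. -/
theorem finrank_page (hf : (S w n).Finite) (d b : ℕ) :
    (finrank ℤ (Page w n ⊤ d b) : ℤ) =
      (finrank ℤ (pageZ w n ⊤ d b) - finrank ℤ (pageB w n ⊤ d b)) -
      (finrank ℤ (pageZ w n ⊤ (d + 1 : ℕ) b) - finrank ℤ (pageB w n ⊤ (d + 1 : ℕ) b)) := by
  have hsub : SX w n ((d + 1 : ℕ) : ℕ∞) ⊆ SX w n d := SX_anti w n (by exact_mod_cast d.le_succ)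
  have hZ' : pageZ w n ⊤ d b ⊓ chainsOn (SX w n ((d : ℕ∞) + 1)) b = pageZ w n ⊤ (d + 1 : ℕ) b := by
    rw [pageZ_top, pageZ_top, inf_right_comm, ← Nat.cast_succ, Nat.succ_eq_add_one,
      inf_eq_right.2 (chainsOn_mono hsub b)]
  have hint : pageZ w n ⊤ (d + 1 : ℕ) b ⊓ pageB w n ⊤ d b = pageB w n ⊤ (d + 1 : ℕ) b := by
    rw [pageZ_top, pageB_top, pageB_top]
    have h1 : (chainsOn (S w n) (b + 1)).map bdry ≤ LinearMap.ker bdry :=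
      (boundaries_le_cycles (isComplex_S w n) b).trans inf_le_right
    have h2 := chainsOn_mono hsub b
    ext x
    simp only [Submodule.mem_inf]
    exact ⟨fun h => ⟨h.1.1, h.2.2⟩, fun h => ⟨⟨h.1, h1 h.2⟩, h2 h.1, h.2⟩⟩
  have hBZ : pageB w n ⊤ d b ≤ pageZ w n ⊤ d b := by
    rw [pageZ_top, pageB_top]
    exact inf_le_inf_left _ ((boundaries_le_cycles (isComplex_S w n) b).trans inf_le_right)
  have hfin : ∀ e : ℕ, Module.Finite ℤ (pageZ w n ⊤ e b) := fun e => by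
    have := finite_chainsOn (hf.subset fun _ (h : _ ∈ SX w n e) => h.1) b
    exact finite_of_le (Q := chainsOn (SX w n e) b) inf_le_left
  have := hfin d
  have := hfin (d + 1)
  have : Module.Finite ℤ (pageB w n ⊤ d b) := finite_of_le hBZ
  have h2 : finrank ℤ (Page w n ⊤ d b) + _ = _ := finrank_subquot_add (sup_le inf_le_left hBZ)
  have h3 := finrank_sup_add_finrank_inf_of_isDomain (pageZ w n ⊤ (d + 1 : ℕ) b) (pageB w n ⊤ d b)
  rw [hint] at h3
  have h4 : finrank ℤ ↥(pageZ w n ⊤ d b ⊓ chainsOn (SX w n ((d : ℕ∞) + 1)) b ⊔ pageB w n ⊤ d b) =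
      finrank ℤ ↥(pageZ w n ⊤ (d + 1 : ℕ) b ⊔ pageB w n ⊤ d b) := by rw [hZ']
  omega

theorem page_eq_zero {D : ℕ} (hD : ∀ K ∈ S w n, level K ≤ D) {d : ℕ} (hd : D < d) (b : ℕ) :
    finrank ℤ (Page w n ⊤ d b) = 0 := by
  have h : pageZ w n ⊤ d b = ⊥ := by
    rw [pageZ_top, SX_eq_empty hD (by exact_mod_cast hd), chainsOn_empty, bot_inf_eq]
  have : Subsingleton (Page w n ⊤ d b) :=
    Submodule.Quotient.subsingleton_iff.2 (Submodule.submoduleOf_eq_top.2 (by rw [h]; exact bot_le))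
  exact finrank_zero_of_subsingleton

/-- Telescoping: level 0 gives all of H_b(S_n), and level D + 1 is empty. -/
theorem sum_finrank_page (hf : (S w n).Finite) {D : ℕ} (hD : ∀ K ∈ S w n, level K ≤ D) (b : ℕ) :
    ∑ d ∈ Finset.range (D + 1), finrank ℤ (Page w n ⊤ d b) = finrank ℤ (H (S w n) b) := by
  have h1 : ((∑ d ∈ Finset.range (D + 1), finrank ℤ (Page w n ⊤ d b) : ℕ) : ℤ) =
      finrank ℤ (H (S w n) b) := by
    push_cast
    simp_rw [finrank_page hf]
    rw [Finset.sum_range_sub' fun d : ℕ => (finrank ℤ (pageZ w n ⊤ d b) : ℤ) -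
      finrank ℤ (pageB w n ⊤ d b)]
    have h0 : ((D + 1 : ℕ) : ℕ∞) > D := by exact_mod_cast D.lt_succ_self
    rw [finrank_H (isComplex_S w n) hf, pageZ_top, pageB_top, pageZ_top, pageB_top,
      SX_eq_empty hD h0, chainsOn_empty, bot_inf_eq, bot_inf_eq, finrank_bot, Nat.cast_zero,
      SX_zero, inf_eq_right.2 ((boundaries_le_cycles (isComplex_S w n) b).trans inf_le_left)]
    ring
  exact_mod_cast h1

end Pages

/-! ### The grading of ℒ. -/

section Homogeneous

variable (w : (Fin r → ℕ) → ℤ)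

/-- The embedding of the chains of `S_n` in `ℒ` as homogeneous elements of degree `-2n`. -/
def homog (n : ℤ) : Chains r →+ L r :=
  Finsupp.liftAddHom fun K => if weight w K ≤ n then
    (Finsupp.singleAddHom K).comp (Polynomial.monomial (n - weight w K).toNat).toAddMonoidHom else 0

/-- The homogeneous component of degree `-2n`, as a chain of `S_n`. -/
def component (n : ℤ) : L r →+ Chains r :=
  Finsupp.liftAddHom fun K => if weight w K ≤ n then
    (Finsupp.singleAddHom K).comp (Polynomial.lcoeff ℤ (n - weight w K).toNat).toAddMonoidHom else 0

variable {w}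

theorem homog_single {n : ℤ} {K : Cube r} (hK : weight w K ≤ n) (a : ℤ) :
    homog w n (Finsupp.single K a) =
      Finsupp.single K (Polynomial.monomial (n - weight w K).toNat a) := by
  rw [homog, Finsupp.liftAddHom_apply_single, if_pos hK]
  rfl

theorem component_single (n : ℤ) (K : Cube r) (m : ℕ) (a : ℤ) :
    component w n (Finsupp.single K (Polynomial.monomial m a)) =
      if weight w K + m = n then Finsupp.single K a else 0 := by
  rw [component, Finsupp.liftAddHom_apply_single]
  split_ifs with h1 h2 h2
  · have : (n - weight w K).toNat = m := by omega
    change Finsupp.single K ((Polynomial.monomial m a).coeff (n - weight w K).toNat) = _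
    rw [this, Polynomial.coeff_monomial, if_pos rfl]
  · have : m ≠ (n - weight w K).toNat := by omega
    change Finsupp.single K ((Polynomial.monomial m a).coeff (n - weight w K).toNat) = _
    rw [Polynomial.coeff_monomial, if_neg this, Finsupp.single_zero]
  · omega
  · rfl

theorem L_induction {p : L r → Prop} (h0 : p 0) (hadd : ∀ x y, p x → p y → p (x + y))
    (hs : ∀ K m a, p (Finsupp.single K (Polynomial.monomial m a))) (x : L r) : p x := by
  induction x using Finsupp.induction_linear with
  | zero => exact h0
  | add x y hx hy => exact hadd x y hx hy
  | single K q =>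
    induction q using Polynomial.induction_on' with
    | add q q' hq hq' =>
      rw [Finsupp.single_add]
      exact hadd _ _ hq hq'
    | monomial m a => exact hs K m a

theorem component_apply (n : ℤ) (x : L r) (K : Cube r) : component w n x K =
    if weight w K ≤ n then (x K).coeff (n - weight w K).toNat else 0 := by
  induction x using L_induction with
  | h0 => simp
  | hadd x y hx hy =>
    rw [map_add, Finsupp.add_apply, hx, hy, Finsupp.add_apply, Polynomial.coeff_add]
    split_ifs <;> simp
  | hs K' m a =>
    rw [component_single]
    by_cases hK : K' = K
    · subst hK
      rw [Finsupp.single_eq_same, Polynomial.coeff_monomial]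
      split_ifs with h1 h2 h3 h3 h4 <;> first | omega | simp
    · rw [Finsupp.single_eq_of_ne' hK]
      split_ifs <;> simp [hK]

theorem homog_apply (n : ℤ) (z : Chains r) (K : Cube r) : homog w n z K =
    if weight w K ≤ n then Polynomial.monomial (n - weight w K).toNat (z K) else 0 := by
  induction z using Finsupp.induction_linear with
  | zero => simp
  | add x y hx hy =>
    rw [map_add, Finsupp.add_apply, hx, hy, Finsupp.add_apply, map_add]
    split_ifs <;> simp
  | single K' a =>
    rw [homog, Finsupp.liftAddHom_apply_single]
    by_cases hK : K' = K
    · subst hK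
      rw [Finsupp.single_eq_same]
      split_ifs
      · exact Finsupp.single_eq_same
      · rfl
    · rw [Finsupp.single_eq_of_ne' hK, map_zero, ite_self]
      split_ifs
      · exact Finsupp.single_eq_of_ne' hK
      · rfl

variable (w) in
theorem bdryW_single (K : Cube r) (m : ℕ) (a : ℤ) :
    bdryW w (Finsupp.single K (Polynomial.monomial m a)) = ∑ i ∈ K.2, sgn K i •
      (Finsupp.single (upperFace K i)
          (Polynomial.monomial (m + (weight w K - weight w (upperFace K i)).toNat) a) -
        Finsupp.single (lowerFace K i)
          (Polynomial.monomial (m + (weight w K - weight w (lowerFace K i)).toNat) a)) := by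
  rw [bdryW, Finsupp.linearCombination_single, Finset.smul_sum]
  refine Finset.sum_congr rfl fun i _ => ?_
  rw [smul_comm, smul_sub, Finsupp.smul_single, Finsupp.smul_single, smul_eq_mul, smul_eq_mul,
    Polynomial.monomial_mul_X_pow, Polynomial.monomial_mul_X_pow]

/-- The exponent w(□) - w(□_k) gives every term of ∂_w the degree of the cube it comes from, so
forgetting U on a homogeneous part yields the ordinary boundary. -/
theorem component_bdryW (n : ℤ) (x : L r) : component w n (bdryW w x) = bdry (component w n x) := by
  induction x using L_induction with
  | h0 => simp
  | hadd x y hx hy => rw [map_add, map_add, map_add, map_add, hx, hy]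
  | hs K m a =>
    rw [bdryW_single, map_sum, component_single]
    have h : ∀ i ∈ K.2, component w n (sgn K i •
      (Finsupp.single (upperFace K i)
          (Polynomial.monomial (m + (weight w K - weight w (upperFace K i)).toNat) a) -
        Finsupp.single (lowerFace K i)
          (Polynomial.monomial (m + (weight w K - weight w (lowerFace K i)).toNat) a))) =
        if weight w K + m = n then a • sgn K i • (Finsupp.single (upperFace K i) (1 : ℤ) -
          Finsupp.single (lowerFace K i) 1) else 0 := by
      intro i hi
      have h1 := weight_upperFace_le w hi
      have h2 := weight_lowerFace_le w K i
      rw [map_zsmul, map_sub, component_single, component_single]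
      by_cases hn : weight w K + m = n
      · rw [if_pos hn, if_pos (by push_cast; omega), if_pos (by push_cast; omega), smul_comm a,
          smul_sub a, Finsupp.smul_single, Finsupp.smul_single, smul_eq_mul, mul_one]
      · rw [if_neg hn, if_neg (by push_cast; omega), if_neg (by push_cast; omega), sub_zero,
          smul_zero]
    rw [Finset.sum_congr rfl h]
    split_ifs
    · rw [bdry_single, Finset.smul_sum]
    · simp

theorem homog_bdry {n : ℤ} {b : ℕ} {z : Chains r} (hz : z ∈ chainsOn (S w n) b) :
    homog w n (bdry z) = bdryW w (homog w n z) := by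
  rw [← Finsupp.sum_single z, Finsupp.sum, map_sum, map_sum, map_sum, map_sum]
  refine Finset.sum_congr rfl fun K hK => ?_
  have hK : weight w K ≤ n := (hz hK).1
  rw [homog_single hK, bdryW_single, bdry_single, map_zsmul, map_sum, Finset.smul_sum]
  refine Finset.sum_congr rfl fun i hi => ?_
  have h1 := weight_upperFace_le w hi
  have h2 := weight_lowerFace_le w K i
  rw [map_zsmul, map_sub, homog_single (h1.trans hK), homog_single (h2.trans hK), smul_comm,
    smul_sub (z K), Finsupp.smul_single, Finsupp.smul_single, Polynomial.smul_monomial,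
    Polynomial.smul_monomial, smul_eq_mul, mul_one]
  congr 5 <;> omega

theorem homog_mem_Lb {n : ℤ} {A : Set (Cube r)} {b : ℕ} {z : Chains r} (hz : z ∈ chainsOn A b) :
    homog w n z ∈ Lb r b := by
  intro K hK
  have h1 : z K ≠ 0 := by
    intro h0
    refine Finsupp.mem_support_iff.1 hK ?_
    rw [homog_apply, h0, map_zero, ite_self]
  exact (hz (Finsupp.mem_support_iff.2 h1)).2

theorem component_mem {n : ℤ} {b : ℕ} {x : L r} (hx : x ∈ Lb r b) :
    component w n x ∈ chainsOn (S w n) b := by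
  intro K hK
  have h := Finsupp.mem_support_iff.1 hK
  rw [component_apply] at h
  split_ifs at h with h1
  · refine ⟨h1, hx (Finsupp.mem_support_iff.2 fun h0 => h ?_)⟩
    rw [h0, Polynomial.coeff_zero]
  · exact absurd rfl h

theorem component_homog {n : ℤ} {b : ℕ} {z : Chains r} (hz : z ∈ chainsOn (S w n) b) (n' : ℤ) :
    component w n' (homog w n z) = if n' = n then z else 0 := by
  ext K
  rw [component_apply, homog_apply]
  by_cases hK : z K = 0
  · split_ifs <;> simp [hK]
  · have h1 : weight w K ≤ n := (hz (Finsupp.mem_support_iff.2 hK)).1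
    rw [if_pos h1, Polynomial.coeff_monomial]
    split_ifs <;> first | omega | simp

theorem homog_mem_LDeg {n : ℤ} (z : Chains r) : homog w n z ∈ LDeg w (-2 * n) := by
  intro K m h
  rw [homog_apply]
  split_ifs with h1
  · rw [Polynomial.coeff_monomial, if_neg]
    omega
  · exact Polynomial.coeff_zero _

theorem homog_component {n : ℤ} {x : L r} (hx : x ∈ LDeg w (-2 * n)) :
    homog w n (component w n x) = x := by
  ext K m
  rw [homog_apply, component_apply]
  by_cases hm : -2 * (m : ℤ) - 2 * weight w K = -2 * n
  · rw [if_pos (by omega), if_pos (by omega), Polynomial.coeff_monomial, if_pos (by omega)]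
    congr 1
    omega
  · rw [hx K m hm]
    split_ifs with h1
    · rw [Polynomial.coeff_monomial, if_neg (by omega)]
    · exact Polynomial.coeff_zero _

theorem LDeg_eq_zero {D : ℤ} (hD : ∀ n, D ≠ -2 * n) {x : L r} (hx : x ∈ LDeg w D) : x = 0 := by
  ext K m
  exact hx K m fun h => hD (m + weight w K) (by omega)

/-- An element of `ℒ` is the sum of its homogeneous components. -/
theorem exists_eq_sum_homog (x : L r) :
    ∃ s : Finset ℤ, x = ∑ n ∈ s, homog w n (component w n x) := by
  classical
  refine ⟨x.support.biUnion fun K => (x K).support.image fun m : ℕ => weight w K + (m : ℤ), ?_⟩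
  ext K m
  rw [Finsupp.finsetSum_apply, Polynomial.finsetSum_coeff]
  have h : ∀ n, (homog w n (component w n x) K).coeff m =
      if weight w K + m = n then (x K).coeff m else 0 := by
    intro n
    rw [homog_apply, component_apply]
    split_ifs with h1 h2 h2
    · rw [Polynomial.coeff_monomial, if_pos (by omega)]
      congr 1
      omega
    · rw [Polynomial.coeff_monomial, if_neg (by omega)]
    · omega
    · exact Polynomial.coeff_zero _
  simp_rw [h]
  rw [Finset.sum_ite_eq]
  split_ifs with hs
  · rfl
  · by_contra h0
    refine hs (Finset.mem_biUnion.2 ⟨K, Finsupp.mem_support_iff.2 ?_, Finset.mem_image.2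
      ⟨m, Polynomial.mem_support_iff.2 h0, rfl⟩⟩)
    intro hK
    rw [hK] at h0
    exact h0 (Polynomial.coeff_zero _)

/-- U ^ m l goes to U ^ (m + w(l)), so the coefficient of U ^ n sees only the component of degree
-2n. -/
theorem coeff_augW (n : ℤ) (x : L r) : (augW w x).coeff n = aug (component w n x) := by
  induction x using L_induction with
  | h0 => simp
  | hadd x y hx hy => rw [map_add, map_add, map_add, AddMonoidAlgebra.coeff_add,
      Finsupp.add_apply, hx, hy]
  | hs K m a =>
    rw [component_single, augW, Finsupp.linearCombination_single]
    by_cases hK : K.2 = ∅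
    · have hw : weight w K = w K.1 := by
        rw [← weight_vertex w K.1, ← hK]
      rw [if_pos hK, Algebra.smul_def, LaurentPolynomial.algebraMap_eq_toLaurent,
        ← Polynomial.C_mul_X_pow_eq_monomial, Polynomial.toLaurent_C_mul_X_pow, mul_assoc,
        ← LaurentPolynomial.T_add, ← LaurentPolynomial.single_eq_C_mul_T, hw]
      split_ifs with h
      · rw [aug_single, if_pos hK, mul_one, add_comm, h]
        exact Finsupp.single_eq_same
      · rw [map_zero]
        exact Finsupp.single_eq_of_ne' (by omega)
    · rw [if_neg hK, smul_zero]
      split_ifs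
      · rw [aug_single, if_neg hK, mul_zero]
        rfl
      · rw [map_zero]
        rfl

/-- Removes the case distinction of the definition: 0-chains are always cycles, and the augmentation
vanishes in positive dimension. -/
theorem mem_redCyclesW {b : ℕ} {x : L r} :
    x ∈ redCyclesW w b ↔ x ∈ Lb r b ∧ bdryW w x = 0 ∧ augW w x = 0 := by
  rw [redCyclesW]
  split_ifs with hb
  · subst hb
    refine ⟨fun h => ⟨h.1, ?_, h.2⟩, fun h => ⟨h.1, h.2.2⟩⟩
    obtain ⟨s, hs⟩ := exists_eq_sum_homog (w := w) x
    rw [hs, map_sum]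
    refine Finset.sum_eq_zero fun n _ => ?_
    have h1 := component_mem (w := w) (n := n) h.1
    rw [← homog_bdry h1, bdry_eq_zero h1, map_zero]
  · refine ⟨fun h => ⟨h.1, h.2, ?_⟩, fun h => ⟨h.1, h.2.1⟩⟩
    refine LaurentPolynomial.ext fun n => ?_
    rw [coeff_augW, aug_eq_zero hb (component_mem h.1)]
    rfl

/-- ∂_w respects the grading and an element has finitely many components, so it can be bounded
degree by degree. -/
theorem mem_boundariesW {b : ℕ} {x : L r} :
    x ∈ boundariesW w b ↔ ∀ n, component w n x ∈ (chainsOn (S w n) (b + 1)).map bdry := by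
  constructor
  · rintro ⟨y, hy, rfl⟩ n
    exact ⟨_, component_mem hy, (component_bdryW n y).symm⟩
  · intro h
    obtain ⟨s, hs⟩ := exists_eq_sum_homog (w := w) x
    choose y hy hy' using h
    rw [hs]
    refine sum_mem fun n _ => ?_
    rw [← hy' n, homog_bdry (hy n)]
    exact ⟨_, homog_mem_Lb (hy n), rfl⟩

theorem mem_Lb_of_component {b : ℕ} {x : L r}
    (h : ∀ n, component w n x ∈ chainsOn (S w n) b) : x ∈ Lb r b := by
  obtain ⟨s, hs⟩ := exists_eq_sum_homog (w := w) x
  rw [hs]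
  exact sum_mem fun n _ => homog_mem_Lb (h n)

theorem eq_zero_of_component {x : L r} (h : ∀ n, component w n x = 0) : x = 0 := by
  obtain ⟨s, hs⟩ := exists_eq_sum_homog (w := w) x
  rw [hs]
  exact Finset.sum_eq_zero fun n _ => by rw [h, map_zero]

theorem mem_cyclesW {b : ℕ} {x : L r} : x ∈ cyclesW w b ↔
    ∀ n, component w n x ∈ chainsOn (S w n) b ⊓ LinearMap.ker bdry := by
  constructor
  · intro h n
    refine ⟨component_mem h.1, LinearMap.mem_ker.2 ?_⟩
    rw [← component_bdryW, LinearMap.mem_ker.1 h.2, map_zero]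
  · intro h
    refine ⟨mem_Lb_of_component fun n => (h n).1, LinearMap.mem_ker.2 ?_⟩
    refine eq_zero_of_component (w := w) fun n => ?_
    rw [component_bdryW]
    exact LinearMap.mem_ker.1 (h n).2

theorem mem_redCyclesW_iff_component {b : ℕ} {x : L r} :
    x ∈ redCyclesW w b ↔ ∀ n, component w n x ∈ redCycles (S w n) b := by
  rw [mem_redCyclesW]
  constructor
  · rintro ⟨h1, h2, h3⟩ n
    refine ⟨mem_cyclesW.1 ⟨h1, h2⟩ n, LinearMap.mem_ker.2 ?_⟩
    rw [← coeff_augW, h3]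
    rfl
  · intro h
    have h1 := mem_cyclesW.2 fun n => (h n).1
    refine ⟨h1.1, h1.2, LaurentPolynomial.ext fun n => ?_⟩
    rw [coeff_augW]
    exact LinearMap.mem_ker.1 (h n).2

end Homogeneous

/-! ### Lattice homology as the homology of the S_n. -/

section Identification

open Module

theorem Subquot.mk_congr {R M : Type*} [CommRing R] [AddCommGroup M] [Module R M]
    {Z B : Submodule R M} {x y : ↥Z} (h : (x : M) = y) : Subquot.mk Z B x = Subquot.mk Z B y := by
  rw [Subtype.ext h]

variable {w : (Fin r → ℕ) → ℤ}

theorem homog_mem_cyclesW {n : ℤ} {b : ℕ} {z : Chains r}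
    (hz : z ∈ chainsOn (S w n) b ⊓ LinearMap.ker bdry) : homog w n z ∈ cyclesW w b :=
  ⟨homog_mem_Lb hz.1, LinearMap.mem_ker.2 <| by
    rw [← homog_bdry hz.1, LinearMap.mem_ker.1 hz.2, map_zero]⟩

/-- The homogeneous part of degree `-2n` of the lattice homology is the homology of `S_n`. -/
theorem nonempty_HHDeg_addEquiv (n : ℤ) (b : ℕ) : Nonempty (H (S w n) b ≃+ HHDeg w b (-2 * n)) := by
  let f : ↥(chainsOn (S w n) b ⊓ LinearMap.ker bdry) →+ HHDeg w b (-2 * n) :=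
    { toFun := fun z => ⟨Subquot.mk _ _ ⟨homog w n z, homog_mem_cyclesW z.2⟩,
        ⟨homog w n z, homog_mem_cyclesW z.2⟩, homog_mem_LDeg _, rfl⟩
      map_zero' := by
        refine Subtype.ext ?_
        refine Eq.trans ?_ (map_zero (Subquot.mk (cyclesW w b) (boundariesW w b)))
        exact Subquot.mk_congr (map_zero (homog w n))
      map_add' := fun x y => by
        refine Subtype.ext ?_
        refine Eq.trans ?_ (map_add (Subquot.mk (cyclesW w b) (boundariesW w b)) _ _)
        exact Subquot.mk_congr (map_add (homog w n) _ _) }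
  refine nonempty_subquot_addEquiv f ?_ ?_
  · rintro ⟨_, ⟨x, hx⟩, hD, rfl⟩
    refine ⟨⟨component w n x, mem_cyclesW.1 hx n⟩, Subtype.ext ?_⟩
    exact Subquot.mk_congr (homog_component hD)
  · intro z
    have h1 : f z = 0 ↔ homog w n z ∈ boundariesW w b :=
      Subtype.ext_iff.trans (Submodule.Quotient.mk_eq_zero _)
    rw [h1, mem_boundariesW]
    constructor
    · intro h
      have := h n
      rwa [component_homog z.2.1, if_pos rfl] at this
    · intro h n'
      rw [component_homog z.2.1]
      split_ifs with h2
      · rwa [h2]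
      · exact zero_mem _

/-- All degrees -2m - 2w(□) are even. -/
theorem subsingleton_HHDeg {D : ℤ} (hD : ∀ n, D ≠ -2 * n) (b : ℕ) :
    Subsingleton (HHDeg w b D) := by
  have h : ∀ x : HHDeg w b D, x = 0 := by
    rintro ⟨_, ⟨x, hx⟩, hxD, rfl⟩
    refine Subtype.ext ?_
    exact (Subquot.mk_congr (LDeg_eq_zero hD hxD)).trans (map_zero _)
  exact ⟨fun x y => by rw [h x, h y]⟩

/-- The reduced lattice homology is the sum of the reduced homologies of the `S_n`. -/
theorem nonempty_HHred_addEquiv {m : ℤ} {k : ℕ} (hm : ∀ n < m, S w n = ∅) (b : ℕ)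
    (hk : ∀ n : ℤ, m + k ≤ n → redCycles (S w n) b ≤ (chainsOn (S w n) (b + 1)).map bdry) :
    Nonempty (HHred w b ≃+ ∀ j : Fin k, redH (S w (m + (j : ℕ))) b) := by
  let f : ↥(redCyclesW w b) →+ ∀ j : Fin k, redH (S w (m + (j : ℕ))) b :=
    { toFun := fun x j => Subquot.mk _ _
        ⟨component w (m + (j : ℕ)) x, mem_redCyclesW_iff_component.1 x.2 _⟩
      map_zero' := by
        funext j
        exact (Subquot.mk_congr (map_zero (component w _))).trans (map_zero _)
      map_add' := fun x y => by
        funext j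
        exact (Subquot.mk_congr (map_add (component w _) _ _)).trans (map_add _ _ _) }
  refine nonempty_subquot_addEquiv f ?_ ?_
  · intro q
    have hq : ∀ j : Fin k, ∃ z : ↥(redCycles (S w (m + (j : ℕ))) b), Subquot.mk _ _ z = q j :=
      fun j => Submodule.mkQ_surjective _ (q j)
    choose z hz using hq
    -- Each representative is placed in its own degree, so taking one component recovers one
    -- representative.
    have hc : ∀ n, component w n (∑ j : Fin k, homog w (m + (j : ℕ)) (z j)) =
        ∑ j : Fin k, if n = m + (j : ℕ) then (z j : Chains r) else 0 := by
      intro n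
      rw [map_sum]
      exact Finset.sum_congr rfl fun j _ => component_homog (z j).2.1.1 n
    have hmem : ∑ j : Fin k, homog w (m + (j : ℕ)) (z j) ∈ redCyclesW w b := by
      rw [mem_redCyclesW_iff_component]
      intro n
      rw [hc]
      refine sum_mem fun j _ => ?_
      split_ifs with h
      · rw [h]
        exact (z j).2
      · exact zero_mem _
    refine ⟨⟨_, hmem⟩, ?_⟩
    funext j
    rw [← hz j]
    refine Subquot.mk_congr ((hc _).trans ?_)
    rw [Finset.sum_eq_single j, if_pos rfl]
    · intro j' _ hne
      rw [if_neg]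
      intro h
      exact hne (Fin.ext (by omega))
    · intro h
      exact absurd (Finset.mem_univ j) h
  · intro x
    have h1 : f x = 0 ↔ ∀ j : Fin k, component w (m + (j : ℕ)) x ∈
        (chainsOn (S w (m + (j : ℕ))) (b + 1)).map bdry :=
      funext_iff.trans (forall_congr' fun j => Submodule.Quotient.mk_eq_zero _)
    rw [h1, mem_boundariesW]
    constructor
    · intro h n
      have hx := mem_redCyclesW_iff_component.1 x.2 n
      -- Outside the window m ≤ n < m + k there is no condition: below it S_n is empty, above it
      -- every reduced cycle bounds.
      rcases lt_or_ge n m with hn | hn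
      · have h2 := hx.1.1
        rw [hm n hn, chainsOn_empty] at h2
        rw [(Submodule.mem_bot ℤ).1 h2]
        exact zero_mem _
      · rcases lt_or_ge n (m + k) with hn' | hn'
        · have h2 := h ⟨(n - m).toNat, by omega⟩
          have h3 : m + ((n - m).toNat : ℤ) = n := by omega
          simp only [h3] at h2
          exact h2
        · exact hk n hn' hx
    · intro h j
      exact h _

end Identification

/-! ### The Euler characteristic of lattice homology. -/

section Euler

open Module

variable {h : (Fin r → ℕ) → ℕ} {δ : ℕ} {c : Fin r → ℕ} (hh : IsHilbertFunction h δ c)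
include hh

namespace IsHilbertFunction

/-- Any bound for the weights of the finitely many cubes of R(0, c) serves as `B`. -/
theorem exists_acyclic : ∃ B : ℤ, ∀ n, B ≤ n →
    (∀ K ∈ rectCubes c, weight (hilbWeight h) K ≤ n) ∧
    ∀ b, redCycles (S (hilbWeight h) n) b ≤ (chainsOn (S (hilbWeight h) n) (b + 1)).map bdry := by
  obtain ⟨B, hB⟩ := ((rectCubes c).image (weight (hilbWeight h))).exists_le
  replace hB : ∀ K ∈ rectCubes c, weight (hilbWeight h) K ≤ B :=
    fun K hK => hB _ (Finset.mem_image_of_mem _ hK)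
  refine ⟨B, fun n hn => ?_⟩
  have hn' : ∀ K ∈ rectCubes c, weight (hilbWeight h) K ≤ n := fun K hK => (hB K hK).trans hn
  refine ⟨hn', fun b z hz => ?_⟩
  obtain ⟨y, hy, rfl⟩ := hh.acyclic hn' hz.1.1 (LinearMap.mem_ker.1 hz.1.2) (LinearMap.mem_ker.1 hz.2)
  exact ⟨y, hy, rfl⟩

theorem chiTop_S {c' : Fin r → ℕ} (hc : c ≤ c') (n : ℤ) : chiTop (S (hilbWeight h) n) =
    ∑ K ∈ rectCubes c', if weight (hilbWeight h) K ≤ n then (-1 : ℤ) ^ K.2.card else 0 := by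
  rw [chiTop_eq (isComplex_S _ n) (hh.S_finite n), hh.sum_S_eq hc]

theorem minW_le_weight (K : Cube r) : minW (hilbWeight h) ≤ weight (hilbWeight h) K :=
  (hh.isLeast_minW.2 ⟨K.1, rfl⟩).trans (le_weight _ K)

/-- The window runs from m_w to the bound of `exists_acyclic`. The weight bound is kept for the
count in `eu_eq`. -/
theorem exists_HHred_addEquiv : ∃ k : ℕ,
    (∀ K ∈ rectCubes c, weight (hilbWeight h) K ≤ minW (hilbWeight h) + k) ∧
    ∀ b, Nonempty (HHred (hilbWeight h) b ≃+
      ∀ j : Fin k, redH (S (hilbWeight h) (minW (hilbWeight h) + (j : ℕ))) b) := by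
  obtain ⟨B, hB⟩ := hh.exists_acyclic
  refine ⟨(B - minW (hilbWeight h)).toNat, (hB _ (by omega)).1, fun b => ?_⟩
  exact nonempty_HHred_addEquiv (fun n hn => hh.S_eq_empty hn) b
    fun n hn => (hB n (by omega)).2 b

theorem finite_redH (n : ℤ) (b : ℕ) : Module.Finite ℤ (redH (S (hilbWeight h) n) b) := by
  have := finite_redCycles (hh.S_finite n) b
  exact finite_subquot _ _

theorem finite_HHred (b : ℕ) : Module.Finite ℤ (HHred (hilbWeight h) b) := by
  obtain ⟨k, -, hk⟩ := hh.exists_HHred_addEquiv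
  obtain ⟨e⟩ := hk b
  have := fun j : Fin k => hh.finite_redH (minW (hilbWeight h) + (j : ℕ)) b
  exact finite_of_addEquiv e.symm

theorem finite_HHDeg (b : ℕ) (D : ℤ) : Module.Finite ℤ (HHDeg (hilbWeight h) b D) := by
  by_cases hD : ∃ n, D = -2 * n
  · obtain ⟨n, rfl⟩ := hD
    obtain ⟨e⟩ := nonempty_HHDeg_addEquiv (w := hilbWeight h) n b
    have := finite_H (hh.S_finite n) b
    exact finite_of_addEquiv e
  · push Not at hD
    have := subsingleton_HHDeg (w := hilbWeight h) hD b
    infer_instance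

theorem sum_neg_one_pow_mul_finrank_redH {n : ℤ} (hn : minW (hilbWeight h) ≤ n) :
    ∑ b ∈ Finset.range (r + 1), (-1 : ℤ) ^ b * (finrank ℤ (redH (S (hilbWeight h) n) b) : ℤ) =
      chiTop (S (hilbWeight h) n) - 1 := by
  obtain ⟨l, hl⟩ := hh.exists_vertex_mem hn
  simp_rw [finrank_redH (isComplex_S _ n) (hh.S_finite n) hl, mul_sub]
  rw [Finset.sum_sub_distrib, chiTop]
  congr 1
  simp

/-- The Euler characteristic of the lattice homology is the delta invariant. -/
theorem eu_eq : eu (hilbWeight h) = δ := by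
  obtain ⟨k, hk, he⟩ := hh.exists_HHred_addEquiv
  set m := minW (hilbWeight h) with hm
  have h1 : ∀ b, (finrank ℤ (HHred (hilbWeight h) b) : ℤ) =
      ∑ j : Fin k, (finrank ℤ (redH (S (hilbWeight h) (m + (j : ℕ))) b) : ℤ) := by
    intro b
    obtain ⟨e⟩ := he b
    have := fun j : Fin k => hh.finite_redH (m + (j : ℕ)) b
    rw [finrank_eq_of_addEquiv e, finrank_pi_of_isDomain]
    push_cast
    rfl
  have h2 : ∑ b ∈ Finset.range (r + 1), (-1 : ℤ) ^ b * (finrank ℤ (HHred (hilbWeight h) b) : ℤ) =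
      ∑ j : Fin k, (chiTop (S (hilbWeight h) (m + (j : ℕ))) - 1) := by
    simp_rw [h1, Finset.mul_sum]
    rw [Finset.sum_comm]
    exact Finset.sum_congr rfl fun j _ => hh.sum_neg_one_pow_mul_finrank_redH (by omega)
  -- After exchanging the sums, a cube K counts once for each n from w(K) to m + k - 1, that is m +
  -- k - w(K) times; `sum_rectCubes_weight` then produces δ.
  have h3 : ∑ j : Fin k, chiTop (S (hilbWeight h) (m + (j : ℕ))) = m + k + δ := by
    simp_rw [hh.chiTop_S le_rfl]
    rw [Finset.sum_comm]
    have h4 : ∀ K ∈ rectCubes c, ∑ j : Fin k, (if weight (hilbWeight h) K ≤ m + (j : ℕ) then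
        (-1 : ℤ) ^ K.2.card else 0) =
        (m + k) * (-1) ^ K.2.card - (-1) ^ K.2.card * weight (hilbWeight h) K := by
      intro K hK
      have h5 := hh.minW_le_weight K
      have h6 := hk K hK
      obtain ⟨a, ha⟩ : ∃ a : ℕ, weight (hilbWeight h) K = m + a :=
        ⟨(weight (hilbWeight h) K - m).toNat, by omega⟩
      have h7 : a ≤ k := by omega
      rw [Fin.sum_univ_eq_sum_range (fun j => if weight (hilbWeight h) K ≤ m + (j : ℕ) then
        (-1 : ℤ) ^ K.2.card else 0), ← Finset.sum_filter]
      have h8 : (Finset.range k).filter (fun j => weight (hilbWeight h) K ≤ m + (j : ℕ)) =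
          Finset.Ico a k := by
        ext j
        simp only [Finset.mem_filter, Finset.mem_range, Finset.mem_Ico, ha]
        omega
      rw [h8, Finset.sum_const, Nat.card_Ico, nsmul_eq_mul, ha, Nat.cast_sub h7]
      ring
    rw [Finset.sum_congr rfl h4, Finset.sum_sub_distrib, ← Finset.mul_sum, sum_rectCubes_one,
      hh.sum_rectCubes_weight le_rfl]
    ring
  rw [eu, h2, Finset.sum_sub_distrib, h3]
  simp
  ring

end IsHilbertFunction

end Euler

/-! ### Coefficients of the Poincaré series. -/

section Series

open Module

theorem coeff_laurent {R : Type*} [Zero R] {a : ℤ → R} (ha : BddBelow (Function.support a)) (n : ℤ) :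
    (laurent a).coeff n = a n := by
  rw [laurent, dif_pos ha, HahnSeries.coeff_ofSuppBddBelow]

theorem bddBelow_support {R : Type*} [Zero R] {a : ℤ → R} {m : ℤ} (h : ∀ n < m, a n = 0) :
    BddBelow (Function.support a) :=
  ⟨m, fun n hn => not_lt.1 fun hlt => hn (h n hlt)⟩

theorem laurent_eq_of_coeff {R : Type*} [Zero R] {P : LaurentSeries R} {a : ℤ → R} {m : ℤ}
    (ha : ∀ n < m, a n = 0) (h : ∀ n, P.coeff n = a n) : P = laurent a :=
  HahnSeries.ext (funext fun n => by rw [h, coeff_laurent (bddBelow_support ha)])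

theorem coeff_geom (n : ℤ) : geom.coeff n = if 0 ≤ n then 1 else 0 := by
  have h := PowerSeries.coeff_coe (PowerSeries.mk (1 : ℕ → ℤ)) n
  rw [geom]
  refine h.trans ?_
  split_ifs <;> first | omega | simp

/-- Multiplication by 1 / (1 - Q) replaces coefficients by their partial sums. -/
theorem coeff_geom_mul_rectEuler (w : (Fin r → ℕ) → ℤ) (c' : Fin r → ℕ) (n : ℤ) :
    (geom * rectEuler w c').coeff n =
      ∑ K ∈ rectCubes c', if weight w K ≤ n then (-1 : ℤ) ^ K.2.card else 0 := by
  rw [rectEuler, Finset.mul_sum, HahnSeries.coeff_sum]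
  refine Finset.sum_congr rfl fun K _ => ?_
  rw [HahnSeries.coeff_mul_single, coeff_geom, ite_mul, one_mul, zero_mul]
  simp only [sub_nonneg]

variable {w : (Fin r → ℕ) → ℤ} {n : ℤ}

theorem coeff_PEcoeff (k : ℕ∞) (d : ℕ) : PowerSeries.coeff d (PEcoeff w k n) =
    ∑ b ∈ Finset.range (r + 1), Polynomial.monomial b (finrank ℤ (Page w n k d b) : ℤ) := by
  rw [PEcoeff, PowerSeries.coeff_mk]

theorem coeff_PEcoeff_eq_zero {D : ℕ} (hD : ∀ K ∈ S w n, level K ≤ D) {d : ℕ} (hd : D < d) :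
    PowerSeries.coeff d (PEcoeff w ⊤ n) = 0 := by
  rw [coeff_PEcoeff]
  refine Finset.sum_eq_zero fun b _ => ?_
  rw [page_eq_zero hD hd, Nat.cast_zero, map_zero]

theorem finsum_coeff_PEcoeff (hf : (S w n).Finite) {D : ℕ} (hD : ∀ K ∈ S w n, level K ≤ D) :
    ∑ᶠ d : ℕ, PowerSeries.coeff d (PEcoeff w ⊤ n) =
      ∑ b ∈ Finset.range (r + 1), Polynomial.monomial b (finrank ℤ (H (S w n) b) : ℤ) := by
  rw [finsum_eq_sum_of_support_subset (s := Finset.range (D + 1))]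
  · simp_rw [coeff_PEcoeff]
    rw [Finset.sum_comm]
    refine Finset.sum_congr rfl fun b _ => ?_
    rw [← sum_finrank_page hf hD, Nat.cast_sum, map_sum]
  · intro d hd
    rw [Finset.coe_range, Set.mem_Iio]
    by_contra hlt
    exact hd (coeff_PEcoeff_eq_zero hD (by omega))

theorem finrank_H_of_S_eq_empty (h : S w n = ∅) (b : ℕ) : finrank ℤ (H (S w n) b) = 0 := by
  have : Subsingleton (H (S w n) b) :=
    Submodule.Quotient.subsingleton_iff.2
      (Submodule.submoduleOf_eq_top.2 (by rw [h, chainsOn_empty, bot_inf_eq]; exact bot_le))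
  exact finrank_zero_of_subsingleton

theorem PEcoeff_eq_zero (h : S w n = ∅) : PEcoeff w ⊤ n = 0 := by
  ext1 d
  rw [coeff_PEcoeff, map_zero]
  refine Finset.sum_eq_zero fun b _ => ?_
  have h1 : pageZ w n ⊤ d b = ⊥ := by
    have : SX w n d = ∅ := Set.subset_empty_iff.1 fun K hK => h ▸ hK.1
    rw [pageZ_top, this, chainsOn_empty, bot_inf_eq]
  have : Subsingleton (Page w n ⊤ d b) :=
    Submodule.Quotient.subsingleton_iff.2 (Submodule.submoduleOf_eq_top.2 (by rw [h1]; exact bot_le))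
  rw [finrank_zero_of_subsingleton, Nat.cast_zero, map_zero]

theorem coeff_sum_monomial (f : ℕ → ℤ) (m b : ℕ) :
    (∑ i ∈ Finset.range m, Polynomial.monomial i (f i)).coeff b = if b < m then f b else 0 := by
  rw [Polynomial.finsetSum_coeff]
  simp [Polynomial.coeff_monomial]

namespace IsHilbertFunction

variable {h : (Fin r → ℕ) → ℕ} {δ : ℕ} {c : Fin r → ℕ} (hh : IsHilbertFunction h δ c)
include hh

theorem bddBelow_support_PEcoeff : BddBelow (Function.support (PEcoeff (hilbWeight h) ⊤)) :=
  bddBelow_support fun _ hn => PEcoeff_eq_zero (hh.S_eq_empty hn)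

/-- The coefficients of `PE_∞(1, Q, h)` are the Poincaré polynomials of the `S_n`. -/
theorem coeff_atTOne (n : ℤ) : (atTOne (PE (hilbWeight h) ⊤)).coeff n =
    ∑ b ∈ Finset.range (r + 1),
      Polynomial.monomial b (finrank ℤ (H (S (hilbWeight h) n) b) : ℤ) := by
  have h1 : ∀ n, ∑ᶠ d : ℕ, PowerSeries.coeff d ((PE (hilbWeight h) ⊤).coeff n) =
      ∑ b ∈ Finset.range (r + 1),
        Polynomial.monomial b (finrank ℤ (H (S (hilbWeight h) n) b) : ℤ) := by
    intro n
    rw [PE, coeff_laurent hh.bddBelow_support_PEcoeff]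
    exact finsum_coeff_PEcoeff (hh.S_finite n) fun K hK => hh.level_le hK
  rw [atTOne, coeff_laurent, h1]
  refine bddBelow_support (m := minW (hilbWeight h)) fun n hn => ?_
  rw [h1]
  refine Finset.sum_eq_zero fun b _ => ?_
  rw [finrank_H_of_S_eq_empty (hh.S_eq_empty hn), Nat.cast_zero, map_zero]

theorem chiTop_of_lt {n : ℤ} (hn : n < minW (hilbWeight h)) : chiTop (S (hilbWeight h) n) = 0 := by
  refine Finset.sum_eq_zero fun b _ => ?_
  rw [finrank_H_of_S_eq_empty (hh.S_eq_empty hn), Nat.cast_zero, mul_zero]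

theorem coeff_atH_neg_one (n : ℤ) :
    (atH (-1) (atTOne (PE (hilbWeight h) ⊤))).coeff n = chiTop (S (hilbWeight h) n) := by
  have : (atH (-1) (atTOne (PE (hilbWeight h) ⊤))).coeff n =
      Polynomial.evalRingHom (-1) ((atTOne (PE (hilbWeight h) ⊤)).coeff n) := rfl
  rw [this, hh.coeff_atTOne, map_sum, chiTop]
  refine Finset.sum_congr rfl fun b _ => ?_
  rw [Polynomial.coe_evalRingHom, Polynomial.eval_monomial, mul_comm]

theorem coeff_atH_zero (n : ℤ) :
    (atH 0 (atTOne (PE (hilbWeight h) ⊤))).coeff n = finrank ℤ (H (S (hilbWeight h) n) 0) := by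
  have : (atH 0 (atTOne (PE (hilbWeight h) ⊤))).coeff n =
      Polynomial.evalRingHom 0 ((atTOne (PE (hilbWeight h) ⊤)).coeff n) := rfl
  rw [this, hh.coeff_atTOne, Polynomial.coe_evalRingHom, ← Polynomial.coeff_zero_eq_eval_zero,
    coeff_sum_monomial, if_pos (Nat.succ_pos r)]

theorem atH_neg_one_eq {c' : Fin r → ℕ} (hc : c ≤ c') :
    atH (-1) (atTOne (PE (hilbWeight h) ⊤)) = geom * rectEuler (hilbWeight h) c' :=
  HahnSeries.ext (funext fun n => by
    rw [hh.coeff_atH_neg_one, hh.chiTop_S hc, coeff_geom_mul_rectEuler])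

end IsHilbertFunction

end Series

/-! ### Convergence and the limit at Q = 1. -/

section Convergence

theorem hasSum_geometric_int (m : ℤ) {Q : ℂ} (hQ : Q ≠ 0) (hQ' : ‖Q‖ < 1) :
    HasSum (fun n : ℤ => if m ≤ n then Q ^ n else 0) (1 / (1 - Q) * Q ^ m) := by
  -- Terms with n < m vanish, so the sum over ℤ is a geometric series reindexed by n = m + j.
  have hinj : Function.Injective fun j : ℕ => m + (j : ℤ) := fun a b h => by simpa using h
  rw [← hinj.hasSum_iff]
  · have h1 := (hasSum_geometric_of_norm_lt_one hQ').mul_right (Q ^ m)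
    rw [← one_div] at h1
    refine h1.congr_fun fun j => ?_
    simp only [Function.comp]
    rw [if_pos (by omega), zpow_add₀ hQ, zpow_natCast, mul_comm]
  · intro n hn
    rw [if_neg]
    intro h
    exact hn ⟨(n - m).toNat, by simp only; omega⟩

/-- Convergence of the expansion of the rational function `(1 - Q)⁻¹ ∑_{□ ⊂ R(0, c')} ±Q^{w(□)}`. -/
theorem hasSum_rectEuler (w : (Fin r → ℕ) → ℤ) (c' : Fin r → ℕ) {Q : ℂ} (hQ : Q ≠ 0)
    (hQ' : ‖Q‖ < 1) :
    HasSum (fun n : ℤ => ((geom * rectEuler w c').coeff n : ℂ) * Q ^ n)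
      (1 / (1 - Q) * ∑ K ∈ rectCubes c', (-1) ^ K.2.card * Q ^ weight w K) := by
  have h1 : HasSum (fun n : ℤ => ∑ K ∈ rectCubes c',
      (-1 : ℂ) ^ K.2.card * if weight w K ≤ n then Q ^ n else 0)
      (∑ K ∈ rectCubes c', (-1) ^ K.2.card * (1 / (1 - Q) * Q ^ weight w K)) :=
    hasSum_sum fun K _ => (hasSum_geometric_int (weight w K) hQ hQ').mul_left _
  convert h1 using 1
  · funext n
    rw [coeff_geom_mul_rectEuler, Int.cast_sum, Finset.sum_mul]
    refine Finset.sum_congr rfl fun K _ => ?_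
    split_ifs <;> simp
  · rw [Finset.mul_sum]
    exact Finset.sum_congr rfl fun K _ => by ring

/-- The expression is minus the difference quotient at 1 of the Laurent polynomial g, since g(1) =
1; and g'(1) is the alternating sum of the weights, which is -δ. -/
theorem IsHilbertFunction.tendsto_rectEuler {h : (Fin r → ℕ) → ℕ} {δ : ℕ} {c : Fin r → ℕ}
    (hh : IsHilbertFunction h δ c) {c' : Fin r → ℕ} (hc : c ≤ c') :
    Tendsto (fun Q : ℂ => (1 / (1 - Q)) * ∑ K ∈ rectCubes c',
        (-1) ^ K.2.card * Q ^ weight (hilbWeight h) K - 1 / (1 - Q)) (𝓝[≠] 1) (𝓝 (δ : ℂ)) := by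
  set g : ℂ → ℂ := fun Q => ∑ K ∈ rectCubes c', (-1) ^ K.2.card * Q ^ weight (hilbWeight h) K
  have hg : HasDerivAt g (-(δ : ℂ)) 1 := by
    have h1 : HasDerivAt g (∑ K ∈ rectCubes c', (-1) ^ K.2.card *
        ((weight (hilbWeight h) K : ℂ) * 1 ^ (weight (hilbWeight h) K - 1))) 1 :=
      HasDerivAt.fun_sum fun K _ => (hasDerivAt_zpow _ _ (.inl one_ne_zero)).const_mul _
    convert h1 using 1
    simp_rw [one_zpow, mul_one]
    have h2 := congrArg (Int.cast : ℤ → ℂ) (hh.sum_rectCubes_weight hc)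
    push_cast at h2
    exact h2.symm
  have hg1 : g 1 = 1 := by
    have h2 := congrArg (Int.cast : ℤ → ℂ) (sum_rectCubes_one c')
    push_cast at h2
    simpa [g] using h2
  have h3 := hg.tendsto_slope.neg
  rw [neg_neg] at h3
  refine h3.congr' ?_
  filter_upwards [self_mem_nhdsWithin] with Q hQ
  have hQ1 : Q - 1 ≠ 0 := sub_ne_zero.2 hQ
  have hQ2 : 1 - Q ≠ 0 := sub_ne_zero.2 (Ne.symm hQ)
  rw [slope_def_field, hg1]
  change _ = 1 / (1 - Q) * g Q - 1 / (1 - Q)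
  field_simp
  ring

end Convergence

end LatticeHomology

end

/-! ### The theorem for curve germs. -/

theorem proposition4p3 {r : ℕ} (C : CurveGerm r) :
    -- all the objects below are well defined, and the pages stabilize to the `∞`-page
    (FiniteDimensional ℂ (Branches r ⧸ C.O.toSubmodule) ∧
      (∀ l, FiniteDimensional ℂ (Subquot C.O.toSubmodule (C.F l))) ∧
      C.conductorIdeal = {g | ∀ i, (C.conductor i : ℕ∞) ≤ ord (g i)} ∧
      IsLeast (Set.range C.w₀) (minW C.w₀) ∧
      (∀ n, (S C.w₀ n).Finite) ∧
      (∀ n, ∃ k₀ : ℕ, ∀ k : ℕ, k₀ ≤ k → ∀ d b : ℕ,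
        pageZ C.w₀ n k d b = pageZ C.w₀ n ⊤ d b ∧ pageB C.w₀ n k d b = pageB C.w₀ n ⊤ d b) ∧
      (∀ b D, Module.Finite ℤ (HHDeg C.w₀ b D)) ∧
      (∀ b, Module.Finite ℤ (HHred C.w₀ b)) ∧
      BddBelow (Function.support (PEcoeff C.w₀ ⊤)) ∧
      (∀ n, {d : ℕ | PowerSeries.coeff d (PEcoeff C.w₀ ⊤ n) ≠ 0}.Finite)) ∧
    -- (a)
    (atTOne (PE C.w₀ ⊤) =
        laurent (fun n => if minW C.w₀ ≤ n then
          ∑ b ∈ Finset.range (r + 1),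
            Polynomial.monomial b (Module.finrank ℤ (H (S C.w₀ n) b) : ℤ) else 0) ∧
      atTOne (PE C.w₀ ⊤) =
        laurent (fun n => ∑ b ∈ Finset.range (r + 1),
          Polynomial.monomial b (Module.finrank ℤ (HHDeg C.w₀ b (-2 * n)) : ℤ))) ∧
    -- (b)
    atH (-1) (atTOne (PE C.w₀ ⊤)) =
      laurent (fun n => if minW C.w₀ ≤ n then chiTop (S C.w₀ n) else 0) ∧
    -- (c)
    (∀ c' : Fin r → ℕ, C.conductor ≤ c' →
      atH (-1) (atTOne (PE C.w₀ ⊤)) = geom * rectEuler C.w₀ c') ∧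
    -- (d)
    ((∀ Q : ℂ, Q ≠ 0 → ‖Q‖ < 1 →
        Summable fun n : ℤ => ((atH (-1) (atTOne (PE C.w₀ ⊤))).coeff n : ℂ) * Q ^ n) ∧
      Tendsto (fun Q : ℂ => evalAt (atH (-1) (atTOne (PE C.w₀ ⊤))) Q - 1 / (1 - Q))
        (𝓝[Metric.ball 0 1] 1) (𝓝 (eu C.w₀ : ℂ)) ∧
      (∀ c' : Fin r → ℕ, C.conductor ≤ c' →
        Tendsto (fun Q : ℂ =>
            (1 / (1 - Q)) * ∑ c ∈ rectCubes c', (-1) ^ c.2.card * Q ^ weight C.w₀ c - 1 / (1 - Q))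
          (𝓝[≠] 1) (𝓝 (eu C.w₀ : ℂ))) ∧
      eu C.w₀ = (C.delta : ℤ)) ∧
    -- (e)
    (SeriesGE (atTOne (PE C.w₀ ⊤)) (constH (atH 0 (atTOne (PE C.w₀ ⊤)))) ∧
      SeriesGE (constH (atH 0 (atTOne (PE C.w₀ ⊤)))) (constH geom) ∧
      {n : ℤ | (atH 0 (atTOne (PE C.w₀ ⊤)) - geom).coeff n ≠ 0}.Finite) := by
  have hh := C.isHilbertFunction
  have hw : C.w₀ = hilbWeight C.hilb := rfl
  rw [hw]
  have hbelow : ∀ n < minW (hilbWeight C.hilb), ∑ b ∈ Finset.range (r + 1),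
      Polynomial.monomial b (Module.finrank ℤ (H (S (hilbWeight C.hilb) n) b) : ℤ) = 0 :=
    fun n hn => Finset.sum_eq_zero fun b _ => by
      rw [finrank_H_of_S_eq_empty (hh.S_eq_empty hn), Nat.cast_zero, map_zero]
  have hdisc : ∀ᶠ Q in 𝓝[Metric.ball (0 : ℂ) 1] 1, Q ≠ 0 ∧ ‖Q‖ < 1 := by
    filter_upwards [self_mem_nhdsWithin, nhdsWithin_le_nhds (isOpen_ne.mem_nhds one_ne_zero)]
      with Q hQ hQ0
    exact ⟨hQ0, by simpa using hQ⟩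
  -- The open disc omits 1, so its limit follows from the punctured one.
  have hle : 𝓝[Metric.ball (0 : ℂ) 1] 1 ≤ 𝓝[≠] 1 := by
    refine nhdsWithin_mono _ fun Q hQ h1 => ?_
    rw [Set.mem_singleton_iff.1 h1] at hQ
    simp at hQ
  refine ⟨⟨C.finite_quotient_O, C.finite_quotient_F, C.conductorIdeal_eq, hh.isLeast_minW,
    hh.S_finite, fun n => ⟨(n + 2 * C.delta).toNat + 1, fun k hk d b =>
      page_stabilizes (fun K hK => hh.level_le hK) hk d b⟩, hh.finite_HHDeg, hh.finite_HHred,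
    hh.bddBelow_support_PEcoeff, fun n => ?_⟩, ⟨?_, ?_⟩, ?_, fun c' hc => hh.atH_neg_one_eq hc,
    ⟨fun Q hQ hQ' => ?_, ?_, fun c' hc => ?_, hh.eu_eq⟩, fun n b => ?_, fun n b => ?_, ?_⟩
  · refine (Set.finite_Iic (n + 2 * C.delta).toNat).subset fun d hd => ?_
    rw [Set.mem_Iic]
    by_contra hlt
    exact hd (coeff_PEcoeff_eq_zero (fun K hK => hh.level_le hK) (not_le.1 hlt))
  · refine laurent_eq_of_coeff (m := minW (hilbWeight C.hilb)) (fun n hn => if_neg hn.not_ge)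
      fun n => ?_
    rw [hh.coeff_atTOne]
    split_ifs with hn
    · rfl
    · exact hbelow n (not_le.1 hn)
  · have heq : ∀ n, ∑ b ∈ Finset.range (r + 1), Polynomial.monomial b
        (Module.finrank ℤ (HHDeg (hilbWeight C.hilb) b (-2 * n)) : ℤ) =
        ∑ b ∈ Finset.range (r + 1), Polynomial.monomial b
          (Module.finrank ℤ (H (S (hilbWeight C.hilb) n) b) : ℤ) := by
      intro n
      refine Finset.sum_congr rfl fun b _ => ?_
      obtain ⟨e⟩ := nonempty_HHDeg_addEquiv (w := hilbWeight C.hilb) n b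
      rw [finrank_eq_of_addEquiv e]
    refine laurent_eq_of_coeff (m := minW (hilbWeight C.hilb)) (fun n hn => ?_) fun n => ?_
    · rw [heq, hbelow n hn]
    · rw [hh.coeff_atTOne, heq]
  · refine laurent_eq_of_coeff (m := minW (hilbWeight C.hilb)) (fun n hn => if_neg hn.not_ge)
      fun n => ?_
    rw [hh.coeff_atH_neg_one]
    split_ifs with hn
    · rfl
    · exact hh.chiTop_of_lt (not_le.1 hn)
  · rw [hh.atH_neg_one_eq le_rfl]
    exact (hasSum_rectEuler _ _ hQ hQ').summable
  · rw [hh.eu_eq, hh.atH_neg_one_eq le_rfl, Int.cast_natCast]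
    refine ((hh.tendsto_rectEuler le_rfl).mono_left hle).congr' ?_
    filter_upwards [hdisc] with Q hQ
    rw [evalAt, (hasSum_rectEuler _ _ hQ.1 hQ.2).tsum_eq]
  · rw [hh.eu_eq, Int.cast_natCast]
    exact hh.tendsto_rectEuler hc
  · have h1 : (constH (atH 0 (atTOne (PE (hilbWeight C.hilb) ⊤)))).coeff n =
        Polynomial.C ((atH 0 (atTOne (PE (hilbWeight C.hilb) ⊤))).coeff n) := rfl
    rw [HahnSeries.coeff_sub, h1, hh.coeff_atTOne, hh.coeff_atH_zero, Polynomial.coeff_sub,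
      coeff_sum_monomial, Polynomial.coeff_C]
    split_ifs with h2 h3 h3
    · rw [h3, sub_self]
    · rw [sub_zero]
      exact Int.natCast_nonneg _
    · omega
    · rw [sub_zero]
  · have h1 : (constH (atH 0 (atTOne (PE (hilbWeight C.hilb) ⊤)))).coeff n =
        Polynomial.C ((atH 0 (atTOne (PE (hilbWeight C.hilb) ⊤))).coeff n) := rfl
    have h2 : (constH geom).coeff n = Polynomial.C (geom.coeff n) := rfl
    rw [HahnSeries.coeff_sub, h1, h2, hh.coeff_atH_zero, ← Polynomial.C_sub, Polynomial.coeff_C,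
      coeff_geom]
    split_ifs with h3 h4
    -- As w(0) = 0, m_w ≤ 0 ≤ n; hence S_n has a vertex and its zeroth Betti number is positive.
    · obtain ⟨l, hl⟩ := hh.exists_vertex_mem (hh.minW_le_zero.trans h4)
      have := one_le_finrank_H_zero (isComplex_S _ n) (hh.S_finite n) hl
      omega
    · rw [sub_zero]
      exact Int.natCast_nonneg _
    · exact le_rfl
  · obtain ⟨B, hB⟩ := hh.exists_acyclic
    -- Below m_w ≤ 0 both coefficients are 0; from `max B 0` on both are 1.
    refine (Set.finite_Ico (minW (hilbWeight C.hilb)) (max B 0)).subset fun n hn => ?_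
    rw [Set.mem_ofPred_eq, HahnSeries.coeff_sub, hh.coeff_atH_zero, coeff_geom] at hn
    by_contra hnot
    rw [Set.mem_Ico, not_and_or, not_le, not_lt] at hnot
    refine hn ?_
    have hmin := hh.minW_le_zero
    rcases hnot with h1 | h1
    · rw [finrank_H_of_S_eq_empty (hh.S_eq_empty h1), if_neg (by omega)]
      rfl
    · have hn0 : 0 ≤ n := (le_max_right _ _).trans h1
      obtain ⟨l, hl⟩ := hh.exists_vertex_mem (hmin.trans hn0)
      rw [finrank_H_zero_of_acyclic (isComplex_S _ n) (hh.S_finite n) hl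
        ((hB n ((le_max_left _ _).trans h1)).2 0), if_pos hn0]
      rfl
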